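/- For a non-negative integer $d$, the problem $d$-Out-Degree SCC Deletion is the following: given a finite digraph $D$ and a non-negative integer $k$, decide whether there is a set $X\subseteq V(D)$ with $|X|\le k$ such that, for every strong component $C$ of $D-X$, every vertex of the induced digraph $(D-X)[C]$ has out-degree at most $d$ in $(D-X)[C]$. Theorem. $d$-Out-Degree SCC Deletion can be solved in time $2^{O(k^3\log k)}\cdot n^{O(1)}$ for every fixed $d$, where $n=|V(D)|$, and it is fixed-parameter tractable in $k$ and $d$ together. Precisely: there are a single algorithm, a computable function $f:\mathbb N\to\mathbb N$ and constants $a,c\in\mathbb N$ such that, for all $d$, all finite digraphs $D$ on $n$ vertices (given by $n$ and the adjacency matrix) and all $k\ge 0$, the algorithm, given $(d,k,D)$, halts with the correct answer after at most $$f(d)\cdot 2^{a\,k^3\log_2 k}\cdot (n+1)^{c}$$ steps (with $k^3\log_2 k$ read as $0$ for $k=0$). The algorithm is a program for a unit-cost machine on numbers and pointers, whose arithmetic is addition, subtraction and comparison; this model is polynomially equivalent to random access machines and to Turing machines. -/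

import Mathlib

/-! ### Digraphs, strong components and the deletion problem -/

namespace SCCDeletion

/-- The subdigraph `D[S]` of `D` induced by `S`. -/
def induce {V : Type*} (D : Digraph V) (S : Set V) : Digraph S where
  Adj u v := D.Adj u.1 v.1

/-- `D - X`: the subdigraph induced by the vertices outside `X`. -/
def deleteVerts {V : Type*} (D : Digraph V) (X : Set V) : Digraph (Xᶜ : Set V) :=
  induce D Xᶜ

/-- There is a directed path (possibly of length zero) from `u` to `v` in `D`. -/
def Reachable {V : Type*} (D : Digraph V) (u v : V) : Prop :=
  Relation.ReflTransGen D.Adj u v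

/-- A strong component: a maximal nonempty set of pairwise mutually reachable vertices. -/
def IsStrongComponent {V : Type*} (D : Digraph V) (S : Set V) : Prop :=
  Maximal (fun T : Set V => T.Nonempty ∧ ∀ u ∈ T, ∀ v ∈ T, Reachable D u v) S

/-- The out-degree of `v`: the number of out-neighbours of `v`. -/
noncomputable def outDegree {V : Type*} (D : Digraph V) (v : V) : ℕ :=
  {u : V | D.Adj v u}.ncard

/-- Every strong component of `D` induces a digraph in which all out-degrees are at most `d`. -/
def StrongComponentsOutDegreeLE {V : Type*} (D : Digraph V) (d : ℕ) : Prop :=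
  ∀ S : Set V, IsStrongComponent D S → ∀ v : S, outDegree (induce D S) v ≤ d

/-- `(D, k)` is a yes-instance of `d`-Out-Degree SCC Deletion: at most `k` vertices can be deleted
so that every strong component of the rest induces a digraph of out-degree at most `d`. -/
def IsYesInstance {V : Type*} (d : ℕ) (D : Digraph V) (k : ℕ) : Prop :=
  ∃ X : Finset V, X.card ≤ k ∧ StrongComponentsOutDegreeLE (deleteVerts D (X : Set V)) d

end SCCDeletion

/-! ### The machine model

Programs are finite lists of mutually recursive first-order functions over pointer structures whose
leaves are natural numbers. Every elementary operation (variable access, constant, allocation of a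
pair, projection, shape test, addition, truncated subtraction, comparison, branching, local binding,
function call) costs one unit. A step is executed by a unit-cost random access machine with addition
and subtraction (and no multiplication) in constant time for a fixed program, and conversely such a
machine is simulated with polynomial overhead, so the model is polynomially equivalent to random
access machines and to Turing machines. -/

namespace RecProg

/-- Values: a machine number, or a (pointer to a) pair of values. -/
inductive Val : Type
  | num (n : ℕ) : Val
  | pair (a b : Val) : Val

/-- The number stored in a value; a pair counts as `0`. -/
def Val.toNat : Val → ℕ
  | .num n => n
  | .pair _ _ => 0

/-- First component; `0` for a number. -/
def Val.fst : Val → Val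
  | .num _ => .num 0
  | .pair a _ => a

/-- Second component; `0` for a number. -/
def Val.snd : Val → Val
  | .num _ => .num 0
  | .pair _ b => b

/-- `1` for a pair and `0` for a number. -/
def Val.shape : Val → ℕ
  | .num _ => 0
  | .pair _ _ => 1

/-- Expressions. Variables are positions in the list of local bindings, innermost first;
functions are named by their position in the program and take one argument. -/
inductive Expr : Type
  | var (i : ℕ) : Expr
  | const (n : ℕ) : Expr
  | pair (e₁ e₂ : Expr) : Expr
  | fst (e : Expr) : Expr
  | snd (e : Expr) : Expr
  | isPair (e : Expr) : Expr
  | add (e₁ e₂ : Expr) : Expr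
  | sub (e₁ e₂ : Expr) : Expr
  | le (e₁ e₂ : Expr) : Expr
  | ite (c e₁ e₂ : Expr) : Expr
  | bind (e₁ e₂ : Expr) : Expr
  | call (f : ℕ) (e : Expr) : Expr

/-- A program: the list of its function bodies. Function `0` is the entry point. -/
abbrev Program : Type := List Expr

/-- `Eval P env e v t`: in the program `P`, the expression `e` evaluates under the local bindings
`env` to the value `v` in exactly `t` steps (call by value). -/
inductive Eval (P : Program) : List Val → Expr → Val → ℕ → Prop
  | var {env : List Val} {i : ℕ} : Eval P env (.var i) (env.getD i (.num 0)) 1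
  | const {env : List Val} {n : ℕ} : Eval P env (.const n) (.num n) 1
  | pair {env : List Val} {e₁ e₂ : Expr} {v₁ v₂ : Val} {t₁ t₂ : ℕ} :
      Eval P env e₁ v₁ t₁ → Eval P env e₂ v₂ t₂ →
      Eval P env (.pair e₁ e₂) (.pair v₁ v₂) (t₁ + t₂ + 1)
  | fst {env : List Val} {e : Expr} {v : Val} {t : ℕ} :
      Eval P env e v t → Eval P env (.fst e) v.fst (t + 1)
  | snd {env : List Val} {e : Expr} {v : Val} {t : ℕ} :
      Eval P env e v t → Eval P env (.snd e) v.snd (t + 1)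
  | isPair {env : List Val} {e : Expr} {v : Val} {t : ℕ} :
      Eval P env e v t → Eval P env (.isPair e) (.num v.shape) (t + 1)
  | add {env : List Val} {e₁ e₂ : Expr} {v₁ v₂ : Val} {t₁ t₂ : ℕ} :
      Eval P env e₁ v₁ t₁ → Eval P env e₂ v₂ t₂ →
      Eval P env (.add e₁ e₂) (.num (v₁.toNat + v₂.toNat)) (t₁ + t₂ + 1)
  | sub {env : List Val} {e₁ e₂ : Expr} {v₁ v₂ : Val} {t₁ t₂ : ℕ} :
      Eval P env e₁ v₁ t₁ → Eval P env e₂ v₂ t₂ →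
      Eval P env (.sub e₁ e₂) (.num (v₁.toNat - v₂.toNat)) (t₁ + t₂ + 1)
  | le {env : List Val} {e₁ e₂ : Expr} {v₁ v₂ : Val} {t₁ t₂ : ℕ} :
      Eval P env e₁ v₁ t₁ → Eval P env e₂ v₂ t₂ →
      Eval P env (.le e₁ e₂) (.num (if v₁.toNat ≤ v₂.toNat then 1 else 0)) (t₁ + t₂ + 1)
  | iteTrue {env : List Val} {c e₁ e₂ : Expr} {b v : Val} {t₁ t₂ : ℕ} :
      Eval P env c b t₁ → b.toNat ≠ 0 → Eval P env e₁ v t₂ →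
      Eval P env (.ite c e₁ e₂) v (t₁ + t₂ + 1)
  | iteFalse {env : List Val} {c e₁ e₂ : Expr} {b v : Val} {t₁ t₂ : ℕ} :
      Eval P env c b t₁ → b.toNat = 0 → Eval P env e₂ v t₂ →
      Eval P env (.ite c e₁ e₂) v (t₁ + t₂ + 1)
  | bind {env : List Val} {e₁ e₂ : Expr} {v₁ v₂ : Val} {t₁ t₂ : ℕ} :
      Eval P env e₁ v₁ t₁ → Eval P (v₁ :: env) e₂ v₂ t₂ →
      Eval P env (.bind e₁ e₂) v₂ (t₁ + t₂ + 1)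
  | call {env : List Val} {f : ℕ} {e body : Expr} {a v : Val} {t₁ t₂ : ℕ} :
      Eval P env e a t₁ → P[f]? = some body → Eval P [a] body v t₂ →
      Eval P env (.call f e) v (t₁ + t₂ + 1)

/-- The program `P`, started on the input `x`, halts with output `y` after exactly `t` steps. -/
def Runs (P : Program) (x y : Val) (t : ℕ) : Prop :=
  ∃ body : Expr, P[0]? = some body ∧ Eval P [x] body y t

/-- Evaluation is deterministic, in its result and in its number of steps. -/
theorem Eval.det {P : Program} {env : List Val} {e : Expr} {v : Val} {t : ℕ}
    (h : Eval P env e v t) : ∀ {v' : Val} {t' : ℕ}, Eval P env e v' t' → v = v' ∧ t = t' := by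
  induction h with
  | var => intro v' t' h'; cases h'; exact ⟨rfl, rfl⟩
  | const => intro v' t' h'; cases h'; exact ⟨rfl, rfl⟩
  | fst _ ih => intro v' t' h'; cases h' with | fst h => grind
  | snd _ ih => intro v' t' h'; cases h' with | snd h => grind
  | isPair _ ih => intro v' t' h'; cases h' with | isPair h => grind
  | pair _ _ ih₁ ih₂ => intro v' t' h'; cases h' with | pair h₁ h₂ => grind
  | add _ _ ih₁ ih₂ => intro v' t' h'; cases h' with | add h₁ h₂ => grind
  | sub _ _ ih₁ ih₂ => intro v' t' h'; cases h' with | sub h₁ h₂ => grind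
  | le _ _ ih₁ ih₂ => intro v' t' h'; cases h' with | le h₁ h₂ => grind
  | bind _ _ ih₁ ih₂ =>
    intro v' t' h'
    cases h' with
    | bind h₁ h₂ =>
      obtain ⟨rfl, rfl⟩ := ih₁ h₁
      obtain ⟨rfl, rfl⟩ := ih₂ h₂
      exact ⟨rfl, rfl⟩
  | iteTrue _ hb _ ih₁ ih₂ => intro v' t' h'; cases h' <;> grind
  | iteFalse _ hb _ ih₁ ih₂ => intro v' t' h'; cases h' <;> grind
  | call _ hf _ ih₁ ih₂ =>
    intro v' t' h'
    cases h' with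
    | call h₁ hf' h₂ =>
      obtain ⟨rfl, rfl⟩ := ih₁ h₁
      rw [hf] at hf'
      cases hf'
      obtain ⟨rfl, rfl⟩ := ih₂ h₂
      exact ⟨rfl, rfl⟩

/-- Lists as values: `0` is the empty list, a pair is a cons cell. -/
def Val.ofList : List Val → Val
  | [] => .num 0
  | a :: l => .pair a (Val.ofList l)

/-- Truth values as values: `1` for true, `0` for false. -/
noncomputable def Val.ofProp (p : Prop) : Val :=
  open Classical in .num (if p then 1 else 0)

end RecProg

namespace SCCDeletion

/-- The adjacency matrix of a digraph on `n` vertices, as a list of rows. -/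
noncomputable def encodeDigraph {n : ℕ} (D : Digraph (Fin n)) : RecProg.Val :=
  .ofList (List.ofFn fun u : Fin n =>
    .ofList (List.ofFn fun v : Fin n => .ofProp (D.Adj u v)))

/-- The input `(d, k, n, D)` of the deletion problem as a value. -/
noncomputable def encodeInstance {n : ℕ} (d : ℕ) (D : Digraph (Fin n)) (k : ℕ) : RecProg.Val :=
  .ofList [.num d, .num k, .num n, encodeDigraph D]

end SCCDeletion

/-!
The algorithm is iterative compression. The vertices are added one by one; a solution for the
smaller digraph together with the new vertex is a set `W` of at most `k + 1` terminals whose deletion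
leaves strong components of out-degree at most `d`, and a search tree decides whether a solution `X`
with at most `k` vertices exists (`searchFrom_initial`).

Let `H` be the set of live vertices. Call an out-neighbour of `v` returning if some terminal can be
reached from it, and `v` active if it has more than `d` returning out-neighbours. For a solution `X`,
some terminal `r` outside `X` lies in a last strong component among those of the terminals of `D - X`
(`exists_sink`), unless all terminals are deleted. The search guesses `r` and the set `A` of the
terminals reachable from `r` in `D - X`; the others form `T`. An active vertex `v` that is reachable
from `r` must have one of any `d + 1` returning out-neighbours deleted or cut off from the terminals,
since otherwise all of them lie in the strong component of `v` (`step_vertex`). If an active vertex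
lies in every minimum cut from `A` that avoids `T`, then the search branches on it; moving it to `T`
enlarges the minimum cut. Otherwise, by submodularity (`lam_uni_le`), some minimum cut avoids all
active vertices. The largest cut of this kind is deleted, and what lies inside is finished for good,
because it contains no active vertex (`Good.union`); or else a vertex of the cut belongs to `X` or can
be reached from `r`, and in the latter case the minimum cut grows (`step_finish`). A vertex that is
taken to be cut off from all terminals is treated by the pushing lemma
(`exists_solution_of_push`, `step_cut`).

Every branch lowers a potential that is quadratic in `k` (`exists_branch`), and every state has
at most `2 * k + 2 * d + 6` successors (`length_children_le`), which gives a tree of size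
`(2 * k + 2 * d + 8) ^ O((k + 1) ^ 2)`. This is at most `f d * 2 ^ O(k ^ 3 * log k)` (`treeSize_le`): it is
a function of `d` if `k ≤ d`, and a power `k ^ O(k ^ 2)` otherwise.

Minimum vertex cuts are computed without multiplication or an augmenting path search. The boundary
of a set `A ∪ R` is expressed by the neighbourhood of `R` in a bipartite graph, so a minimum cut is a
deficiency in the sense of Hall, and a maximum matching is found by an auction in which free left
nodes raise the prices of right nodes (`auction_spec`, `card_le_card_bipNbrs_add`,
`exists_card_bipNbrs_add_le`, `lam_le_iff`). Reachability is the special case of cuts of size zero.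

The functions of a search node are shown to be computable in polynomial time by the closure
properties of the predicate `PT`, which asks for a program with a polynomial time bound. Only the
search tree and the loop around it are programmed by hand (`searchBody_eval`, `exists_program`).
-/

namespace RecProg

/-! ### Evaluation with time bounds -/

/-- The number of nodes of a value; a machine number counts as one node. -/
def Val.size : Val → ℕ
  | .num _ => 1
  | .pair a b => a.size + b.size + 1

/-- Renumber the function calls of an expression, for a program that is moved by `m` places. -/
def Expr.shift (m : ℕ) : Expr → Expr
  | .var i => .var i
  | .const n => .const n
  | .pair a b => .pair (a.shift m) (b.shift m)
  | .fst a => .fst (a.shift m)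
  | .snd a => .snd (a.shift m)
  | .isPair a => .isPair (a.shift m)
  | .add a b => .add (a.shift m) (b.shift m)
  | .sub a b => .sub (a.shift m) (b.shift m)
  | .le a b => .le (a.shift m) (b.shift m)
  | .ite c a b => .ite (c.shift m) (a.shift m) (b.shift m)
  | .bind a b => .bind (a.shift m) (b.shift m)
  | .call f a => .call (m + f) (a.shift m)

theorem Eval.append_right {P : Program} (Q : Program) {env : List Val} {e : Expr} {v : Val} {t : ℕ}
    (h : Eval P env e v t) : Eval (P ++ Q) env e v t := by
  induction h with
  | var => exact .var
  | const => exact .const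
  | fst _ ih => exact .fst ih
  | snd _ ih => exact .snd ih
  | isPair _ ih => exact .isPair ih
  | pair _ _ ih₁ ih₂ => exact .pair ih₁ ih₂
  | add _ _ ih₁ ih₂ => exact .add ih₁ ih₂
  | sub _ _ ih₁ ih₂ => exact .sub ih₁ ih₂
  | le _ _ ih₁ ih₂ => exact .le ih₁ ih₂
  | iteTrue _ hb _ ih₁ ih₂ => exact .iteTrue ih₁ hb ih₂
  | iteFalse _ hb _ ih₁ ih₂ => exact .iteFalse ih₁ hb ih₂
  | bind _ _ ih₁ ih₂ => exact .bind ih₁ ih₂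
  | call _ hf _ ih₁ ih₂ =>
    refine .call ih₁ ?_ ih₂
    rw [List.getElem?_append_left]
    · exact hf
    · exact (List.getElem?_eq_some_iff.1 hf).1

/-- Prepending a program does not change evaluation, once the calls are renumbered. -/
theorem Eval.append_left {P : Program} (Q : Program) {env : List Val} {e : Expr} {v : Val} {t : ℕ}
    (h : Eval P env e v t) :
    Eval (Q ++ P.map (Expr.shift Q.length)) env (e.shift Q.length) v t := by
  induction h with
  | var => exact .var
  | const => exact .const
  | fst _ ih => exact .fst ih
  | snd _ ih => exact .snd ih
  | isPair _ ih => exact .isPair ih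
  | pair _ _ ih₁ ih₂ => exact .pair ih₁ ih₂
  | add _ _ ih₁ ih₂ => exact .add ih₁ ih₂
  | sub _ _ ih₁ ih₂ => exact .sub ih₁ ih₂
  | le _ _ ih₁ ih₂ => exact .le ih₁ ih₂
  | iteTrue _ hb _ ih₁ ih₂ => exact .iteTrue ih₁ hb ih₂
  | iteFalse _ hb _ ih₁ ih₂ => exact .iteFalse ih₁ hb ih₂
  | bind _ _ ih₁ ih₂ => exact .bind ih₁ ih₂
  | call _ hf _ ih₁ ih₂ =>
    refine .call ih₁ ?_ ih₂
    rw [List.getElem?_append_right (by omega)]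
    simp [hf]

/-- `e` evaluates to `v` within `T` steps. -/
def EvalLe (P : Program) (env : List Val) (e : Expr) (v : Val) (T : ℕ) : Prop :=
  ∃ t ≤ T, Eval P env e v t

namespace EvalLe

variable {P : Program} {env : List Val} {e e₁ e₂ c : Expr} {v v₁ v₂ a b : Val} {T T₁ T₂ : ℕ}

theorem mono (h : EvalLe P env e v T₁) (hT : T₁ ≤ T₂) : EvalLe P env e v T₂ :=
  let ⟨t, ht, h⟩ := h; ⟨t, ht.trans hT, h⟩

theorem append_right (Q : Program) (h : EvalLe P env e v T) : EvalLe (P ++ Q) env e v T :=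
  let ⟨t, ht, h⟩ := h; ⟨t, ht, h.append_right Q⟩

theorem append_left (Q : Program) (h : EvalLe P env e v T) :
    EvalLe (Q ++ P.map (Expr.shift Q.length)) env (e.shift Q.length) v T :=
  let ⟨t, ht, h⟩ := h; ⟨t, ht, h.append_left Q⟩

theorem var0 : EvalLe P (v :: env) (.var 0) v 1 := ⟨1, le_rfl, .var⟩

theorem const {n : ℕ} : EvalLe P env (.const n) (.num n) 1 := ⟨1, le_rfl, .const⟩

theorem pair (h₁ : EvalLe P env e₁ v₁ T₁) (h₂ : EvalLe P env e₂ v₂ T₂) :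
    EvalLe P env (.pair e₁ e₂) (.pair v₁ v₂) (T₁ + T₂ + 1) :=
  let ⟨_, h, h₁⟩ := h₁; let ⟨_, h', h₂⟩ := h₂; ⟨_, by omega, h₁.pair h₂⟩

theorem fst (h : EvalLe P env e (.pair a b) T) : EvalLe P env (.fst e) a (T + 1) :=
  let ⟨_, h', h⟩ := h; ⟨_, by omega, h.fst⟩

theorem snd (h : EvalLe P env e (.pair a b) T) : EvalLe P env (.snd e) b (T + 1) :=
  let ⟨_, h', h⟩ := h; ⟨_, by omega, h.snd⟩

theorem isPair (h : EvalLe P env e v T) : EvalLe P env (.isPair e) (.num v.shape) (T + 1) :=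
  let ⟨_, h', h⟩ := h; ⟨_, by omega, h.isPair⟩

theorem add {m n : ℕ} (h₁ : EvalLe P env e₁ (.num m) T₁) (h₂ : EvalLe P env e₂ (.num n) T₂) :
    EvalLe P env (.add e₁ e₂) (.num (m + n)) (T₁ + T₂ + 1) :=
  let ⟨_, h, h₁⟩ := h₁; let ⟨_, h', h₂⟩ := h₂; ⟨_, by omega, h₁.add h₂⟩

theorem sub {m n : ℕ} (h₁ : EvalLe P env e₁ (.num m) T₁) (h₂ : EvalLe P env e₂ (.num n) T₂) :
    EvalLe P env (.sub e₁ e₂) (.num (m - n)) (T₁ + T₂ + 1) :=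
  let ⟨_, h, h₁⟩ := h₁; let ⟨_, h', h₂⟩ := h₂; ⟨_, by omega, h₁.sub h₂⟩

theorem le {m n : ℕ} (h₁ : EvalLe P env e₁ (.num m) T₁) (h₂ : EvalLe P env e₂ (.num n) T₂) :
    EvalLe P env (.le e₁ e₂) (.num (if m ≤ n then 1 else 0)) (T₁ + T₂ + 1) :=
  let ⟨_, h, h₁⟩ := h₁; let ⟨_, h', h₂⟩ := h₂; ⟨_, by omega, h₁.le h₂⟩

theorem iteTrue {n : ℕ} (h : EvalLe P env c (.num n) T₁) (hn : n ≠ 0)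
    (h₂ : EvalLe P env e₁ v T₂) : EvalLe P env (.ite c e₁ e₂) v (T₁ + T₂ + 1) :=
  let ⟨_, h', h⟩ := h; let ⟨_, h'', h₂⟩ := h₂; ⟨_, by omega, h.iteTrue hn h₂⟩

theorem iteFalse (h : EvalLe P env c (.num 0) T₁)
    (h₂ : EvalLe P env e₂ v T₂) : EvalLe P env (.ite c e₁ e₂) v (T₁ + T₂ + 1) :=
  let ⟨_, h', h⟩ := h; let ⟨_, h'', h₂⟩ := h₂; ⟨_, by omega, h.iteFalse rfl h₂⟩

theorem call {f : ℕ} {body : Expr} (h : EvalLe P env e a T₁) (hf : P[f]? = some body)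
    (h₂ : EvalLe P [a] body v T₂) : EvalLe P env (.call f e) v (T₁ + T₂ + 1) :=
  let ⟨_, h', h⟩ := h; let ⟨_, h'', h₂⟩ := h₂; ⟨_, by omega, h.call hf h₂⟩

end EvalLe

/-! ### Encodings and polynomial bounds -/

/-- A representation of the elements of `α` as machine values. -/
class Enc (α : Type) where
  /-- The value that represents an element. -/
  enc : α → Val

open Enc (enc)

instance : Enc ℕ := ⟨.num⟩
instance : Enc Bool := ⟨fun b => .num (if b then 1 else 0)⟩
instance : Enc Unit := ⟨fun _ => .num 0⟩
instance {α β : Type} [Enc α] [Enc β] : Enc (α × β) := ⟨fun p => .pair (enc p.1) (enc p.2)⟩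
instance {α : Type} [Enc α] : Enc (List α) := ⟨fun l => .ofList (l.map enc)⟩

variable {α β γ δ : Type} [Enc α] [Enc β] [Enc γ] [Enc δ]

/-- The number of nodes of the value that represents `a`. -/
def sz (a : α) : ℕ := (enc a).size

@[simp] theorem sz_nat (n : ℕ) : sz n = 1 := rfl
@[simp] theorem sz_bool (b : Bool) : sz b = 1 := rfl
@[simp] theorem sz_unit (b : Unit) : sz b = 1 := rfl
@[simp] theorem sz_pair (p : α × β) : sz p = sz p.1 + sz p.2 + 1 := rfl
@[simp] theorem sz_nil : sz ([] : List α) = 1 := rfl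
@[simp] theorem sz_cons (a : α) (l : List α) : sz (a :: l) = sz a + sz l + 1 := rfl

theorem sz_pos (a : α) : 1 ≤ sz a := by
  unfold sz; cases enc a <;> simp [Val.size]

theorem length_le_sz (l : List α) : l.length ≤ sz l := by
  induction l with
  | nil => simp
  | cons a l ih => simp; omega

theorem sz_mem_le {l : List α} {a : α} (h : a ∈ l) : sz a ≤ sz l := by
  induction l with
  | nil => simp at h
  | cons b l ih =>
    rcases List.mem_cons.1 h with rfl | h
    · simp; omega
    · have := ih h; simp; omega

theorem sz_list_nat (l : List ℕ) : sz l = 2 * l.length + 1 := by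
  induction l with
  | nil => rfl
  | cons a l ih => simp [ih]; omega

theorem sz_list_le {l : List α} {s : ℕ} (h : ∀ a ∈ l, sz a ≤ s) : sz l ≤ l.length * (s + 1) + 1 := by
  induction l with
  | nil => simp
  | cons a l ih =>
    have h₁ := h a (by simp)
    have h₂ := ih fun b hb => h b (by simp [hb])
    simp only [sz_cons, List.length_cons]
    nlinarith

/-- `T` is bounded by a polynomial in the size of its argument. -/
def Poly (T : α → ℕ) : Prop := ∃ c, ∀ a, T a ≤ (sz a + 2) ^ c

namespace Poly

theorem mono {S T : α → ℕ} (hT : Poly T) (h : ∀ a, S a ≤ T a) : Poly S :=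
  let ⟨c, hc⟩ := hT; ⟨c, fun a => (h a).trans (hc a)⟩

theorem const (n : ℕ) : Poly (fun _ : α => n) :=
  ⟨n, fun a => (Nat.lt_two_pow_self (n := n)).le.trans (Nat.pow_le_pow_left (by omega) n)⟩

theorem size : Poly (fun a : α => sz a) := ⟨1, fun a => by simp⟩

theorem mul {S T : α → ℕ} (hS : Poly S) (hT : Poly T) : Poly (fun a => S a * T a) := by
  obtain ⟨c, hc⟩ := hS
  obtain ⟨d, hd⟩ := hT
  exact ⟨c + d, fun a => by rw [pow_add]; exact Nat.mul_le_mul (hc a) (hd a)⟩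

theorem add {S T : α → ℕ} (hS : Poly S) (hT : Poly T) : Poly (fun a => S a + T a) := by
  obtain ⟨c, hc⟩ := hS
  obtain ⟨d, hd⟩ := hT
  refine ⟨max c d + 1, fun a => ?_⟩
  have h₁ := (hc a).trans (Nat.pow_le_pow_right (by omega : 0 < sz a + 2) (le_max_left c d))
  have h₂ := (hd a).trans (Nat.pow_le_pow_right (by omega : 0 < sz a + 2) (le_max_right c d))
  rw [pow_succ]
  nlinarith [Nat.zero_le (sz a), Nat.zero_le ((sz a + 2) ^ max c d)]

theorem comp {T : β → ℕ} {f : α → β} (hT : Poly T) (hf : Poly fun a => sz (f a)) :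
    Poly (fun a => T (f a)) := by
  obtain ⟨c, hc⟩ := hT
  obtain ⟨d, hd⟩ := hf.add (const 2)
  exact ⟨d * c, fun a => by rw [pow_mul]; exact (hc _).trans (Nat.pow_le_pow_left (hd a) c)⟩

end Poly

/-! ### Polynomial-time functions -/

/-- `f` is computed by an expression `e` (in the variable that holds the argument) over a program
`P`, in polynomial time and with output of polynomial size. Numbers have size one, so neither the
time nor the size of the output may grow with their magnitude. -/
@[fun_prop]
def PT (f : α → β) : Prop :=
  ∃ (P : Program) (e : Expr) (T : α → ℕ), Poly T ∧ Poly (fun a => sz (f a)) ∧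
    ∀ a, EvalLe P [enc a] e (enc (f a)) (T a)

namespace PT

theorem size {f : α → β} (hf : PT f) : Poly (fun a => sz (f a)) :=
  let ⟨_, _, _, _, h, _⟩ := hf; h

@[fun_prop]
theorem id : PT (fun a : α => a) :=
  ⟨[], .var 0, fun _ => 1, .const 1, .size, fun _ => .var0⟩

@[fun_prop]
theorem const (b : β) : PT (fun _ : α => b) := by
  have key : ∀ v : Val, ∃ e T, ∀ env, EvalLe [] env e v T := by
    intro v
    induction v with
    | num n => exact ⟨.const n, 1, fun env => .const⟩
    | pair a b iha ihb =>
      obtain ⟨e, T, h⟩ := iha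
      obtain ⟨e', T', h'⟩ := ihb
      exact ⟨.pair e e', T + T' + 1, fun env => (h env).pair (h' env)⟩
  obtain ⟨e, T, h⟩ := key (enc b)
  exact ⟨[], e, fun _ => T, .const T, .const _, fun _ => h _⟩

@[fun_prop]
theorem comp {f : β → γ} {g : α → β} (hf : PT f) (hg : PT g) : PT (fun a => f (g a)) := by
  obtain ⟨P, e, T, hT, hs, h⟩ := hf
  obtain ⟨Q, e', T', hT', hs', h'⟩ := hg
  refine ⟨(Q ++ P.map (Expr.shift Q.length)) ++ [e.shift Q.length],
    .call (Q ++ P.map (Expr.shift Q.length)).length e', fun a => T' a + T (g a) + 1,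
    (hT'.add (hT.comp hs')).add (.const 1), hs.comp hs', fun a => ?_⟩
  refine (((h' a).append_right _).append_right _).call (List.getElem?_concat_length) ?_
  exact ((h (g a)).append_left Q).append_right _

/-- Two polynomial-time functions are computed over a common program. -/
theorem common {f : α → β} {g : γ → δ} (hf : PT f) (hg : PT g) :
    ∃ (P : Program) (e e' : Expr) (T : α → ℕ) (T' : γ → ℕ), Poly T ∧ Poly T' ∧
      (∀ a, EvalLe P [enc a] e (enc (f a)) (T a)) ∧
      ∀ c, EvalLe P [enc c] e' (enc (g c)) (T' c) := by
  obtain ⟨P, e, T, hT, hs, h⟩ := hf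
  obtain ⟨Q, e', T', hT', hs', h'⟩ := hg
  exact ⟨P ++ Q.map (Expr.shift P.length), e, e'.shift P.length, T, T', hT, hT',
    fun a => (h a).append_right _, fun c => (h' c).append_left P⟩

@[fun_prop]
theorem mk {f : α → β} {g : α → γ} (hf : PT f) (hg : PT g) : PT (fun a => (f a, g a)) := by
  obtain ⟨P, e, e', T, T', hT, hT', h, h'⟩ := hf.common hg
  exact ⟨P, .pair e e', fun a => T a + T' a + 1, (hT.add hT').add (.const 1),
    (hf.size.add hg.size).add (.const 1), fun a => (h a).pair (h' a)⟩

@[fun_prop]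
theorem fst {f : α → β × γ} (hf : PT f) : PT (fun a => (f a).1) := by
  have hs := hf.size
  obtain ⟨P, e, T, hT, _, h⟩ := hf
  exact ⟨P, .fst e, fun a => T a + 1, hT.add (.const 1), hs.mono fun a => by simp; omega,
    fun a => (h a).fst⟩

@[fun_prop]
theorem snd {f : α → β × γ} (hf : PT f) : PT (fun a => (f a).2) := by
  have hs := hf.size
  obtain ⟨P, e, T, hT, _, h⟩ := hf
  exact ⟨P, .snd e, fun a => T a + 1, hT.add (.const 1), hs.mono fun a => by simp; omega,
    fun a => (h a).snd⟩

@[fun_prop]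
theorem add {f g : α → ℕ} (hf : PT f) (hg : PT g) : PT (fun a => f a + g a) := by
  obtain ⟨P, e, e', T, T', hT, hT', h, h'⟩ := hf.common hg
  exact ⟨P, .add e e', fun a => T a + T' a + 1, (hT.add hT').add (.const 1), .const 1,
    fun a => (h a).add (h' a)⟩

@[fun_prop]
theorem sub {f g : α → ℕ} (hf : PT f) (hg : PT g) : PT (fun a => f a - g a) := by
  obtain ⟨P, e, e', T, T', hT, hT', h, h'⟩ := hf.common hg
  exact ⟨P, .sub e e', fun a => T a + T' a + 1, (hT.add hT').add (.const 1), .const 1,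
    fun a => (h a).sub (h' a)⟩

end PT

/-- The comparison `m ≤ n` as a truth value. -/
def leb (m n : ℕ) : Bool := decide (m ≤ n)

@[simp] theorem leb_iff {m n : ℕ} : leb m n = true ↔ m ≤ n := by simp [leb]

/-- The test `m = n` as a truth value. -/
def eqb (m n : ℕ) : Bool := leb m n && leb n m

@[simp] theorem eqb_iff {m n : ℕ} : eqb m n = true ↔ m = n := by
  simp [eqb]; omega

namespace PT

@[fun_prop]
theorem leb {f g : α → ℕ} (hf : PT f) (hg : PT g) : PT (fun a => leb (f a) (g a)) := by
  obtain ⟨P, e, e', T, T', hT, hT', h, h'⟩ := hf.common hg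
  refine ⟨P, .le e e', fun a => T a + T' a + 1, (hT.add hT').add (.const 1), .const 1,
    fun a => ?_⟩
  simpa [Enc.enc, RecProg.leb] using (h a).le (h' a)

@[fun_prop]
theorem cond {c : α → Bool} {f g : α → β} (hc : PT c) (hf : PT f) (hg : PT g) :
    PT (fun a => cond (c a) (f a) (g a)) := by
  have hs : Poly fun a => sz (f a) + sz (g a) := hf.size.add hg.size
  obtain ⟨P, e, e', T, T', hT, hT', h, h'⟩ := hc.common (hf.mk hg)
  refine ⟨P, .ite e (.fst e') (.snd e'), fun a => T a + (T' a + 1) + 1,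
    (hT.add (hT'.add (.const 1))).add (.const 1), hs.mono fun a => ?_, fun a => ?_⟩
  · cases hca : c a
    all_goals simp [hca]
  · have := h a
    cases hca : c a
    · rw [hca] at this
      simpa [hca] using EvalLe.iteFalse this (h' a).snd
    · rw [hca] at this
      simpa [hca] using EvalLe.iteTrue this (by simp) (h' a).fst

@[fun_prop]
theorem and {f g : α → Bool} (hf : PT f) (hg : PT g) : PT (fun a => f a && g a) := by
  have : (fun a => f a && g a) = fun a => bif f a then g a else false := by
    funext a; cases f a <;> rfl
  rw [this]; fun_prop

@[fun_prop]
theorem or {f g : α → Bool} (hf : PT f) (hg : PT g) : PT (fun a => f a || g a) := by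
  have : (fun a => f a || g a) = fun a => bif f a then true else g a := by
    funext a; cases f a <;> rfl
  rw [this]; fun_prop

@[fun_prop]
theorem not {f : α → Bool} (hf : PT f) : PT (fun a => !f a) := by
  have : (fun a => !f a) = fun a => bif f a then false else true := by
    funext a; cases f a <;> rfl
  rw [this]; fun_prop

@[fun_prop]
theorem eqb {f g : α → ℕ} (hf : PT f) (hg : PT g) : PT (fun a => eqb (f a) (g a)) := by
  unfold RecProg.eqb; fun_prop

@[fun_prop]
theorem cons {f : α → β} {g : α → List β} (hf : PT f) (hg : PT g) : PT (fun a => f a :: g a) :=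
  hf.mk hg

@[fun_prop]
theorem isEmpty {f : α → List β} (hf : PT f) : PT (fun a => (f a).isEmpty) := by
  obtain ⟨P, e, T, hT, _, h⟩ := hf
  refine ⟨P, .sub (.const 1) (.isPair e), fun a => 1 + (T a + 1) + 1,
    ((Poly.const 1).add (hT.add (.const 1))).add (.const 1), .const 1, fun a => ?_⟩
  have := EvalLe.sub (.const (n := 1)) (h a).isPair
  have he : Val.num (1 - (enc (f a)).shape) = enc (f a).isEmpty := by cases f a <;> rfl
  rw [he] at this
  exact this

end PT

/-! ### Loops -/

/-- The body of the loop over a list: the argument holds the parameter, the state and the list;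
function `j` is the step and function `j + 1` the loop itself. -/
def foldBody (j : ℕ) : Expr :=
  let x : Expr := .var 0
  .ite (.isPair (.snd (.snd x)))
    (.call (j + 1) (.pair (.fst x) (.pair
      (.call j (.pair (.fst x) (.pair (.fst (.snd x)) (.fst (.snd (.snd x))))))
      (.snd (.snd (.snd x))))))
    (.fst (.snd x))

theorem foldBody_eval (P : Program) (e : Expr) (a : α) (g : β → γ → β) (I : β → List γ → Prop)
    (K : ℕ) (hI : ∀ b x l, I b (x :: l) → I (g b x) l ∧
      EvalLe P [enc (a, b, x)] e (enc (g b x)) K) (l : List γ) :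
    ∀ b, I b l → EvalLe (P ++ [e, foldBody P.length]) [enc (a, b, l)] (foldBody P.length)
      (enc (l.foldl g b)) (l.length * (K + 30) + 30) := by
  induction l with
  | nil =>
    intro b _
    refine (EvalLe.iteFalse (T₁ := 4) (T₂ := 3) ?_ ?_).mono (by omega)
    · exact EvalLe.var0.snd.snd.isPair
    · exact EvalLe.var0.snd.fst
  | cons x l ih =>
    intro b hb
    obtain ⟨h₁, h₂⟩ := hI b x l hb
    have x0 : EvalLe (P ++ [e, foldBody P.length]) [enc (a, b, x :: l)] (.var 0)
      (.pair (enc a) (.pair (enc b) (.pair (enc x) (enc l)))) 1 := .var0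
    have hstep := EvalLe.call (f := P.length) (x0.fst.pair (x0.snd.fst.pair x0.snd.snd.fst))
      (body := e) (by simp) (h₂.append_right _)
    have := EvalLe.iteTrue (n := 1) x0.snd.snd.isPair (by simp)
      (e₂ := .fst (.snd (.var 0)))
      (EvalLe.call (f := P.length + 1) (x0.fst.pair (hstep.pair x0.snd.snd.snd))
        (by simp) (ih _ h₁))
    refine this.mono ?_
    simp only [List.length_cons, Nat.add_mul]
    omega

namespace PT

/-- A loop whose state stays of polynomial size is polynomial. -/
theorem foldl {l : α → List γ} {i : α → β} {g : α → β → γ → β} (hl : PT l) (hi : PT i)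
    (hg : PT (fun q : α × β × γ => g q.1 q.2.1 q.2.2)) {B : α → ℕ} (hB : Poly B)
    (hb : ∀ a, ∀ l', l' <+: l a → sz (l'.foldl (g a) (i a)) ≤ B a) :
    PT (fun a => (l a).foldl (g a) (i a)) := by
  have hinit : PT (fun a => (a, i a, l a)) := by fun_prop
  have hfold : ∃ (P : Program) (e : Expr) (c : ℕ), ∀ a, EvalLe P [enc (a, i a, l a)] e
      (enc ((l a).foldl (g a) (i a)))
      ((l a).length * ((sz a + (B a + sz (l a) + 1) + 1 + 2) ^ c + 30) + 30) := by
    obtain ⟨P, e, T, ⟨c, hT⟩, _, h⟩ := hg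
    refine ⟨_, foldBody P.length, c, fun a => foldBody_eval P e a (g a)
      (fun b l₂ => ∃ l₁, l a = l₁ ++ l₂ ∧ b = l₁.foldl (g a) (i a)) _ ?_ (l a) (i a)
      ⟨[], rfl, rfl⟩⟩
    rintro b x l₂ ⟨l₁, h₁, rfl⟩
    refine ⟨⟨l₁ ++ [x], by simp [h₁], by simp⟩, (h (a, _, x)).mono ((hT _).trans ?_)⟩
    refine Nat.pow_le_pow_left ?_ c
    have h₂ := hb a l₁ (by rw [h₁]; simp)
    have h₃ : sz x ≤ sz (l a) := sz_mem_le (by rw [h₁]; simp)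
    simp only [sz_pair]
    omega
  obtain ⟨P, e, c, h⟩ := hfold
  obtain ⟨Q, e', T, hT, hs, h'⟩ := hinit
  have hls := hl.size
  refine ⟨(Q ++ P.map (Expr.shift Q.length)) ++ [e.shift Q.length],
    .call (Q ++ P.map (Expr.shift Q.length)).length e', _, ?_, hB.mono fun a => hb a _
      (List.prefix_refl _), fun a => (((h' a).append_right _).append_right _).call
        List.getElem?_concat_length (((h a).append_left Q).append_right _)⟩
  have hpow : Poly fun a => (sz a + (B a + sz (l a) + 1) + 1 + 2) ^ c := by
    have : Poly fun a => sz a + (B a + sz (l a) + 1) + 1 + 2 :=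
      ((Poly.size.add ((hB.add hls).add (.const 1))).add (.const 1)).add (.const 2)
    obtain ⟨d, hd⟩ := this
    exact ⟨d * c, fun a => by rw [pow_mul]; exact Nat.pow_le_pow_left (hd a) c⟩
  exact (hT.add (((hls.mono fun a => length_le_sz _).mul (hpow.add (.const 30))).add
    (.const 30))).add (.const 1)

end PT
end RecProg

namespace RecProg
open Enc (enc)
variable {α β γ δ : Type} [Enc α] [Enc β] [Enc γ] [Enc δ]

/-! ### List functions in polynomial time -/

theorem sz_append (l₁ l₂ : List α) : sz (l₁ ++ l₂) + 1 = sz l₁ + sz l₂ := by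
  induction l₁ with
  | nil => simp; omega
  | cons a l ih => simp; omega

theorem sz_prefix_le {l₁ l₂ : List α} (h : l₁ <+: l₂) : sz l₁ ≤ sz l₂ := by
  obtain ⟨l, rfl⟩ := h
  have := sz_append l₁ l
  have := sz_pos l
  omega

namespace PT

@[fun_prop]
theorem headD {f : α → List β} {g : α → β} (hf : PT f) (hg : PT g) :
    PT (fun a => (f a).headD (g a)) := by
  have hs : Poly fun a => sz (f a) + sz (g a) := hf.size.add hg.size
  obtain ⟨P, e, e', T, T', hT, hT', h, h'⟩ := hf.common hg
  refine ⟨P, .ite (.isPair e) (.fst e) e', fun a => T a + 1 + (T a + 1 + T' a) + 1,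
    ((hT.add (.const 1)).add ((hT.add (.const 1)).add hT')).add (.const 1), hs.mono fun a => ?_,
    fun a => ?_⟩
  · cases hfa : f a
    · simp [hfa]
    · simp [hfa]; omega
  · have := h a
    cases hfa : f a with
    | nil =>
      rw [hfa] at this
      have h₂ := EvalLe.iteFalse (e₁ := .fst e) this.isPair (h' a)
      simpa [hfa] using h₂.mono (T₂ := T a + 1 + (T a + 1 + T' a) + 1) (by omega)
    | cons b l =>
      rw [hfa] at this
      have h₂ : EvalLe P [enc a] (.fst e) (enc b) (T a + 1) := this.fst
      have h₃ := EvalLe.iteTrue (e₂ := e') this.isPair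
        (by simp [Val.shape, Enc.enc, Val.ofList]) h₂
      simpa [hfa] using h₃.mono (T₂ := T a + 1 + (T a + 1 + T' a) + 1) (by omega)

@[fun_prop]
theorem tail {f : α → List β} (hf : PT f) : PT (fun a => (f a).tail) := by
  have hs := hf.size
  obtain ⟨P, e, T, hT, _, h⟩ := hf
  refine ⟨P, .snd e, fun a => T a + 1, hT.add (.const 1), hs.mono fun a => ?_, fun a => ?_⟩
  · cases hfa : f a
    · simp [hfa]
    · simp [hfa]; omega
  · obtain ⟨t, ht, h⟩ := h a
    refine ⟨t + 1, Nat.succ_le_succ ht, ?_⟩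
    have he : enc (f a).tail = (enc (f a)).snd := by cases f a <;> rfl
    rw [he]
    exact h.snd

/-- A loop whose state has bounded size. -/
theorem foldl_const {l : α → List γ} {i : α → β} {g : α → β → γ → β} (hl : PT l) (hi : PT i)
    (hg : PT (fun q : α × β × γ => g q.1 q.2.1 q.2.2)) (c : ℕ) (hc : ∀ b : β, sz b ≤ c) :
    PT (fun a => (l a).foldl (g a) (i a)) :=
  foldl hl hi hg (.const c) fun _ _ _ => hc _

@[fun_prop]
theorem any {l : α → List γ} {p : α → γ → Bool} (hl : PT l)
    (hp : PT (fun q : α × γ => p q.1 q.2)) : PT (fun a => (l a).any (p a)) := by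
  have : (fun a => (l a).any (p a)) = fun a => (l a).foldl (fun b x => b || p a x) false := by
    funext a
    have : ∀ (l : List γ) (b : Bool), l.foldl (fun b x => b || p a x) b = (b || l.any (p a)) := by
      intro l
      induction l with
      | nil => simp
      | cons x l ih => intro b; simp [ih, Bool.or_assoc]
    simp [this]
  rw [this]
  have hp' : PT (fun q : α × Bool × γ => p q.1 q.2.2) :=
    comp (f := fun q : α × γ => p q.1 q.2) (g := fun q : α × Bool × γ => (q.1, q.2.2)) hp
      (by fun_prop)
  exact foldl_const hl (const _) (by fun_prop) 1 fun b => by simp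

@[fun_prop]
theorem all {l : α → List γ} {p : α → γ → Bool} (hl : PT l)
    (hp : PT (fun q : α × γ => p q.1 q.2)) : PT (fun a => (l a).all (p a)) := by
  have : (fun a => (l a).all (p a)) = fun a => !(l a).any fun x => !p a x := by
    funext a; simp [List.all_eq_not_any_not]
  rw [this]
  fun_prop

@[fun_prop]
theorem length {l : α → List γ} (hl : PT l) : PT (fun a => (l a).length) := by
  have : (fun a => (l a).length) = fun a => (l a).foldl (fun n _ => n + 1) 0 := by
    funext a
    simp
  rw [this]
  exact foldl_const hl (const _) (by fun_prop) 1 fun b => by simp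

end PT

/-- The images of the elements of `l`, put in front of `l'` in reverse order. -/
def mapOnto {α β : Type} (f : α → β) (l : List α) (l' : List β) : List β :=
  l.foldl (fun acc x => f x :: acc) l'

theorem mapOnto_eq {α β : Type} (f : α → β) (l : List α) (l' : List β) :
    mapOnto f l l' = (l.map f).reverse ++ l' := by
  unfold mapOnto
  induction l generalizing l' with
  | nil => rfl
  | cons a l ih => simp [ih]

@[simp] theorem mem_mapOnto {α β : Type} {f : α → β} {l : List α} {l' : List β} {b : β} :
    b ∈ mapOnto f l l' ↔ (∃ a ∈ l, f a = b) ∨ b ∈ l' := by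
  simp [mapOnto_eq]

@[simp] theorem length_mapOnto {α β : Type} (f : α → β) (l : List α) (l' : List β) :
    (mapOnto f l l').length = l.length + l'.length := by
  simp [mapOnto_eq]

namespace PT

@[fun_prop]
theorem mapOnto {l : α → List γ} {l' : α → List δ} {f : α → γ → δ} (hl : PT l) (hl' : PT l')
    (hf : PT (fun q : α × γ => f q.1 q.2)) : PT (fun a => mapOnto (f a) (l a) (l' a)) := by
  unfold RecProg.mapOnto
  obtain ⟨c, hc⟩ := hf.size
  have hf' : PT (fun q : α × List δ × γ => f q.1 q.2.2) :=
    comp (f := fun q : α × γ => f q.1 q.2) (g := fun q : α × List δ × γ => (q.1, q.2.2)) hf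
      (by fun_prop)
  refine foldl (g := fun a acc x => f a x :: acc)
    (B := fun a => sz (l a) * ((sz a + sz (l a) + 1 + 2) ^ c + 1) + sz (l' a)) hl hl'
    (by fun_prop) ?_ ?_
  · have h₁ : Poly fun a => sz a + sz (l a) + 1 + 2 :=
      ((Poly.size.add hl.size).add (.const 1)).add (.const 2)
    obtain ⟨d, hd⟩ := h₁
    have h₂ : Poly fun a => (sz a + sz (l a) + 1 + 2) ^ c :=
      ⟨d * c, fun a => by rw [pow_mul]; exact Nat.pow_le_pow_left (hd a) c⟩
    exact (hl.size.mul (h₂.add (.const 1))).add hl'.size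
  · intro a m hm
    have key : ∀ (m : List γ) (k : List δ), (∀ x ∈ m, x ∈ l a) →
        sz (m.foldl (fun acc x => f a x :: acc) k) ≤
          m.length * ((sz a + sz (l a) + 1 + 2) ^ c + 1) + sz k := by
      intro m
      induction m with
      | nil => intro k _; simp
      | cons x m ih =>
        intro k hk
        have h₁ := ih (f a x :: k) fun y hy => hk y (by simp [hy])
        have h₂ : sz (f a x) ≤ (sz a + sz (l a) + 1 + 2) ^ c := by
          refine (hc (a, x)).trans (Nat.pow_le_pow_left ?_ c)
          have := sz_mem_le (hk x (by simp))
          simp only [sz_pair]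
          omega
        simp only [List.foldl_cons, List.length_cons, Nat.add_mul, sz_cons] at h₁ ⊢
        omega
    refine (key m _ fun x hx => hm.subset hx).trans ?_
    gcongr
    exact (length_le_sz m).trans (sz_prefix_le hm)

@[fun_prop]
theorem reverse {l : α → List γ} (hl : PT l) : PT (fun a => (l a).reverse) := by
  have : (fun a => (l a).reverse) = fun a => RecProg.mapOnto (fun x => x) (l a) [] := by
    funext a; simp [mapOnto_eq]
  rw [this]
  fun_prop

@[fun_prop]
theorem map {l : α → List γ} {f : α → γ → δ} (hl : PT l)
    (hf : PT (fun q : α × γ => f q.1 q.2)) : PT (fun a => (l a).map (f a)) := by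
  have : (fun a => (l a).map (f a)) = fun a => (RecProg.mapOnto (f a) (l a) []).reverse := by
    funext a; simp [mapOnto_eq]
  rw [this]
  fun_prop

@[fun_prop]
theorem filter {l : α → List γ} {p : α → γ → Bool} (hl : PT l)
    (hp : PT (fun q : α × γ => p q.1 q.2)) : PT (fun a => (l a).filter (p a)) := by
  have key : ∀ (a : α) (m k : List γ),
      m.foldl (fun acc x => bif p a x then x :: acc else acc) k = (m.filter (p a)).reverse ++ k := by
    intro a m
    induction m with
    | nil => simp
    | cons x m ih => intro k; cases h : p a x <;> simp [ih, h]
  have : (fun a => (l a).filter (p a)) =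
      fun a => ((l a).foldl (fun acc x => bif p a x then x :: acc else acc) []).reverse := by
    funext a; simp [key]
  rw [this]
  refine reverse ?_
  have hp' : PT (fun q : α × List γ × γ => p q.1 q.2.2) :=
    comp (f := fun q : α × γ => p q.1 q.2) (g := fun q : α × List γ × γ => (q.1, q.2.2)) hp
      (by fun_prop)
  refine foldl (g := fun a acc x => bif p a x then x :: acc else acc)
    (B := fun a => sz (l a)) hl (const _) (by fun_prop) hl.size ?_
  intro a m hm
  refine le_trans ?_ (sz_prefix_le hm)
  have h₂ : ∀ (m k : List γ),
      sz (m.foldl (fun acc x => bif p a x then x :: acc else acc) k) + 1 ≤ sz m + sz k := by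
    intro m
    induction m with
    | nil => intro k; simp
    | cons x m ih =>
      intro k
      cases h : p a x
      · have := ih k; simp [h]; omega
      · have := ih (x :: k); simp [h] at this ⊢; omega
  have := h₂ m []
  simp at this
  omega

@[fun_prop]
theorem getD {l : α → List γ} {i : α → ℕ} {d : α → γ} (hl : PT l) (hi : PT i) (hd : PT d) :
    PT (fun a => (l a).getD (i a) (d a)) := by
  have key : ∀ (i n : ℕ) (m : List γ) (d : γ),
      (m.foldl (fun (b : ℕ × γ) x => (b.1 + 1, bif RecProg.eqb b.1 i then x else b.2))
        (n, d)).2 = if n ≤ i then m.getD (i - n) d else d := by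
    intro i n m
    induction m generalizing n with
    | nil => simp
    | cons x m ih =>
      intro d
      simp only [List.foldl_cons, ih]
      rcases lt_trichotomy n i with h | rfl | h
      · have h₁ : RecProg.eqb n i = false := by simp [← Bool.not_eq_true]; omega
        obtain ⟨j, rfl⟩ := Nat.exists_eq_add_of_lt h
        have h₂ : n + j + 1 - n = j + 1 := by omega
        have h₃ : n + j + 1 - (n + 1) = j := by omega
        simp [h₁, h₂, h₃, show n ≤ n + j + 1 by omega]
      · have h₁ : RecProg.eqb n n = true := eqb_iff.2 rfl
        simp only [h₁, cond_true]
        simp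
      · have h₁ : RecProg.eqb n i = false := by simp [← Bool.not_eq_true]; omega
        simp [h₁, show ¬ n ≤ i by omega, show ¬ n + 1 ≤ i by omega]
  have : (fun a => (l a).getD (i a) (d a)) = fun a => ((l a).foldl
      (fun (b : ℕ × γ) x => (b.1 + 1, bif RecProg.eqb b.1 (i a) then x else b.2)) (0, d a)).2 := by
    funext a; simp [key]
  rw [this]
  refine snd (foldl
    (g := fun a (b : ℕ × γ) x => (b.1 + 1, bif RecProg.eqb b.1 (i a) then x else b.2))
    (B := fun a => sz (l a) + sz (d a) + 2) hl (by fun_prop) (by fun_prop)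
    ((hl.size.add hd.size).add (.const 2)) ?_)
  intro a m hm
  have h₂ : ∀ (m : List γ) (n : ℕ) (d : γ), sz (m.foldl
      (fun (b : ℕ × γ) x => (b.1 + 1, bif RecProg.eqb b.1 (i a) then x else b.2)) (n, d))
      ≤ sz m + sz d + 2 := by
    intro m
    induction m with
    | nil => intro n d; simp
    | cons x m ih =>
      intro n d
      cases h : RecProg.eqb n (i a)
      · have := ih (n + 1) d
        simp only [List.foldl_cons, h, cond_false, sz_cons]
        omega
      · have := ih (n + 1) x
        simp only [List.foldl_cons, h, cond_true, sz_cons]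
        omega
  have := h₂ m 0 (d a)
  have := sz_prefix_le hm
  omega

end PT

/-- Membership in a list of numbers. -/
def mem (x : ℕ) (l : List ℕ) : Bool := l.any fun y => eqb x y

@[simp] theorem mem_iff {x : ℕ} {l : List ℕ} : mem x l = true ↔ x ∈ l := by
  simp [mem]

@[simp] theorem mem_eq_false {x : ℕ} {l : List ℕ} : mem x l = false ↔ x ∉ l := by
  rw [← mem_iff, Bool.not_eq_true]

@[fun_prop]
theorem PT.mem {f : α → ℕ} {l : α → List ℕ} (hf : PT f) (hl : PT l) :
    PT (fun a => mem (f a) (l a)) := by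
  unfold RecProg.mem; fun_prop

/-- The product of a number and the length of a list, by repeated addition. -/
def mulLen {α : Type} (l : List α) (m : ℕ) : ℕ := l.foldl (fun s _ => s + m) 0

theorem mulLen_eq {α : Type} (l : List α) (m : ℕ) : mulLen l m = l.length * m := by
  simp [mulLen, mul_comm]

@[fun_prop]
theorem PT.mulLen {l : α → List γ} {f : α → ℕ} (hl : PT l) (hf : PT f) :
    PT (fun a => mulLen (l a) (f a)) := by
  unfold RecProg.mulLen
  exact foldl_const (g := fun a s _ => s + f a) hl (const _) (by fun_prop) 1 fun b => by simp

/-- The first `m` elements of a list, in reverse order. -/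
def pick {α : Type} (m : ℕ) (l : List α) : List α :=
  l.foldl (fun acc x => bif leb m acc.length then acc else x :: acc) []

theorem pick_eq {α : Type} (m : ℕ) (l : List α) : pick m l = (l.take m).reverse := by
  have key : ∀ (l k : List α), l.foldl (fun acc x => bif leb m acc.length then acc else x :: acc) k
      = (l.take (m - k.length)).reverse ++ k := by
    intro l
    induction l with
    | nil => simp
    | cons x l ih =>
      intro k
      by_cases h : m ≤ k.length
      · have : m - k.length = 0 := by omega
        simp only [List.foldl_cons, leb, decide_eq_true h, cond_true]
        exact (ih k).trans (by simp [this])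
      · obtain ⟨j, rfl⟩ := Nat.exists_eq_add_of_lt (not_le.1 h)
        have h₁ : k.length + j + 1 - k.length = j + 1 := by omega
        have h₂ : k.length + j + 1 - (k.length + 1) = j := by omega
        simp only [List.foldl_cons, leb, decide_eq_false h, cond_false]
        exact (ih (x :: k)).trans (by simp [h₁, h₂])
  simp [pick, key]

@[fun_prop]
theorem PT.pick {l : α → List γ} {f : α → ℕ} (hl : PT l) (hf : PT f) :
    PT (fun a => pick (f a) (l a)) := by
  unfold RecProg.pick
  refine foldl (g := fun a acc x => bif RecProg.leb (f a) acc.length then acc else x :: acc)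
    (B := fun a => sz (l a)) hl (const _) (by fun_prop) hl.size ?_
  intro a m hm
  refine le_trans ?_ (sz_prefix_le hm)
  have h₂ : ∀ (m k : List γ),
      sz (m.foldl (fun acc x => bif RecProg.leb (f a) acc.length then acc else x :: acc) k) + 1
        ≤ sz m + sz k := by
    intro m
    induction m with
    | nil => intro k; simp
    | cons x m ih =>
      intro k
      cases h : RecProg.leb (f a) k.length
      · have := ih (x :: k); simp [h] at this ⊢; omega
      · have := ih k; simp [h]; omega
  have := h₂ m []
  simp at this
  omega

end RecProg

namespace RecProg
open Enc (enc)
variable {α β γ δ : Type} [Enc α] [Enc β] [Enc γ] [Enc δ]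

theorem sz_iter_le {ι : Type} {g : β → β} {B : ℕ} (hb : ∀ b, sz (g b) ≤ max (sz b) B) (l : List ι)
    (b : β) :
    sz (l.foldl (fun s _ => g s) b) ≤ max (sz b) B := by
  induction l generalizing b with
  | nil => simp
  | cons x l ih => exact (ih _).trans (by have := hb b; simp; omega)

/-- Repetition of a step that keeps the state below a polynomial size. -/
theorem PT.iter {l : α → List γ} {i : α → β} {g : α → β → β} (hl : PT l) (hi : PT i)
    (hg : PT (fun q : α × β => g q.1 q.2)) {B : α → ℕ} (hB : Poly B)
    (hb : ∀ a b, sz (g a b) ≤ max (sz b) (B a)) :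
    PT (fun a => (l a).foldl (fun s _ => g a s) (i a)) := by
  have hg' : PT (fun q : α × β × γ => g q.1 q.2.1) :=
    comp (f := fun q : α × β => g q.1 q.2) (g := fun q : α × β × γ => (q.1, q.2.1)) hg
      (by fun_prop)
  refine foldl (g := fun a s _ => g a s) hl hi hg' (hi.size.add hB) fun a m _ => ?_
  exact (sz_iter_le (hb a) m (i a)).trans (by omega)

end RecProg

namespace SCCDeletion
open RecProg

/-! ### Minimum cuts by an auction -/

/-- The entry of a Boolean matrix. -/
def adj (M : List (List Bool)) (u v : ℕ) : Bool := (M.getD u []).getD v false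

/-- The vertices of `H` outside `R` that have an in-neighbour in `R`. -/
def bdry (M : List (List Bool)) (H R : List ℕ) : List ℕ :=
  H.filter fun v => !mem v R && R.any fun r => adj M r v

/-- No right node is matched to the left node `u`. An auction state `s` consists of the list of
prices of the right nodes and of the list of their mates; the mate `u` is stored as `u + 1`, and
`0` stands for an unmatched node. -/
def isFree (vs : List ℕ) (s : List ℕ × List ℕ) (u : ℕ) : Bool :=
  vs.all fun v => !eqb (s.2.getD v 0) (u + 1)

/-- The free left nodes that have a neighbour whose price is at most the number of vertices. -/
def bidders (vs L : List ℕ) (B : List (List Bool)) (s : List ℕ × List ℕ) : List ℕ :=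
  L.filter fun u => isFree vs s u && vs.any fun v => adj B u v && leb (s.1.getD v 0) vs.length

/-- The neighbours of `u` of the least price. -/
def bargains (vs : List ℕ) (B : List (List Bool)) (s : List ℕ × List ℕ) (u : ℕ) : List ℕ :=
  vs.filter fun v => adj B u v && vs.all fun w => !adj B u w || leb (s.1.getD v 0) (s.1.getD w 0)

/-- Match the right node `v` to `u` and raise its price by one. -/
def award (vs : List ℕ) (s : List ℕ × List ℕ) (u v : ℕ) : List ℕ × List ℕ :=
  (vs.map fun x => bif eqb x v then s.1.getD x 0 + 1 else s.1.getD x 0,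
    vs.map fun x => bif eqb x v then u + 1 else s.2.getD x 0)

/-- One round of the auction: a free left node takes over its cheapest neighbour. -/
def bid (vs L : List ℕ) (B : List (List Bool)) (s : List ℕ × List ℕ) : List ℕ × List ℕ :=
  bif (bidders vs L B s).isEmpty then s else
    award vs s ((bidders vs L B s).headD 0)
      ((bargains vs B s ((bidders vs L B s).headD 0)).headD 0)

/-- As many rounds as the list has elements, and one more. -/
def bids (vs L : List ℕ) (B : List (List Bool)) (s : List ℕ × List ℕ) : List ℕ × List ℕ :=
  (0 :: vs).foldl (fun s _ => bid vs L B s) s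

/-- The final state of the auction. -/
def auction (vs L : List ℕ) (B : List (List Bool)) : List ℕ × List ℕ :=
  (0 :: vs).foldl (fun s _ => bids vs L B s) (vs.map fun _ => 0, vs.map fun _ => 0)

/-- The number of left nodes that a maximum matching leaves unmatched. -/
def deficiency (vs L : List ℕ) (B : List (List Bool)) : ℕ :=
  (L.filter fun u => isFree vs (auction vs L B) u).length

/-- The bipartite graph whose deficiency determines the minimum cut from `A`: the left nodes are
the elements of `L`, the right nodes the vertices of `H` outside `A` and its boundary, and `u` is
joined to itself and to its out-neighbours. -/
def cutMatrix (vs : List ℕ) (M : List (List Bool)) (H A L : List ℕ) : List (List Bool) :=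
  vs.map fun u => vs.map fun v => mem u L && mem v H && !mem v A && !mem v (bdry M H A) &&
    (eqb u v || adj M u v)

/-- The least size of the boundary in `H` of a set that contains `A` and avoids `T`, and one more
than the number of vertices if there is no such set. -/
def lam (vs : List ℕ) (M : List (List Bool)) (H A T : List ℕ) : ℕ :=
  bif A.any fun a => mem a T then vs.length + 1 else
    (bdry M H A).length - deficiency vs (H.filter fun u => !mem u A && !mem u T)
      (cutMatrix vs M H A (H.filter fun u => !mem u A && !mem u T))

/-- The union of two sets of vertices. -/
def uni (vs S T : List ℕ) : List ℕ := vs.filter fun v => mem v S || mem v T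

/-- The largest set that attains the minimum `lam`. -/
def rmax (vs : List ℕ) (M : List (List Bool)) (H A T : List ℕ) : List ℕ :=
  H.filter fun v => leb (lam vs M H (uni vs A [v]) T) (lam vs M H A T)

/-! ### The search -/

/-- Every vertex of `H` has at most `d` out-neighbours in its strong component of `D[H]`. -/
def good (vs : List ℕ) (M : List (List Bool)) (d : ℕ) (H : List ℕ) : Bool :=
  H.all fun v => leb (H.filter fun u => adj M v u && leb 1 (lam vs M H [u] [v])).length d

/-- The out-neighbours of `v` in `H` from which a vertex of `W` can be reached in `D[H]`. -/
def returning (vs : List ℕ) (M : List (List Bool)) (H W : List ℕ) (v : ℕ) : List ℕ :=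
  H.filter fun z => adj M v z && leb 1 (lam vs M H [z] W)

/-- The vertices with more than `d` returning out-neighbours. -/
def active (vs : List ℕ) (M : List (List Bool)) (d : ℕ) (H W : List ℕ) : List ℕ :=
  H.filter fun v => leb (d + 1) (returning vs M H W v).length

/-- The complement of `S` in `H`. -/
def diff (H S : List ℕ) : List ℕ := H.filter fun v => !mem v S

/-- The states of the search: the set `H` of live vertices, the set `Y` of deleted vertices, the
live terminals `W`, the terminals not yet assigned to `A` or `T`, the set `A` of vertices that are
taken to be reachable from the chosen terminal after the deletion, the set `T` of vertices that are
taken not to be, and the set `U` of vertices that are taken to reach no terminal. -/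
abbrev St : Type :=
  List ℕ × List ℕ × List ℕ × List ℕ × List ℕ × List ℕ × List ℕ

/-- The state after the deletion of `S` and the removal of the finished set `R`. -/
def advance (vs H Y W S R : List ℕ) : St :=
  (diff (diff H S) R, uni vs Y S, diff (diff W S) R, diff (diff W S) R, [], [], [])

/-- The branches when `U` is to be separated from the terminals. -/
def cutBranches (vs : List ℕ) (M : List (List Bool)) (k : ℕ) (H Y W Wu A T U : List ℕ) : List St :=
  let S := bdry M H (rmax vs M H U W)
  bif leb (k + 1) (lam vs M H U W) || leb (k + 1) S.length then [] else
    advance vs H Y W S [] ::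
      mapOnto (fun s => advance vs H Y W [s] []) S
        (mapOnto (fun s => ((H, Y, W, Wu, A, T, uni vs U [s]) : St)) S [])

/-- The branches on the destiny of a vertex `v` with the returning out-neighbours `Z`. -/
def vertexBranches (vs H Y W Wu A T U Z : List ℕ) (v : ℕ) : List St :=
  advance vs H Y W [v] [] :: (H, Y, W, Wu, A, uni vs T [v], U) ::
    mapOnto (fun z => advance vs H Y W [z] []) Z
      (mapOnto (fun z => ((H, Y, W, Wu, A, T, [z]) : St)) Z [])

/-- The branches on the cut with boundary `S` around the set `R`. -/
def finishBranches (vs : List ℕ) (k : ℕ) (H Y W Wu A T U R S : List ℕ) : List St :=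
  bif leb (k + 1) S.length then [] else
    advance vs H Y W S R ::
      mapOnto (fun s => advance vs H Y W [s] []) S
        (mapOnto (fun s => ((H, Y, W, Wu, uni vs A [s], T, U) : St)) S [])

/-- The active vertices that lie in every minimum cut. -/
def forced (vs : List ℕ) (M : List (List Bool)) (d : ℕ) (H W A T : List ℕ) : List ℕ :=
  (active vs M d H W).filter fun v => leb (lam vs M H A T + 1) (lam vs M H A (uni vs T [v]))

/-- The branches when all terminals are assigned. -/
def mainBranches (vs : List ℕ) (M : List (List Bool)) (k d : ℕ) (H Y W Wu A T U : List ℕ) :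
    List St :=
  bif leb (k + 1) (lam vs M H A T) then [] else
  bif (forced vs M d H W A T).isEmpty then
    finishBranches vs k H Y W Wu A T U (rmax vs M H A (uni vs T (active vs M d H W)))
      (bdry M H (rmax vs M H A (uni vs T (active vs M d H W))))
  else
    vertexBranches vs H Y W Wu A T U
      (pick (d + 1) (returning vs M H W ((forced vs M d H W A T).headD 0)))
      ((forced vs M d H W A T).headD 0)

/-- The successors of a state in the search tree. -/
def branches (vs : List ℕ) (M : List (List Bool)) (k d : ℕ) (H Y W Wu A T U : List ℕ) : List St :=
  bif leb (k + 1) Y.length || leb (k + 2) W.length then [] else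
  bif !U.isEmpty then cutBranches vs M k H Y W Wu A T U else
  bif A.isEmpty then
    mapOnto (fun w => advance vs H Y W [w] []) W
      (mapOnto (fun w => ((H, Y, W, Wu, [w], T, U) : St)) W [])
  else bif !Wu.isEmpty then
    [(H, Y, W, Wu.tail, uni vs A [Wu.headD 0], T, U),
      (H, Y, W, Wu.tail, A, uni vs T [Wu.headD 0], U)]
  else mainBranches vs M k d H Y W Wu A T U

end SCCDeletion

namespace RecProg.PT
open RecProg.Enc (enc)
variable {α : Type} [Enc α]
variable {vs H A T L R S W Y Z U Wu : α → List ℕ} {M B : α → List (List Bool)} {k d : α → ℕ}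

@[fun_prop]
theorem adj {u v : α → ℕ} (hM : PT M) (hu : PT u) (hv : PT v) :
    PT (fun a => SCCDeletion.adj (M a) (u a) (v a)) := by
  unfold SCCDeletion.adj; fun_prop

@[fun_prop]
theorem bdry (hM : PT M) (hH : PT H) (hR : PT R) :
    PT (fun a => SCCDeletion.bdry (M a) (H a) (R a)) := by
  unfold SCCDeletion.bdry; fun_prop

@[fun_prop]
theorem isFree {s : α → List ℕ × List ℕ} {u : α → ℕ} (hvs : PT vs) (hs : PT s) (hu : PT u) :
    PT (fun a => SCCDeletion.isFree (vs a) (s a) (u a)) := by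
  unfold SCCDeletion.isFree; fun_prop

@[fun_prop]
theorem bidders {s : α → List ℕ × List ℕ} (hvs : PT vs) (hL : PT L) (hB : PT B) (hs : PT s) :
    PT (fun a => SCCDeletion.bidders (vs a) (L a) (B a) (s a)) := by
  unfold SCCDeletion.bidders; fun_prop

@[fun_prop]
theorem bargains {s : α → List ℕ × List ℕ} {u : α → ℕ} (hvs : PT vs) (hB : PT B) (hs : PT s)
    (hu : PT u) : PT (fun a => SCCDeletion.bargains (vs a) (B a) (s a) (u a)) := by
  unfold SCCDeletion.bargains; fun_prop

@[fun_prop]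
theorem award {s : α → List ℕ × List ℕ} {u v : α → ℕ} (hvs : PT vs) (hs : PT s) (hu : PT u)
    (hv : PT v) : PT (fun a => SCCDeletion.award (vs a) (s a) (u a) (v a)) := by
  unfold SCCDeletion.award; fun_prop

@[fun_prop]
theorem bid {s : α → List ℕ × List ℕ} (hvs : PT vs) (hL : PT L) (hB : PT B) (hs : PT s) :
    PT (fun a => SCCDeletion.bid (vs a) (L a) (B a) (s a)) := by
  unfold SCCDeletion.bid; fun_prop

theorem sz_bid_le (vs L : List ℕ) (B : List (List Bool)) (s : List ℕ × List ℕ) :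
    sz (SCCDeletion.bid vs L B s) ≤ max (sz s) (4 * sz vs) := by
  unfold SCCDeletion.bid
  cases (SCCDeletion.bidders vs L B s).isEmpty
  · simp [SCCDeletion.award, sz_list_nat]; omega
  · simp

@[fun_prop]
theorem bids {s : α → List ℕ × List ℕ} (hvs : PT vs) (hL : PT L) (hB : PT B) (hs : PT s) :
    PT (fun a => SCCDeletion.bids (vs a) (L a) (B a) (s a)) := by
  unfold SCCDeletion.bids
  exact iter (g := fun a s => SCCDeletion.bid (vs a) (L a) (B a) s) (B := fun a => 4 * sz (vs a))
    (by fun_prop) hs (by fun_prop) ((Poly.const 4).mul hvs.size) fun a s => sz_bid_le _ _ _ _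

@[fun_prop]
theorem auction (hvs : PT vs) (hL : PT L) (hB : PT B) :
    PT (fun a => SCCDeletion.auction (vs a) (L a) (B a)) := by
  unfold SCCDeletion.auction
  exact iter (g := fun a s => SCCDeletion.bids (vs a) (L a) (B a) s) (B := fun a => 4 * sz (vs a))
    (by fun_prop) (by fun_prop) (by fun_prop) ((Poly.const 4).mul hvs.size)
    fun a s => sz_iter_le (sz_bid_le _ _ _) _ _

@[fun_prop]
theorem deficiency (hvs : PT vs) (hL : PT L) (hB : PT B) :
    PT (fun a => SCCDeletion.deficiency (vs a) (L a) (B a)) := by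
  unfold SCCDeletion.deficiency; fun_prop

@[fun_prop]
theorem cutMatrix (hvs : PT vs) (hM : PT M) (hH : PT H) (hA : PT A) (hL : PT L) :
    PT (fun a => SCCDeletion.cutMatrix (vs a) (M a) (H a) (A a) (L a)) := by
  unfold SCCDeletion.cutMatrix; fun_prop

@[fun_prop]
theorem lam (hvs : PT vs) (hM : PT M) (hH : PT H) (hA : PT A) (hT : PT T) :
    PT (fun a => SCCDeletion.lam (vs a) (M a) (H a) (A a) (T a)) := by
  unfold SCCDeletion.lam; fun_prop

@[fun_prop]
theorem uni (hvs : PT vs) (hS : PT S) (hT : PT T) :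
    PT (fun a => SCCDeletion.uni (vs a) (S a) (T a)) := by
  unfold SCCDeletion.uni; fun_prop

@[fun_prop]
theorem rmax (hvs : PT vs) (hM : PT M) (hH : PT H) (hA : PT A) (hT : PT T) :
    PT (fun a => SCCDeletion.rmax (vs a) (M a) (H a) (A a) (T a)) := by
  unfold SCCDeletion.rmax; fun_prop

@[fun_prop]
theorem good (hvs : PT vs) (hM : PT M) (hd : PT d) (hH : PT H) :
    PT (fun a => SCCDeletion.good (vs a) (M a) (d a) (H a)) := by
  unfold SCCDeletion.good; fun_prop

@[fun_prop]
theorem returning {v : α → ℕ} (hvs : PT vs) (hM : PT M) (hH : PT H) (hW : PT W) (hv : PT v) :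
    PT (fun a => SCCDeletion.returning (vs a) (M a) (H a) (W a) (v a)) := by
  unfold SCCDeletion.returning; fun_prop

@[fun_prop]
theorem active (hvs : PT vs) (hM : PT M) (hd : PT d) (hH : PT H) (hW : PT W) :
    PT (fun a => SCCDeletion.active (vs a) (M a) (d a) (H a) (W a)) := by
  unfold SCCDeletion.active; fun_prop

@[fun_prop]
theorem diff (hH : PT H) (hS : PT S) : PT (fun a => SCCDeletion.diff (H a) (S a)) := by
  unfold SCCDeletion.diff; fun_prop

@[fun_prop]
theorem advance (hvs : PT vs) (hH : PT H) (hY : PT Y) (hW : PT W) (hS : PT S) (hR : PT R) :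
    PT (fun a => SCCDeletion.advance (vs a) (H a) (Y a) (W a) (S a) (R a)) := by
  unfold SCCDeletion.advance; fun_prop

@[fun_prop]
theorem cutBranches (hvs : PT vs) (hM : PT M) (hk : PT k) (hH : PT H) (hY : PT Y) (hW : PT W)
    (hWu : PT Wu) (hA : PT A) (hT : PT T) (hU : PT U) :
    PT (fun a => SCCDeletion.cutBranches (vs a) (M a) (k a) (H a) (Y a) (W a) (Wu a) (A a) (T a)
      (U a)) := by
  unfold SCCDeletion.cutBranches; fun_prop

@[fun_prop]
theorem vertexBranches {v : α → ℕ} (hvs : PT vs) (hH : PT H) (hY : PT Y) (hW : PT W)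
    (hWu : PT Wu) (hA : PT A) (hT : PT T) (hU : PT U) (hZ : PT Z) (hv : PT v) :
    PT (fun a => SCCDeletion.vertexBranches (vs a) (H a) (Y a) (W a) (Wu a) (A a) (T a)
      (U a) (Z a) (v a)) := by
  unfold SCCDeletion.vertexBranches; fun_prop

@[fun_prop]
theorem finishBranches (hvs : PT vs) (hk : PT k) (hH : PT H) (hY : PT Y) (hW : PT W)
    (hWu : PT Wu) (hA : PT A) (hT : PT T) (hU : PT U) (hR : PT R) (hS : PT S) :
    PT (fun a => SCCDeletion.finishBranches (vs a) (k a) (H a) (Y a) (W a) (Wu a) (A a) (T a)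
      (U a) (R a) (S a)) := by
  unfold SCCDeletion.finishBranches; fun_prop

@[fun_prop]
theorem forced (hvs : PT vs) (hM : PT M) (hd : PT d) (hH : PT H) (hW : PT W) (hA : PT A)
    (hT : PT T) :
    PT (fun a => SCCDeletion.forced (vs a) (M a) (d a) (H a) (W a) (A a) (T a)) := by
  unfold SCCDeletion.forced; fun_prop

@[fun_prop]
theorem mainBranches (hvs : PT vs) (hM : PT M) (hk : PT k) (hd : PT d) (hH : PT H) (hY : PT Y)
    (hW : PT W) (hWu : PT Wu) (hA : PT A) (hT : PT T) (hU : PT U) :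
    PT (fun a => SCCDeletion.mainBranches (vs a) (M a) (k a) (d a) (H a) (Y a) (W a) (Wu a) (A a)
      (T a) (U a)) := by
  unfold SCCDeletion.mainBranches; fun_prop

@[fun_prop]
theorem branches (hvs : PT vs) (hM : PT M) (hk : PT k) (hd : PT d) (hH : PT H) (hY : PT Y)
    (hW : PT W) (hWu : PT Wu) (hA : PT A) (hT : PT T) (hU : PT U) :
    PT (fun a => SCCDeletion.branches (vs a) (M a) (k a) (d a) (H a) (Y a) (W a) (Wu a) (A a)
      (T a) (U a)) := by
  unfold SCCDeletion.branches; fun_prop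

end RecProg.PT

namespace SCCDeletion
open RecProg

/-! ### Correctness of the auction -/

theorem getD_map_range (n : ℕ) (f : ℕ → ℕ) (v : ℕ) :
    ((List.range n).map f).getD v 0 = if v < n then f v else 0 := by
  by_cases h : v < n <;> simp [List.getD, h]

/-- The invariant of the auction: the mates form a matching, nodes of positive price are matched,
prices are at most `n + 1`, and every matched left node has, up to one unit, a cheapest mate. -/
structure AuctionInv (n : ℕ) (B : List (List Bool)) (s : List ℕ × List ℕ) : Prop where
  edge : ∀ v u, s.2.getD v 0 = u + 1 → adj B u v
  inj : ∀ v w u, s.2.getD v 0 = u + 1 → s.2.getD w 0 = u + 1 → v = w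
  matched : ∀ v, 0 < s.1.getD v 0 → ∃ u, s.2.getD v 0 = u + 1
  cheap : ∀ v w u, s.2.getD v 0 = u + 1 → adj B u w → s.1.getD v 0 ≤ s.1.getD w 0 + 1
  le : ∀ v, s.1.getD v 0 ≤ n + 1

/-- The sum of all prices. -/
def totalPrice (n : ℕ) (s : List ℕ × List ℕ) : ℕ := ∑ v ∈ Finset.range n, s.1.getD v 0

section
variable {n : ℕ} {L : List ℕ} {B : List (List Bool)}

theorem isFree_iff {s : List ℕ × List ℕ} {u : ℕ} :
    isFree (List.range n) s u = true ↔ ∀ v < n, s.2.getD v 0 ≠ u + 1 := by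
  simp [isFree, ← Bool.not_eq_true]

theorem bid_of_bidders_eq_nil {s : List ℕ × List ℕ} (h : bidders (List.range n) L B s = []) :
    bid (List.range n) L B s = s := by
  simp [bid, h]

theorem bid_spec (hB : ∀ u v, adj B u v → u ∈ L ∧ v < n) {s : List ℕ × List ℕ}
    (hs : AuctionInv n B s) (h : bidders (List.range n) L B s ≠ []) :
    AuctionInv n B (bid (List.range n) L B s) ∧
      totalPrice n (bid (List.range n) L B s) = totalPrice n s + 1 := by
  obtain ⟨u, us, hu⟩ := List.exists_cons_of_ne_nil h
  have hub : u ∈ bidders (List.range n) L B s := by simp [hu]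
  have hub' : u ∈ L ∧ (∀ v < n, s.2.getD v 0 ≠ u + 1) ∧
      ∃ v < n, adj B u v = true ∧ s.1.getD v 0 ≤ n := by
    simpa [bidders, isFree_iff] using hub
  obtain ⟨-, hfree, v₀, hv₀n, hv₀, hv₀p⟩ := hub'
  have hne : bargains (List.range n) B s u ≠ [] := by
    obtain ⟨v, hv, hmin⟩ := ((Finset.range n).filter fun v => adj B u v = true).exists_min_image
      (fun v => s.1.getD v 0) ⟨v₀, by simp [hv₀n, hv₀]⟩
    have hv' : v < n ∧ adj B u v = true := by simpa using hv
    have : v ∈ bargains (List.range n) B s u := by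
      simp only [bargains, List.mem_filter, List.mem_range, Bool.and_eq_true, List.all_eq_true,
        Bool.or_eq_true, leb_iff]
      refine ⟨hv'.1, hv'.2, fun w hw => ?_⟩
      cases hw' : adj B u w
      · exact Or.inl rfl
      · exact Or.inr (hmin w (by simp [hw, hw']))
    exact List.ne_nil_of_mem this
  obtain ⟨v, vs, hv⟩ := List.exists_cons_of_ne_nil hne
  have hvb : v ∈ bargains (List.range n) B s u := by simp [hv]
  simp only [bargains, List.mem_filter, List.mem_range, Bool.and_eq_true, List.all_eq_true,
    Bool.or_eq_true, leb_iff] at hvb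
  obtain ⟨hvn, hvu, hmin⟩ := hvb
  have hmin' : ∀ w, adj B u w = true → s.1.getD v 0 ≤ s.1.getD w 0 := by
    intro w hw
    rcases hmin w (hB u w hw).2 with h | h
    · simp [hw] at h
    · exact h
  have hb : bid (List.range n) L B s = award (List.range n) s u v := by simp [bid, hu, hv]
  have hp : ∀ x, (bid (List.range n) L B s).1.getD x 0 =
      if x < n then (if x = v then s.1.getD v 0 + 1 else s.1.getD x 0) else 0 := by
    intro x
    rw [hb, award, getD_map_range]
    by_cases hx : x = v
    · subst hx; simp [hvn, eqb, leb]
    · have : eqb x v = false := by rw [← Bool.not_eq_true, eqb_iff]; exact hx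
      simp [hx, this]
  have hm : ∀ x, (bid (List.range n) L B s).2.getD x 0 =
      if x < n then (if x = v then u + 1 else s.2.getD x 0) else 0 := by
    intro x
    rw [hb, award, getD_map_range]
    by_cases hx : x = v
    · subst hx; simp [hvn, eqb, leb]
    · have : eqb x v = false := by rw [← Bool.not_eq_true, eqb_iff]; exact hx
      simp [hx, this]
  have hle : ∀ w < n, s.1.getD w 0 ≤ (bid (List.range n) L B s).1.getD w 0 := by
    intro w hw
    rw [hp, if_pos hw]
    split_ifs with h
    · subst h; omega
    · exact le_rfl
  refine ⟨⟨?_, ?_, ?_, ?_, ?_⟩, ?_⟩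
  · intro x w hx
    rw [hm] at hx
    split_ifs at hx with h₁ h₂
    · obtain rfl : u = w := by omega
      rw [h₂]; exact hvu
    · exact hs.edge x w hx
  · intro x y w hx hy
    rw [hm] at hx hy
    split_ifs at hx hy with h₁ h₂ h₃ h₄ h₅ h₆
    · rw [h₂, h₄]
    · exact absurd (hx ▸ hy) (hfree y h₃)
    · exact absurd (hx.trans hy.symm) (hfree x h₁)
    · exact hs.inj x y w hx hy
  · intro x hx
    rw [hp] at hx
    rw [hm]
    split_ifs at hx ⊢ with h₁ h₂
    · exact ⟨u, rfl⟩
    · exact hs.matched x hx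
    · omega
  · intro x w y hx hy
    have hwn := (hB y w hy).2
    have h₀ := hle w hwn
    rw [hm] at hx
    rw [hp x]
    split_ifs at hx ⊢ with h₁ h₂
    · obtain rfl : u = y := by omega
      have := hmin' w hy
      omega
    · have := hs.cheap x w y hx hy
      omega
  · intro x
    rw [hp]
    split_ifs with h₁ h₂
    · have := hmin' v₀ hv₀; omega
    · exact hs.le x
    · omega
  · unfold totalPrice
    rw [← Finset.add_sum_erase _ _ (Finset.mem_range.2 hvn),
      ← Finset.add_sum_erase _ (fun x => s.1.getD x 0) (Finset.mem_range.2 hvn), hp, if_pos hvn,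
      if_pos rfl]
    have : ∀ x ∈ (Finset.range n).erase v,
        (bid (List.range n) L B s).1.getD x 0 = s.1.getD x 0 := by
      intro x hx
      simp only [Finset.mem_erase, Finset.mem_range] at hx
      rw [hp, if_pos hx.2, if_neg hx.1]
    rw [Finset.sum_congr rfl this]
    omega

/-- After `N` rounds the auction has come to a halt, or the prices sum up to at least `N`. -/
def AuctionStage (n : ℕ) (L : List ℕ) (B : List (List Bool)) (N : ℕ) (s : List ℕ × List ℕ) : Prop :=
  AuctionInv n B s ∧ (bidders (List.range n) L B s = [] ∨ N ≤ totalPrice n s)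

theorem AuctionStage.bid (hB : ∀ u v, adj B u v → u ∈ L ∧ v < n) {s : List ℕ × List ℕ} {N : ℕ}
    (h : AuctionStage n L B N s) : AuctionStage n L B (N + 1) (bid (List.range n) L B s) := by
  by_cases h₀ : bidders (List.range n) L B s = []
  · rw [bid_of_bidders_eq_nil h₀]
    exact ⟨h.1, Or.inl h₀⟩
  · obtain ⟨h₁, h₂⟩ := bid_spec hB h.1 h₀
    have := h.2.resolve_left h₀
    exact ⟨h₁, Or.inr (by omega)⟩

theorem AuctionStage.iter {α : Type} {f : List ℕ × List ℕ → List ℕ × List ℕ} {c : ℕ}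
    (hf : ∀ N s, AuctionStage n L B N s → AuctionStage n L B (N + c) (f s)) (l : List α) :
    ∀ {N s}, AuctionStage n L B N s →
      AuctionStage n L B (N + l.length * c) (l.foldl (fun s _ => f s) s) := by
  induction l with
  | nil => intro N s h; simpa using h
  | cons a l ih =>
    intro N s h
    have := ih (hf _ _ h)
    simp only [List.foldl_cons, List.length_cons, Nat.add_mul]
    convert this using 1
    omega

theorem auction_spec (hB : ∀ u v, adj B u v → u ∈ L ∧ v < n) :
    AuctionInv n B (auction (List.range n) L B) ∧
      bidders (List.range n) L B (auction (List.range n) L B) = [] := by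
  have h₀ : AuctionStage n L B 0 ((List.range n).map fun _ => 0, (List.range n).map fun _ => 0) := by
    have h : ∀ v, ((List.range n).map fun _ => 0).getD v 0 = 0 := by
      intro v; rw [getD_map_range]; simp
    refine ⟨⟨?_, ?_, ?_, ?_, ?_⟩, Or.inr (Nat.zero_le _)⟩ <;> simp only [h] <;> intros <;> omega
  have h₁ : AuctionStage n L B _ (auction (List.range n) L B) :=
    AuctionStage.iter (fun N s hs => AuctionStage.iter (fun N s hs => hs.bid hB) (0 :: List.range n)
      hs) (0 :: List.range n) h₀
  -- There were `(n + 1) ^ 2` rounds, more than the sum of the prices allows.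
  refine ⟨h₁.1, h₁.2.resolve_right fun h => ?_⟩
  have h₂ : totalPrice n (auction (List.range n) L B) ≤ n * (n + 1) := by
    refine (Finset.sum_le_card_nsmul _ _ (n + 1) fun v _ => h₁.1.le v).trans ?_
    simp
  simp only [List.length_cons, List.length_range] at h
  nlinarith

/-- The right nodes that are adjacent to a set of left nodes. -/
def bipNbrs (n : ℕ) (B : List (List Bool)) (R : Finset ℕ) : Finset ℕ :=
  (Finset.range n).filter fun v => ∃ u ∈ R, adj B u v = true

/-- Hall's deficiency formula, lower bound: the matched nodes of `R` have distinct mates. -/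
theorem card_le_card_bipNbrs_add (hL : L.Nodup) (hB : ∀ u v, adj B u v → u ∈ L ∧ v < n)
    {R : Finset ℕ} (hR : R ⊆ L.toFinset) :
    R.card ≤ (bipNbrs n B R).card + deficiency (List.range n) L B := by
  obtain ⟨hs, -⟩ := auction_spec hB
  set s := auction (List.range n) L B with hsdef
  have hD : deficiency (List.range n) L B =
      (L.toFinset.filter fun u => isFree (List.range n) s u = true).card := by
    rw [deficiency, ← hsdef, ← List.toFinset_card_of_nodup (hL.filter _), List.toFinset_filter]
  have h₁ : (R.filter fun u => isFree (List.range n) s u = true).card ≤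
      deficiency (List.range n) L B := by
    rw [hD]; exact Finset.card_le_card (Finset.filter_subset_filter _ hR)
  have h₂ : (R.filter fun u => ¬ isFree (List.range n) s u = true).card ≤ (bipNbrs n B R).card := by
    have : ∀ u ∈ R.filter fun u => ¬ isFree (List.range n) s u = true,
        ∃ v, v < n ∧ s.2.getD v 0 = u + 1 := by
      intro u hu
      have := (Finset.mem_filter.1 hu).2
      rw [isFree_iff] at this
      push Not at this
      exact this
    choose! f hf using this
    refine Finset.card_le_card_of_injOn f ?_ ?_
    · intro u hu
      exact Finset.mem_filter.2 ⟨Finset.mem_range.2 (hf u hu).1, u, (Finset.mem_filter.1 hu).1,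
        hs.edge _ _ (hf u hu).2⟩
    · intro u hu w hw huw
      have h₁ := (hf u hu).2
      have h₂ := (hf w hw).2
      rw [huw] at h₁
      omega
  have := Finset.card_filter_add_card_filter_not (s := R) (fun u => isFree (List.range n) s u = true)
  omega

/-- Hall's deficiency formula, upper bound. Among the `n + 1` positive price levels one, `j`, is not
the price of any of the `n` right nodes; the left nodes that are free or matched above level `j`
only have neighbours above level `j`. -/
theorem exists_card_bipNbrs_add_le (hL : L.Nodup) (hB : ∀ u v, adj B u v → u ∈ L ∧ v < n) :
    ∃ R ⊆ L.toFinset, (bipNbrs n B R).card + deficiency (List.range n) L B ≤ R.card := by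
  obtain ⟨hs, hend⟩ := auction_spec hB
  set s := auction (List.range n) L B with hsdef
  have hD : deficiency (List.range n) L B =
      (L.toFinset.filter fun u => isFree (List.range n) s u = true).card := by
    rw [deficiency, ← hsdef, ← List.toFinset_card_of_nodup (hL.filter _), List.toFinset_filter]
  obtain ⟨j, hj, hgap⟩ : ∃ j ∈ Finset.Icc 1 (n + 1), ∀ v < n, s.1.getD v 0 ≠ j := by
    by_contra! hcon
    have : (Finset.Icc 1 (n + 1)).card ≤ (Finset.range n).card := by
      choose! f hf hf' using hcon
      refine Finset.card_le_card_of_injOn f (fun j hj => by simpa using hf j hj) ?_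
      intro i hi j hj hij
      rw [← hf' i hi, ← hf' j hj, hij]
    simp at this
  have hj' := Finset.mem_Icc.1 hj
  set F := L.toFinset.filter fun u => isFree (List.range n) s u = true with hF
  set ZR := (Finset.range n).filter fun v => j ≤ s.1.getD v 0 with hZR
  have hmate : ∀ v ∈ ZR, ∃ u, s.2.getD v 0 = u + 1 := fun v hv =>
    hs.matched v (by have := (Finset.mem_filter.1 hv).2; omega)
  choose! mate hmate using hmate
  have hinj : Set.InjOn mate ZR := by
    intro v hv w hw hvw
    exact hs.inj v w _ (hmate v hv) (by rw [hvw]; exact hmate w hw)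
  have hdisj : Disjoint (ZR.image mate) F := by
    rw [Finset.disjoint_left]
    intro u hu hu'
    obtain ⟨v, hv, rfl⟩ := Finset.mem_image.1 hu
    exact isFree_iff.1 (Finset.mem_filter.1 hu').2 v
      (Finset.mem_range.1 (Finset.mem_filter.1 hv).1) (hmate v hv)
  refine ⟨ZR.image mate ∪ F, ?_, ?_⟩
  · refine Finset.union_subset ?_ (Finset.filter_subset _ _)
    intro u hu
    obtain ⟨v, hv, rfl⟩ := Finset.mem_image.1 hu
    exact List.mem_toFinset.2 (hB _ _ (hs.edge _ _ (hmate v hv))).1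
  · rw [Finset.card_union_of_disjoint hdisj, Finset.card_image_of_injOn hinj, hD]
    refine Nat.add_le_add_right (Finset.card_le_card ?_) _
    intro w hw
    obtain ⟨hwn, u, hu, huw⟩ := Finset.mem_filter.1 hw
    refine Finset.mem_filter.2 ⟨hwn, ?_⟩
    rcases Finset.mem_union.1 hu with hu | hu
    · obtain ⟨v, hv, rfl⟩ := Finset.mem_image.1 hu
      have h₁ := hs.cheap v w _ (hmate v hv) huw
      have h₂ := (Finset.mem_filter.1 hv).2
      have h₃ := hgap v (Finset.mem_range.1 (Finset.mem_filter.1 hv).1)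
      omega
    · by_contra hlt
      obtain ⟨huL, hfree⟩ := Finset.mem_filter.1 hu
      have : u ∈ bidders (List.range n) L B s := by
        simp only [bidders, List.mem_filter, Bool.and_eq_true, List.any_eq_true, leb_iff,
          List.length_range]
        exact ⟨List.mem_toFinset.1 huL, hfree, w, by simpa using hwn, huw, by omega⟩
      rw [hend] at this
      simp at this

end
end SCCDeletion

namespace SCCDeletion
open RecProg

/-! ### Boundaries and minimum cuts -/

section
open Classical

/-- The boundary of `R` in `H`: the vertices of `H` outside `R` that have an in-neighbour in `R`. -/
noncomputable def bd (E : ℕ → ℕ → Prop) (H R : Finset ℕ) : Finset ℕ :=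
  (H \ R).filter fun v => ∃ u ∈ R, E u v

variable {E : ℕ → ℕ → Prop} {H R S : Finset ℕ}

theorem mem_bd {v : ℕ} : v ∈ bd E H R ↔ v ∈ H ∧ v ∉ R ∧ ∃ u ∈ R, E u v := by
  simp [bd, and_assoc]

/-- The size of the boundary is a submodular function. -/
theorem card_bd_union_add_card_bd_inter_le :
    (bd E H (R ∪ S)).card + (bd E H (R ∩ S)).card ≤ (bd E H R).card + (bd E H S).card := by
  rw [← Finset.card_union_add_card_inter (bd E H R),
    ← Finset.card_union_add_card_inter (bd E H (R ∪ S))]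
  refine Nat.add_le_add (Finset.card_le_card ?_) (Finset.card_le_card ?_) <;>
  · intro v
    simp only [mem_bd, Finset.mem_union, Finset.mem_inter]
    grind

/-- Some set that contains `A` and avoids `T` has a boundary of size at most `c` in `H`. -/
def CutLE (E : ℕ → ℕ → Prop) (H A T : Finset ℕ) (c : ℕ) : Prop :=
  ∃ R, A ⊆ R ∧ R ⊆ H ∧ Disjoint R T ∧ (bd E H R).card ≤ c

end

/-- The digraph with the adjacency matrix `M`. -/
abbrev rel (M : List (List Bool)) (u v : ℕ) : Prop := adj M u v = true

theorem adj_cutMatrix {n : ℕ} {M : List (List Bool)} {H A L : List ℕ} {u v : ℕ} :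
    adj (cutMatrix (List.range n) M H A L) u v = true ↔ u < n ∧ v < n ∧ u ∈ L ∧ v ∈ H ∧ v ∉ A ∧
      v ∉ bdry M H A ∧ (u = v ∨ adj M u v = true) := by
  unfold adj cutMatrix
  by_cases hu : u < n
  · by_cases hv : v < n
    · simp [List.getD, hu, hv, adj, and_assoc]
    · simp [List.getD, hu, hv]
  · simp [List.getD, hu]

theorem toFinset_bdry (M : List (List Bool)) (H R : List ℕ) :
    (bdry M H R).toFinset = bd (rel M) H.toFinset R.toFinset := by
  ext v
  simp [bdry, mem_bd]

section
variable {n : ℕ} {M : List (List Bool)} {H A T : List ℕ}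

/-- The boundary of `A ∪ R` in terms of the neighbours of `R` in the bipartite graph. -/
theorem card_bd_union_add_card (hHn : ∀ v ∈ H, v < n)
    {L : List ℕ} (hLA : ∀ u ∈ L, u ∈ H ∧ u ∉ A) {R : Finset ℕ} (hR : R ⊆ L.toFinset) :
    (bd (rel M) H.toFinset (A.toFinset ∪ R)).card + R.card =
      (bdry M H A).toFinset.card +
        (bipNbrs n (cutMatrix (List.range n) M H A L) R).card := by
  rw [← Finset.card_union_of_disjoint, ← Finset.card_union_of_disjoint]
  · congr 1
    ext x
    have hRx : ∀ u ∈ R, u < n ∧ u ∈ L ∧ u ∈ H ∧ u ∉ A := fun u hu => by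
      have h₁ := List.mem_toFinset.1 (hR hu)
      have h₂ := hLA u h₁
      exact ⟨hHn u h₂.1, h₁, h₂⟩
    have hHx := hHn x
    simp only [Finset.mem_union, mem_bd, toFinset_bdry, bipNbrs, Finset.mem_filter,
      Finset.mem_range, adj_cutMatrix, List.mem_toFinset]
    have hb : x ∈ bdry M H A ↔ x ∈ H ∧ x ∉ A ∧ ∃ r ∈ A, adj M r x = true := by
      simp [bdry]
    rw [hb]
    grind
  · rw [Finset.disjoint_left]
    intro x hx hx'
    obtain ⟨_, u, _, hu⟩ := Finset.mem_filter.1 hx'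
    exact (adj_cutMatrix.1 hu).2.2.2.2.2.1 (List.mem_toFinset.1 hx)
  · rw [Finset.disjoint_left]
    intro x hx hx'
    exact (mem_bd.1 hx).2.1 (Finset.mem_union_right _ hx')

/-- `lam` is the minimum size of a cut. -/
theorem lam_le_iff (hH : H.Nodup) (hHn : ∀ v ∈ H, v < n) (hA : ∀ a ∈ A, a ∈ H) {c : ℕ}
    (hc : c ≤ n) : lam (List.range n) M H A T ≤ c ↔
      CutLE (rel M) H.toFinset A.toFinset T.toFinset c := by
  unfold lam CutLE
  by_cases hAT : (A.any fun a => mem a T) = true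
  · rw [hAT]
    simp only [cond_true, List.length_range]
    refine iff_of_false (by omega) ?_
    rintro ⟨R, hAR, -, hRT, -⟩
    obtain ⟨a, ha, ha'⟩ := List.any_eq_true.1 hAT
    exact Finset.disjoint_left.1 hRT (hAR (List.mem_toFinset.2 ha))
      (List.mem_toFinset.2 (mem_iff.1 ha'))
  · rw [Bool.not_eq_true] at hAT
    rw [hAT]
    simp only [cond_false]
    set L := H.filter fun u => !mem u A && !mem u T with hL
    have hLm : ∀ u, u ∈ L ↔ u ∈ H ∧ u ∉ A ∧ u ∉ T := fun u => by simp [hL]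
    have hB : ∀ u v, adj (cutMatrix (List.range n) M H A L) u v → u ∈ L ∧ v < n := fun u v h => by
      have := adj_cutMatrix.1 h
      exact ⟨this.2.2.1, this.2.1⟩
    have hLA : ∀ u ∈ L, u ∈ H ∧ u ∉ A := fun u hu => by
      have := (hLm u).1 hu
      exact ⟨this.1, this.2.1⟩
    have hLn : L.Nodup := hH.filter _
    have hnb : (bdry M H A).toFinset.card = (bdry M H A).length :=
      List.toFinset_card_of_nodup (hH.filter _)
    rw [List.any_eq_false] at hAT
    constructor
    · intro h
      obtain ⟨R, hR, hcard⟩ := exists_card_bipNbrs_add_le hLn hB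
      have h₁ := card_bd_union_add_card (M := M) hHn hLA hR
      refine ⟨A.toFinset ∪ R, Finset.subset_union_left, Finset.union_subset ?_ ?_, ?_, by omega⟩
      · intro a ha
        exact List.mem_toFinset.2 (hA a (List.mem_toFinset.1 ha))
      · intro u hu
        exact List.mem_toFinset.2 (hLA u (List.mem_toFinset.1 (hR hu))).1
      · rw [Finset.disjoint_left]
        intro x hx hx'
        rcases Finset.mem_union.1 hx with hx | hx
        · exact hAT x (List.mem_toFinset.1 hx) (mem_iff.2 (List.mem_toFinset.1 hx'))
        · exact ((hLm x).1 (List.mem_toFinset.1 (hR hx))).2.2 (List.mem_toFinset.1 hx')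
    · rintro ⟨R, hAR, hRH, hRT, hcard⟩
      have hR : R \ A.toFinset ⊆ L.toFinset := by
        intro x hx
        obtain ⟨h₁, h₂⟩ := Finset.mem_sdiff.1 hx
        rw [List.mem_toFinset, hLm]
        exact ⟨List.mem_toFinset.1 (hRH h₁), fun h => h₂ (List.mem_toFinset.2 h),
          fun h => Finset.disjoint_left.1 hRT h₁ (List.mem_toFinset.2 h)⟩
      have h₁ := card_bd_union_add_card (M := M) hHn hLA hR
      have h₂ := card_le_card_bipNbrs_add hLn hB hR
      rw [Finset.union_sdiff_of_subset hAR] at h₁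
      omega

theorem toFinset_uni (hA : ∀ a ∈ A, a < n) (hT : ∀ t ∈ T, t < n) :
    (uni (List.range n) A T).toFinset = A.toFinset ∪ T.toFinset := by
  ext v
  simp only [uni, List.mem_toFinset, List.mem_filter, List.mem_range, Bool.or_eq_true, mem_iff,
    Finset.mem_union]
  exact ⟨fun h => h.2, fun h => ⟨h.elim (hA v) (hT v), h⟩⟩

theorem mem_uni {v : ℕ} :
    v ∈ uni (List.range n) A T ↔ v < n ∧ (v ∈ A ∨ v ∈ T) := by
  simp [uni]

theorem mem_diff {v : ℕ} : v ∈ diff H A ↔ v ∈ H ∧ v ∉ A := by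
  simp [diff]

/-- If the sizes of cuts are bounded by `n`, then a largest minimum cut contains every minimum cut:
`rmax` consists of the vertices of all minimum cuts, and is one itself. -/
theorem rmax_spec (hH : H.Nodup) (hHn : ∀ v ∈ H, v < n) (hA : ∀ a ∈ A, a ∈ H)
    (hlam : lam (List.range n) M H A T ≤ n) :
    A.toFinset ⊆ (rmax (List.range n) M H A T).toFinset ∧
    Disjoint (rmax (List.range n) M H A T).toFinset T.toFinset ∧
    (bd (rel M) H.toFinset (rmax (List.range n) M H A T).toFinset).card =
      lam (List.range n) M H A T ∧
    ∀ s ∈ H, s ∉ rmax (List.range n) M H A T →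
      lam (List.range n) M H A T < lam (List.range n) M H (uni (List.range n) A [s]) T := by
  classical
  set l := lam (List.range n) M H A T with hl
  have hmem : ∀ v, v ∈ rmax (List.range n) M H A T ↔
      v ∈ H ∧ lam (List.range n) M H (uni (List.range n) A [v]) T ≤ l := fun v => by
    simp [rmax, hl]
  have hins : ∀ v ∈ H, (uni (List.range n) A [v]).toFinset = insert v A.toFinset := fun v hv => by
    rw [toFinset_uni (fun a ha => hHn a (hA a ha)) (by simpa using hHn v hv)]
    ext x; simp
  have hinsH : ∀ v ∈ H, ∀ a ∈ uni (List.range n) A [v], a ∈ H := fun v hv a ha => by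
    rcases (mem_uni.1 ha).2 with h | h
    · exact hA a h
    · rwa [List.mem_singleton.1 h]
  let F : Finset (Finset ℕ) := H.toFinset.powerset.filter fun R =>
    A.toFinset ⊆ R ∧ Disjoint R T.toFinset ∧
      (bd (rel M) H.toFinset R).card ≤ l
  have hF : F.Nonempty := by
    obtain ⟨R, h₁, h₂, h₃, h₄⟩ := (lam_le_iff hH hHn hA hlam).1 le_rfl
    exact ⟨R, Finset.mem_filter.2 ⟨Finset.mem_powerset.2 h₂, h₁, h₃, h₄⟩⟩
  obtain ⟨R₀, hR₀, hmax⟩ := F.exists_max_image Finset.card hF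
  simp only [F, Finset.mem_filter, Finset.mem_powerset] at hR₀ hmax
  obtain ⟨hR₀H, hAR₀, hR₀T, hR₀c⟩ := hR₀
  have hge : ∀ R, A.toFinset ⊆ R → R ⊆ H.toFinset → Disjoint R T.toFinset →
      l ≤ (bd (rel M) H.toFinset R).card := by
    intro R h₁ h₂ h₃
    by_contra hlt
    push Not at hlt
    have := (lam_le_iff (T := T) (M := M) (A := A) hH hHn hA (c :=
      (bd (rel M) H.toFinset R).card) (by omega)).2 ⟨R, h₁, h₂, h₃, le_rfl⟩
    omega
  have hsub : ∀ R, A.toFinset ⊆ R → R ⊆ H.toFinset → Disjoint R T.toFinset →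
      (bd (rel M) H.toFinset R).card ≤ l → R ⊆ R₀ := by
    intro R h₁ h₂ h₃ h₄
    have h₅ := card_bd_union_add_card_bd_inter_le (E := rel M)
      (H := H.toFinset) (R := R) (S := R₀)
    have h₆ := hge (R ∩ R₀) (Finset.subset_inter h₁ hAR₀) (Finset.inter_subset_left.trans h₂)
      (h₃.mono_left Finset.inter_subset_left)
    have h₇ := hmax (R ∪ R₀) ⟨Finset.union_subset h₂ hR₀H,
      h₁.trans Finset.subset_union_left, Finset.disjoint_union_left.2 ⟨h₃, hR₀T⟩, by omega⟩
    have h₈ := Finset.eq_of_subset_of_card_le (Finset.subset_union_right (s₁ := R) (s₂ := R₀)) h₇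
    rw [h₈]
    exact Finset.subset_union_left
  have heq : (rmax (List.range n) M H A T).toFinset = R₀ := by
    ext v
    rw [List.mem_toFinset, hmem]
    constructor
    · rintro ⟨hv, hle⟩
      obtain ⟨R, h₁, h₂, h₃, h₄⟩ := (lam_le_iff hH hHn (hinsH v hv) hlam).1 hle
      rw [hins v hv] at h₁
      exact hsub R ((Finset.subset_insert _ _).trans h₁) h₂ h₃ h₄
        (h₁ (Finset.mem_insert_self _ _))
    · intro hv
      have hvH := List.mem_toFinset.1 (hR₀H hv)
      refine ⟨hvH, (lam_le_iff hH hHn (hinsH v hvH) hlam).2 ⟨R₀, ?_, hR₀H, hR₀T, hR₀c⟩⟩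
      rw [hins v hvH]
      exact Finset.insert_subset hv hAR₀
  rw [heq]
  refine ⟨hAR₀, hR₀T, le_antisymm hR₀c (hge _ hAR₀ hR₀H hR₀T), fun s hs hs' => ?_⟩
  by_contra hle
  exact hs' ((hmem s).2 ⟨hs, not_lt.1 hle⟩)

end
end SCCDeletion

namespace SCCDeletion
open RecProg Relation

/-! ### Reachability and bounded strong components -/

/-- There is a walk from `u` to `v` all of whose vertices after `u` lie in `H`. -/
def Rch (E : ℕ → ℕ → Prop) (H : Finset ℕ) (u v : ℕ) : Prop :=
  ReflTransGen (fun x y => E x y ∧ y ∈ H) u v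

section
variable {E : ℕ → ℕ → Prop} {H G R S W X U : Finset ℕ} {u v w : ℕ}

theorem Rch.mono (h : Rch E H u v) (hHG : H ⊆ G) : Rch E G u v :=
  ReflTransGen.mono (fun _ _ h => ⟨h.1, hHG h.2⟩) _ _ h

theorem Rch.mem (h : Rch E H u v) (hu : u ∈ H) : v ∈ H := by
  rcases ReflTransGen.cases_tail h with rfl | ⟨_, _, h⟩
  · exact hu
  · exact h.2

/-- A walk that starts in an out-closed set stays there. -/
theorem Rch.inside (h : Rch E H u v) (hR : ∀ x ∈ R, ∀ y ∈ H, E x y → y ∈ R) (hu : u ∈ R) :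
    v ∈ R ∧ Rch E (H ∩ R) u v := by
  induction h with
  | refl => exact ⟨hu, .refl⟩
  | tail _ hxy ih =>
    have hy := hR _ ih.1 _ hxy.2 hxy.1
    exact ⟨hy, ih.2.tail ⟨hxy.1, Finset.mem_inter.2 ⟨hxy.2, hy⟩⟩⟩

/-- A walk that ends outside an out-closed set avoids it. -/
theorem Rch.outside (h : Rch E H u v) (hR : ∀ x ∈ R, ∀ y ∈ H, E x y → y ∈ R) (hv : v ∉ R) :
    u ∉ R ∧ Rch E (H \ R) u v := by
  induction h using ReflTransGen.head_induction_on with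
  | refl => exact ⟨hv, .refl⟩
  | head hxy _ ih =>
    exact ⟨fun hx => ih.1 (hR _ hx _ hxy.2 hxy.1),
      ReflTransGen.head ⟨hxy.1, Finset.mem_sdiff.2 ⟨hxy.2, ih.1⟩⟩ ih.2⟩

theorem bd_closed : ∀ x ∈ R, ∀ y ∈ H \ bd E H R, E x y → y ∈ R := by
  intro x hx y hy hxy
  by_contra hyR
  exact (Finset.mem_sdiff.1 hy).2 (mem_bd.2 ⟨(Finset.mem_sdiff.1 hy).1, hyR, x, hx, hxy⟩)

open Classical in
/-- Cuts of size zero witness that nothing is reachable. -/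
theorem cutLE_zero_iff (hu : u ∈ H) : CutLE E H {u} W 0 ↔ ∀ w ∈ W, ¬ Rch E H u w := by
  constructor
  · rintro ⟨R, huR, hRH, hRW, hcard⟩ w hw h
    have hbd : bd E H R = ∅ := Finset.card_eq_zero.1 (Nat.le_zero.1 hcard)
    have hcl := bd_closed (E := E) (H := H) (R := R)
    rw [hbd, Finset.sdiff_empty] at hcl
    exact Finset.disjoint_left.1 hRW (h.inside hcl (huR (by simp))).1 hw
  · intro h
    refine ⟨H.filter (Rch E H u), ?_, Finset.filter_subset _ _, ?_, ?_⟩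
    · rw [Finset.singleton_subset_iff, Finset.mem_filter]
      exact ⟨hu, .refl⟩
    · rw [Finset.disjoint_left]
      intro x hx hx'
      exact h x hx' (Finset.mem_filter.1 hx).2
    · rw [Nat.le_zero, Finset.card_eq_zero, Finset.eq_empty_iff_forall_notMem]
      intro x hx
      obtain ⟨hxH, hx', y, hy, hyx⟩ := mem_bd.1 hx
      exact hx' (Finset.mem_filter.2 ⟨hxH, (Finset.mem_filter.1 hy).2.tail ⟨hyx, hxH⟩⟩)

open Classical in
/-- Every vertex of `H` has at most `d` out-neighbours in its strong component of `D[H]`. -/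
def Good (E : ℕ → ℕ → Prop) (d : ℕ) (H : Finset ℕ) : Prop :=
  ∀ v ∈ H, (H.filter fun u => E v u ∧ Rch E H u v).card ≤ d

variable {d : ℕ}

theorem Good.mono (h : Good E d G) (hHG : H ⊆ G) : Good E d H := by
  classical
  intro v hv
  refine (Finset.card_le_card fun u hu => ?_).trans (h v (hHG hv))
  simp only [Finset.mem_filter] at hu ⊢
  exact ⟨hHG hu.1, hu.2.1, hu.2.2.mono hHG⟩

/-- Let `R` be out-closed in `G` and free of terminals. Every strong component of `D[G]` lies in `R`
or avoids it, and is bounded because `D[H \ W]` or `D[H \ X]` has bounded components. -/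
theorem Good.of_closed (hW : Good E d (H \ W)) (hX : Good E d (H \ X)) (hGH : G ⊆ H)
    (hRW : Disjoint R W) (hcl : ∀ x ∈ R, ∀ y ∈ G, E x y → y ∈ R) (hGR : G \ R ⊆ H \ X) :
    Good E d G := by
  classical
  intro v hv
  by_cases hvR : v ∈ R
  · have hsub : G ∩ R ⊆ H \ W := fun y hy => by
      obtain ⟨h₁, h₂⟩ := Finset.mem_inter.1 hy
      exact Finset.mem_sdiff.2 ⟨hGH h₁, Finset.disjoint_left.1 hRW h₂⟩
    refine (Finset.card_le_card fun u hu => ?_).trans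
      (hW v (hsub (Finset.mem_inter.2 ⟨hv, hvR⟩)))
    simp only [Finset.mem_filter] at hu ⊢
    obtain ⟨huG, hvu, huv⟩ := hu
    have huR := hcl v hvR u huG hvu
    exact ⟨hsub (Finset.mem_inter.2 ⟨huG, huR⟩), hvu, (huv.inside hcl huR).2.mono hsub⟩
  · refine (Finset.card_le_card fun u hu => ?_).trans
      (hX v (hGR (Finset.mem_sdiff.2 ⟨hv, hvR⟩)))
    simp only [Finset.mem_filter] at hu ⊢
    obtain ⟨huG, hvu, huv⟩ := hu
    obtain ⟨huR, huv⟩ := huv.outside hcl hvR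
    exact ⟨hGR (Finset.mem_sdiff.2 ⟨huG, huR⟩), hvu, huv.mono hGR⟩

open Classical in
/-- The set of vertices that can be reached from `U` after the deletion of `X`. -/
noncomputable def reachSet (E : ℕ → ℕ → Prop) (H X U : Finset ℕ) : Finset ℕ :=
  (H \ X).filter fun v => ∃ u ∈ U, Rch E (H \ X) u v

theorem mem_reachSet : v ∈ reachSet E H X U ↔ v ∈ H \ X ∧ ∃ u ∈ U, Rch E (H \ X) u v := by
  simp [reachSet]

theorem bd_reachSet_subset : bd E H (reachSet E H X U) ⊆ X := by
  intro y hy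
  obtain ⟨hyH, hyQ, x, hx, hxy⟩ := mem_bd.1 hy
  by_contra hyX
  obtain ⟨-, u, hu, hux⟩ := mem_reachSet.1 hx
  have hyHX := Finset.mem_sdiff.2 ⟨hyH, hyX⟩
  exact hyQ (mem_reachSet.2 ⟨hyHX, u, hu, hux.tail ⟨hxy, hyHX⟩⟩)

theorem reachSet_subset : reachSet E H X U ⊆ H := fun _ hv =>
  (Finset.mem_sdiff.1 (mem_reachSet.1 hv).1).1

/-- A set around `U` that no walk from `U` leaves through its boundary contains everything that is
reachable from `U`. -/
theorem reachSet_subset_of_bd (hUX : U ⊆ H \ X) (hUR : U ⊆ R)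
    (hSU : ∀ s ∈ bd E H R, ∀ u ∈ U, ¬ Rch E (H \ X) u s) : reachSet E H X U ⊆ R := by
  intro v hv
  obtain ⟨-, u, hu, h⟩ := mem_reachSet.1 hv
  induction h with
  | refl => exact hUR hu
  | @tail x y hux hxy ih =>
    have hxR := ih (mem_reachSet.2 ⟨Rch.mem hux (hUX hu), u, hu, hux⟩)
    by_contra hyR
    exact hSU y (mem_bd.2 ⟨(Finset.mem_sdiff.1 hxy.2).1, hyR, x, hxR, hxy.1⟩) u hu
      (hux.tail hxy)

/-- The pushing lemma: if the deletion of `X` cuts `U` off from the terminals, and `R` is a minimum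
cut around `U` whose boundary meets neither `X` nor the vertices reachable from `U`, then some
solution contains the boundary of `R`. -/
theorem exists_solution_of_push (hXH : X ⊆ H) (hX : Good E d (H \ X)) (hW : Good E d (H \ W))
    (hUX : U ⊆ H \ X) (hUW : ∀ u ∈ U, ∀ w ∈ W, ¬ Rch E (H \ X) u w) (hUR : U ⊆ R)
    (hRW : Disjoint R W)
    (hmin : ∀ R', U ⊆ R' → R' ⊆ H → Disjoint R' W → (bd E H R).card ≤ (bd E H R').card)
    (hSX : ∀ s ∈ bd E H R, s ∉ X) (hSU : ∀ s ∈ bd E H R, ∀ u ∈ U, ¬ Rch E (H \ X) u s) :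
    ∃ X' ⊆ H \ bd E H R, X'.card + (bd E H R).card ≤ X.card ∧ Good E d ((H \ bd E H R) \ X') := by
  classical
  have hQR := reachSet_subset_of_bd hUX hUR hSU
  have hcard := hmin (reachSet E H X U) (fun u hu => mem_reachSet.2 ⟨hUX hu, u, hu, .refl⟩)
    reachSet_subset (by
      rw [Finset.disjoint_left]
      intro w hw hw'
      obtain ⟨-, u, hu, h⟩ := mem_reachSet.1 hw
      exact hUW u hu w hw' h)
  refine ⟨X \ bd E H (reachSet E H X U), fun x hx => ?_, ?_, ?_⟩
  · have := (Finset.mem_sdiff.1 hx).1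
    exact Finset.mem_sdiff.2 ⟨hXH this, fun h => hSX x h this⟩
  · have := Finset.card_sdiff_add_card_eq_card (bd_reachSet_subset (E := E) (H := H) (X := X)
      (U := U))
    omega
  · refine hW.of_closed hX (R := R) (Finset.sdiff_subset.trans Finset.sdiff_subset) hRW ?_ ?_
    · intro x hx y hy hxy
      exact bd_closed x hx y (Finset.mem_sdiff.1 hy).1 hxy
    · intro y hy
      simp only [Finset.mem_sdiff] at hy ⊢
      obtain ⟨⟨⟨hyH, hyS⟩, hyX⟩, hyR⟩ := hy
      refine ⟨hyH, fun h => hyX ⟨h, fun hyQ => ?_⟩⟩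
      obtain ⟨-, -, x, hx, hxy⟩ := mem_bd.1 hyQ
      exact hyS (mem_bd.2 ⟨hyH, hyR, x, hQR hx, hxy⟩)

/-- If the vertices `Q` reachable after the deletion of `X` lie in `R`, and the boundary of `R` is
not larger than the one of `Q`, then `R` and its boundary can be split off. -/
theorem exists_solution_of_finish {Q : Finset ℕ} (hX : Good E d (H \ X))
    (hQX : bd E H Q ⊆ X) (hQR : Q ⊆ R) (hcard : (bd E H R).card ≤ (bd E H Q).card) :
    ∃ X' ⊆ (H \ bd E H R) \ R, X'.card + (bd E H R).card ≤ X.card ∧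
      Good E d (((H \ bd E H R) \ R) \ X') := by
  classical
  refine ⟨(X \ bd E H Q) ∩ ((H \ bd E H R) \ R), Finset.inter_subset_right, ?_, ?_⟩
  · have h₁ := Finset.card_sdiff_add_card_eq_card hQX
    have h₂ := Finset.card_le_card
      (Finset.inter_subset_left (s₁ := X \ bd E H Q) (s₂ := (H \ bd E H R) \ R))
    omega
  · refine hX.mono fun y hy => ?_
    simp only [Finset.mem_sdiff, Finset.mem_inter] at hy ⊢
    obtain ⟨⟨⟨hyH, hyS⟩, hyR⟩, hyX⟩ := hy
    refine ⟨hyH, fun h => hyX ⟨⟨h, fun hyQ => ?_⟩, ⟨hyH, hyS⟩, hyR⟩⟩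
    obtain ⟨-, -, x, hx, hxy⟩ := mem_bd.1 hyQ
    exact hyS (mem_bd.2 ⟨hyH, hyR, x, hQR hx, hxy⟩)

open Classical in
/-- Let the vertices of `R` have at most `d` out-neighbours from which a terminal is reachable. Once
the boundary of `R` is deleted, no arc leaves `R`, and `R` can be added to a set with bounded strong
components: a strong component in `R` either reaches a terminal or lies in `H \ W`. -/
theorem Good.union (hW : Good E d (H \ W)) (hRH : R ⊆ H)
    (hR : ∀ v ∈ R, (H.filter fun z => E v z ∧ ∃ w ∈ W, Rch E H z w).card ≤ d)
    (hGH : G ⊆ (H \ bd E H R) \ R) (hG : Good E d G) : Good E d (R ∪ G) := by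
  have hRG : R ∪ G ⊆ H := Finset.union_subset hRH
    (hGH.trans (Finset.sdiff_subset.trans Finset.sdiff_subset))
  have hcl : ∀ x ∈ R, ∀ y ∈ R ∪ G, E x y → y ∈ R := by
    intro x hx y hy hxy
    rcases Finset.mem_union.1 hy with hy | hy
    · exact hy
    · exact bd_closed x hx y (Finset.mem_sdiff.1 (hGH hy)).1 hxy
  intro v hv
  by_cases hvR : v ∈ R
  · by_cases hvW : ∃ w ∈ W, Rch E (R ∪ G) v w
    · obtain ⟨w, hw, hvw⟩ := hvW
      refine (Finset.card_le_card fun u hu => ?_).trans (hR v hvR)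
      simp only [Finset.mem_filter] at hu ⊢
      exact ⟨hRG hu.1, hu.2.1, w, hw, Rch.mono (hu.2.2.trans hvw) hRG⟩
    · have hvW' : v ∈ H \ W := Finset.mem_sdiff.2 ⟨hRH hvR, fun h => hvW ⟨v, h, .refl⟩⟩
      refine (Finset.card_le_card fun u hu => ?_).trans (hW v hvW')
      simp only [Finset.mem_filter] at hu ⊢
      obtain ⟨huG, hvu, huv⟩ := hu
      have key : ∀ x, Rch E (R ∪ G) v x → x ∈ R ∪ G → x ∈ H \ W := fun x hx hxG =>
        Finset.mem_sdiff.2 ⟨hRG hxG, fun h => hvW ⟨x, h, hx⟩⟩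
      have hvu' : Rch E (R ∪ G) v u := .single ⟨hvu, huG⟩
      refine ⟨key u hvu' huG, hvu, ?_⟩
      have : ∀ x, Rch E (R ∪ G) u x → Rch E (H \ W) u x := by
        intro x hx
        induction hx with
        | refl => exact .refl
        | tail hx hxy ih => exact ih.tail ⟨hxy.1, key _ ((hvu'.trans hx).tail hxy) hxy.2⟩
      exact this v huv
  · have hvG := (Finset.mem_union.1 hv).resolve_left hvR
    have hsub : (R ∪ G) \ R ⊆ G := fun y hy =>
      (Finset.mem_union.1 (Finset.mem_sdiff.1 hy).1).resolve_left (Finset.mem_sdiff.1 hy).2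
    refine (Finset.card_le_card fun u hu => ?_).trans (hG v hvG)
    simp only [Finset.mem_filter] at hu ⊢
    obtain ⟨huG, hvu, huv⟩ := hu
    obtain ⟨huR, huv⟩ := huv.outside hcl hvR
    exact ⟨(Finset.mem_union.1 huG).resolve_left huR, hvu, huv.mono hsub⟩

/-- Among the remaining terminals there is one that lies in a last strong component. -/
theorem exists_sink (E : ℕ → ℕ → Prop) (G : Finset ℕ) (hne : (W ∩ G).Nonempty) :
    ∃ r ∈ W ∩ G, ∀ w ∈ W, Rch E G r w → Rch E G w r := by
  classical
  obtain ⟨r, hr, hmin⟩ := (W ∩ G).exists_min_image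
    (fun r => ((W ∩ G).filter (Rch E G r)).card) hne
  refine ⟨r, hr, fun w hw hrw => ?_⟩
  have hwG : w ∈ W ∩ G := Finset.mem_inter.2 ⟨hw, hrw.mem (Finset.mem_inter.1 hr).2⟩
  have hsub : (W ∩ G).filter (Rch E G w) ⊆ (W ∩ G).filter (Rch E G r) := fun x hx =>
    Finset.mem_filter.2 ⟨(Finset.mem_filter.1 hx).1, hrw.trans (Finset.mem_filter.1 hx).2⟩
  have h := Finset.eq_of_subset_of_card_le hsub (hmin w hwG)
  have : r ∈ (W ∩ G).filter (Rch E G w) := by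
    rw [h]; exact Finset.mem_filter.2 ⟨hr, .refl⟩
  exact (Finset.mem_filter.1 this).2

end

section
variable {n : ℕ} {M : List (List Bool)} {H W : List ℕ}

theorem one_le_lam_iff (hH : H.Nodup) (hHn : ∀ v ∈ H, v < n) {u : ℕ} (hu : u ∈ H) :
    1 ≤ lam (List.range n) M H [u] W ↔
      ∃ w ∈ W, Rch (rel M) H.toFinset u w := by
  have h := (lam_le_iff (M := M) (T := W) hH hHn (A := [u]) (by simpa using hu)
    (Nat.zero_le n)).trans (by
      simpa using cutLE_zero_iff (E := rel M) (W := W.toFinset)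
        (List.mem_toFinset.2 hu))
  rw [← not_iff_not]
  push Not
  rw [Nat.lt_one_iff, ← Nat.le_zero, h]

theorem good_iff (hH : H.Nodup) (hHn : ∀ v ∈ H, v < n) {d : ℕ} :
    good (List.range n) M d H = true ↔ Good (rel M) d H.toFinset := by
  classical
  unfold good Good
  simp only [List.all_eq_true, leb_iff, List.mem_toFinset]
  refine forall₂_congr fun v _ => ?_
  rw [← List.toFinset_card_of_nodup (hH.filter _)]
  refine iff_of_eq (congrArg (fun S : Finset ℕ => S.card ≤ d) ?_)
  ext u
  simp only [List.mem_toFinset, List.mem_filter, Bool.and_eq_true, leb_iff, Finset.mem_filter]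
  constructor
  · rintro ⟨hu, h₁, h₂⟩
    obtain ⟨w, hw, h⟩ := (one_le_lam_iff hH hHn hu).1 h₂
    simp only [List.mem_singleton] at hw
    exact ⟨hu, h₁, hw ▸ h⟩
  · rintro ⟨hu, h₁, h₂⟩
    exact ⟨hu, h₁, (one_le_lam_iff hH hHn hu).2 ⟨v, by simp, h₂⟩⟩

open Classical in
theorem toFinset_returning (hH : H.Nodup) (hHn : ∀ v ∈ H, v < n) {v : ℕ} :
    (returning (List.range n) M H W v).toFinset = H.toFinset.filter fun z =>
      adj M v z = true ∧ ∃ w ∈ W.toFinset, Rch (rel M) H.toFinset z w := by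
  ext z
  simp only [returning, List.mem_toFinset, List.mem_filter, Bool.and_eq_true, leb_iff,
    Finset.mem_filter]
  constructor
  · rintro ⟨hz, h₁, h₂⟩
    exact ⟨hz, h₁, (one_le_lam_iff hH hHn hz).1 h₂⟩
  · rintro ⟨hz, h₁, h₂⟩
    exact ⟨hz, h₁, (one_le_lam_iff hH hHn hz).2 h₂⟩

theorem mem_active (hH : H.Nodup) {d v : ℕ} :
    v ∈ active (List.range n) M d H W ↔
      v ∈ H ∧ d < (returning (List.range n) M H W v).toFinset.card := by
  have hn : (returning (List.range n) M H W v).Nodup := hH.filter _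
  simp [active, List.toFinset_card_of_nodup hn]

end
end SCCDeletion

namespace SCCDeletion
open RecProg Relation

/-! ### Monotonicity of minimum cuts -/

section
variable {n : ℕ} {M : List (List Bool)} {H A T A' T' : List ℕ}

theorem lam_le_card (hH : H.Nodup) (hHn : ∀ v ∈ H, v < n) (hA : ∀ a ∈ A, a ∈ H) {R : Finset ℕ}
    (hAR : A.toFinset ⊆ R) (hRH : R ⊆ H.toFinset) (hRT : Disjoint R T.toFinset) :
    lam (List.range n) M H A T ≤ (bd (rel M) H.toFinset R).card := by
  refine (lam_le_iff hH hHn hA ?_).2 ⟨R, hAR, hRH, hRT, le_rfl⟩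
  have : bd (rel M) H.toFinset R ⊆ Finset.range n := fun v hv =>
    Finset.mem_range.2 (hHn v (List.mem_toFinset.1 (mem_bd.1 hv).1))
  simpa using Finset.card_le_card this

theorem min_lam_mono (hH : H.Nodup) (hHn : ∀ v ∈ H, v < n) {c : ℕ} (hc : c ≤ n)
    (hA : ∀ a ∈ A, a ∈ A') (hA' : ∀ a ∈ A', a ∈ H) (hT : ∀ t ∈ T, t ∈ T') :
    min (c + 1) (lam (List.range n) M H A T) ≤ min (c + 1) (lam (List.range n) M H A' T') := by
  by_cases h : lam (List.range n) M H A' T' ≤ c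
  · obtain ⟨R, h₁, h₂, h₃, h₄⟩ := (lam_le_iff hH hHn hA' (h.trans hc)).1 le_rfl
    have := (lam_le_iff (M := M) (A := A) (T := T) hH hHn (fun a ha => hA' a (hA a ha))
      (h.trans hc)).2 ⟨R, fun a ha => h₁ (List.mem_toFinset.2 (hA a (List.mem_toFinset.1 ha))), h₂,
        h₃.mono_right fun t ht => List.mem_toFinset.2 (hT t (List.mem_toFinset.1 ht)), h₄⟩
    omega
  · omega

/-- If no single element of `S` raises the minimum cut as an additional vertex to be avoided, then
neither do all of them together: a smallest minimum cut avoids them all. -/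
theorem lam_uni_le (hH : H.Nodup) (hHn : ∀ v ∈ H, v < n) (hA : ∀ a ∈ A, a ∈ H) {S : List ℕ}
    (hS : ∀ s ∈ S, s ∈ H) (hlam : lam (List.range n) M H A T ≤ n)
    (h : ∀ s ∈ S, lam (List.range n) M H A (uni (List.range n) T [s]) ≤
      lam (List.range n) M H A T) :
    lam (List.range n) M H A (uni (List.range n) T S) ≤ lam (List.range n) M H A T := by
  classical
  set l := lam (List.range n) M H A T with hl
  let F : Finset (Finset ℕ) := H.toFinset.powerset.filter fun R =>
    A.toFinset ⊆ R ∧ Disjoint R T.toFinset ∧ (bd (rel M) H.toFinset R).card ≤ l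
  have hF : F.Nonempty := by
    obtain ⟨R, h₁, h₂, h₃, h₄⟩ := (lam_le_iff hH hHn hA hlam).1 le_rfl
    exact ⟨R, Finset.mem_filter.2 ⟨Finset.mem_powerset.2 h₂, h₁, h₃, h₄⟩⟩
  obtain ⟨R₀, hR₀, hmin⟩ := F.exists_min_image Finset.card hF
  simp only [F, Finset.mem_filter, Finset.mem_powerset] at hR₀ hmin
  obtain ⟨hR₀H, hAR₀, hR₀T, hR₀c⟩ := hR₀
  refine (lam_le_iff hH hHn hA hlam).2 ⟨R₀, hAR₀, hR₀H, ?_, hR₀c⟩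
  rw [Finset.disjoint_left]
  intro x hx hx'
  rcases (mem_uni.1 (List.mem_toFinset.1 hx')).2 with hxT | hxS
  · exact Finset.disjoint_left.1 hR₀T hx (List.mem_toFinset.2 hxT)
  obtain ⟨R, h₁, h₂, h₃, h₄⟩ := (lam_le_iff hH hHn hA hlam).1 (h x hxS)
  have hxR : x ∉ R := fun hxR => Finset.disjoint_left.1 h₃ hxR
    (List.mem_toFinset.2 (mem_uni.2 ⟨hHn x (hS x hxS), Or.inr (by simp)⟩))
  have h₅ := card_bd_union_add_card_bd_inter_le (E := rel M) (H := H.toFinset) (R := R) (S := R₀)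
  have hRT : Disjoint (R ∪ R₀) T.toFinset := by
    refine Finset.disjoint_union_left.2 ⟨Finset.disjoint_left.2 fun y hy hyT => ?_, hR₀T⟩
    have hyn := hHn y (List.mem_toFinset.1 (h₂ hy))
    exact Finset.disjoint_left.1 h₃ hy
      (List.mem_toFinset.2 (mem_uni.2 ⟨hyn, Or.inl (List.mem_toFinset.1 hyT)⟩))
  have h₆ := lam_le_card (M := M) (T := T) hH hHn hA (h₁.trans Finset.subset_union_left)
    (Finset.union_subset h₂ hR₀H) hRT
  have h₇ := hmin (R ∩ R₀) ⟨Finset.inter_subset_left.trans h₂, Finset.subset_inter h₁ hAR₀,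
    hRT.mono_left (Finset.inter_subset_left.trans Finset.subset_union_left), by omega⟩
  have h₈ := Finset.eq_of_subset_of_card_le (Finset.inter_subset_right (s₁ := R) (s₂ := R₀)) h₇
  rw [← h₈] at hx
  exact hxR (Finset.mem_inter.1 hx).1

end

/-! ### Completeness of the search -/

/-- The unconditional facts about a state: `H` and `Y` are disjoint sets of vertices, `W` is a small
set of terminals in `H` without which the strong components are bounded, and a set with bounded
strong components inside `H` stays one when all finished vertices are added. -/
structure Base (n : ℕ) (M : List (List Bool)) (k d : ℕ) (H Y W : List ℕ) : Prop where
  nodup : H.Nodup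
  lt : ∀ v ∈ H, v < n
  nodup_deleted : Y.Nodup
  lt_deleted : ∀ v ∈ Y, v < n
  disjoint : ∀ v ∈ H, v ∉ Y
  terminals : ∀ w ∈ W, w ∈ H
  length_le : W.length ≤ k + 1
  good : Good (rel M) d (H.toFinset \ W.toFinset)
  extend : ∀ G ⊆ H.toFinset, Good (rel M) d G →
    Good (rel M) d (((Finset.range n \ Y.toFinset) \ H.toFinset) ∪ G)

/-- `X` is a solution in the live part that agrees with the guesses recorded in the state. In the
presence of `A` there is a terminal `r`, in a last strong component after the deletion of `X`, that
reaches all of `A` and nothing in `T`. -/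
structure Sol (M : List (List Bool)) (k d : ℕ) (H Y W A T U : List ℕ) (X : Finset ℕ) : Prop where
  subset : X ⊆ H.toFinset
  card_le : X.card + Y.length ≤ k
  good : Good (rel M) d (H.toFinset \ X)
  cut : U ≠ [] → (∀ u ∈ U, u ∈ H.toFinset \ X) ∧
    ∀ u ∈ U, ∀ w ∈ W, ¬ Rch (rel M) (H.toFinset \ X) u w
  root : U = [] → A ≠ [] → ∃ r ∈ W, r ∈ A ∧ r ∈ H.toFinset \ X ∧
    (∀ w ∈ W, Rch (rel M) (H.toFinset \ X) r w → Rch (rel M) (H.toFinset \ X) w r) ∧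
    (∀ a ∈ A, Rch (rel M) (H.toFinset \ X) r a) ∧
    ∀ t ∈ T, ¬ Rch (rel M) (H.toFinset \ X) r t

/-- The invariant of the states on a successful path of the search tree. -/
structure Inv (n : ℕ) (M : List (List Bool)) (k d : ℕ) (H Y W Wu A T U : List ℕ) : Prop where
  base : Base n M k d H Y W
  cover : ∀ w ∈ W, w ∈ Wu ∨ w ∈ A ∨ w ∈ T
  length_le : Wu.length ≤ k + 1
  unassigned : ∀ w ∈ Wu, w ∈ W
  fresh : A = [] → T = []
  returns : U ≠ [] → ∃ u ∈ U, ∃ w ∈ W, Rch (rel M) H.toFinset u w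
  sol : ∃ X, Sol M k d H Y W A T U X

/-- The part of the potential that does not change within a stage. The factor exceeds the largest
value of `phasePot`, so a new stage may start with any phase. -/
def stagePot (k : ℕ) (Y W : List ℕ) : ℕ := (4 * k + 9) * ((k - Y.length) + W.length)

/-- The part of the potential that measures the progress within a stage. The phases are ordered: the
choice of a terminal comes before the assignment of the terminals, this before the growth of the
two minimum cuts, and a cut around `U` ends the stage. The cuts are truncated at `k + 1`, since larger
ones are discarded. -/
def phasePot (n : ℕ) (M : List (List Bool)) (k d : ℕ) (H W Wu A T U : List ℕ) : ℕ :=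
  if U ≠ [] then k + 1 - min (k + 1) (lam (List.range n) M H U W)
  else if A = [] then 4 * k + 8
  else if Wu ≠ [] then Wu.length + (3 * k + 6)
  else (2 * (k + 1) - min (k + 1) (lam (List.range n) M H A T) -
    min (k + 1) (lam (List.range n) M H A
      (uni (List.range n) T (active (List.range n) M d H W)))) + (k + 3)

/-- The invariant `Inv` of a state, given as one object. -/
def InvSt (n : ℕ) (M : List (List Bool)) (k d : ℕ) : St → Prop
  | (H, Y, W, Wu, A, T, U) => Inv n M k d H Y W Wu A T U

/-- The potential of a state, a bound for the remaining depth of the search. -/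
def pot (n : ℕ) (M : List (List Bool)) (k d : ℕ) : St → ℕ
  | (H, Y, W, Wu, A, T, U) => stagePot k Y W + phasePot n M k d H W Wu A T U

section
variable {n : ℕ} {M : List (List Bool)} {k d : ℕ} {H Y W Wu A T U : List ℕ} {X : Finset ℕ}

theorem toFinset_diff (H S : List ℕ) : (diff H S).toFinset = H.toFinset \ S.toFinset := by
  ext v; simp [diff]

theorem length_uni (h : Base n M k d H Y W) {S : List ℕ} (hS : ∀ s ∈ S, s ∈ H) (hSn : S.Nodup) :
    (uni (List.range n) Y S).length = Y.length + S.length := by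
  have h₁ : (uni (List.range n) Y S).Nodup := List.nodup_range.filter _
  rw [← List.toFinset_card_of_nodup h₁, toFinset_uni h.lt_deleted fun s hs => h.lt s (hS s hs),
    Finset.card_union_of_disjoint, List.toFinset_card_of_nodup h.nodup_deleted,
    List.toFinset_card_of_nodup hSn]
  rw [Finset.disjoint_left]
  intro x hx hx'
  exact h.disjoint x (hS x (List.mem_toFinset.1 hx')) (List.mem_toFinset.1 hx)

/-- The deletion of `S` and the removal of `R` start a new stage. -/
theorem inv_advance (h : Base n M k d H Y W) {S R : List ℕ} (hS : ∀ s ∈ S, s ∈ H) (hSn : S.Nodup)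
    (hRH : ∀ v ∈ R, v ∈ H) (hRS : ∀ v ∈ R, v ∉ S)
    (hR : ∀ G ⊆ (H.toFinset \ S.toFinset) \ R.toFinset, Good (rel M) d G →
      Good (rel M) d (R.toFinset ∪ G))
    (hX : ∃ X ⊆ (H.toFinset \ S.toFinset) \ R.toFinset, X.card + S.length + Y.length ≤ k ∧
      Good (rel M) d (((H.toFinset \ S.toFinset) \ R.toFinset) \ X))
    (hprog : S ≠ [] ∨ ∃ w ∈ W, w ∈ R) :
    InvSt n M k d (advance (List.range n) H Y W S R) ∧
      pot n M k d (advance (List.range n) H Y W S R) < stagePot k Y W := by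
  have hlen := length_uni h hS hSn
  have hfin : (diff (diff H S) R).toFinset = (H.toFinset \ S.toFinset) \ R.toFinset := by
    rw [toFinset_diff, toFinset_diff]
  have hWle : (diff (diff W S) R).length ≤ W.length :=
    (List.length_filter_le _ _).trans (List.length_filter_le _ _)
  obtain ⟨X, hXsub, hXcard, hXgood⟩ := hX
  have hbase : Base n M k d (diff (diff H S) R) (uni (List.range n) Y S) (diff (diff W S) R) := by
    refine ⟨(h.nodup.filter _).filter _, fun v hv => h.lt v (mem_diff.1 (mem_diff.1 hv).1).1,
      List.nodup_range.filter _, fun v hv => (mem_uni.1 hv).1, fun v hv hv' => ?_, fun w hw => ?_,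
      hWle.trans h.length_le, ?_, fun G hG hGg => ?_⟩
    · have h₁ := mem_diff.1 (mem_diff.1 hv).1
      exact (mem_uni.1 hv').2.elim (h.disjoint v h₁.1) h₁.2
    · have h₁ := mem_diff.1 hw
      have h₂ := mem_diff.1 h₁.1
      exact mem_diff.2 ⟨mem_diff.2 ⟨h.terminals w h₂.1, h₂.2⟩, h₁.2⟩
    · refine h.good.mono fun v hv => ?_
      simp only [Finset.mem_sdiff, List.mem_toFinset, mem_diff] at hv ⊢
      tauto
    · rw [hfin] at hG
      refine (h.extend _ (Finset.union_subset ?_ ?_) (hR G hG hGg)).mono fun v hv => ?_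
      · exact fun v hv => List.mem_toFinset.2 (hRH v (List.mem_toFinset.1 hv))
      · exact hG.trans (Finset.sdiff_subset.trans Finset.sdiff_subset)
      · have := hRS v
        simp only [Finset.mem_union, Finset.mem_sdiff, List.mem_toFinset, mem_diff,
          Finset.mem_range, mem_uni] at hv ⊢
        tauto
  refine ⟨⟨hbase, fun w hw => Or.inl hw, hbase.length_le, fun w hw => hw, fun _ => rfl,
    fun h => absurd rfl h, X, ⟨by rw [hfin]; exact hXsub, by rw [hlen]; omega,
      by rw [hfin]; exact hXgood, fun h => absurd rfl h, fun _ h => absurd rfl h⟩⟩, ?_⟩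
  have hdec : k - (uni (List.range n) Y S).length + (diff (diff W S) R).length + 1 ≤
      k - Y.length + W.length := by
    rcases hprog with hne | ⟨w, hw, hwR⟩
    · have := List.length_pos_of_ne_nil hne
      omega
    · have : (diff (diff W S) R).length < (diff W S).length := by
        by_cases hwS : w ∈ S
        · exact absurd hwS (hRS w hwR)
        · refine lt_of_le_of_ne (List.length_filter_le _ _) fun he => ?_
          have := List.length_filter_eq_length_iff.1 he w (mem_diff.2 ⟨hw, hwS⟩)
          simp [hwR] at this
      have h₂ : (diff W S).length ≤ W.length := List.length_filter_le _ _
      omega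
  have := Nat.mul_le_mul_left (4 * k + 9) hdec
  simp only [pot, advance, stagePot, phasePot]
  simp only [ne_eq, not_true_eq_false, if_false, if_true]
  rw [Nat.mul_add, Nat.mul_one] at this
  omega

/-- The branch in which a vertex of the solution is deleted. -/
theorem inv_delete (h : Base n M k d H Y W) (hX : Sol M k d H Y W A T U X) {s : ℕ} (hs : s ∈ X) :
    InvSt n M k d (advance (List.range n) H Y W [s] []) ∧
      pot n M k d (advance (List.range n) H Y W [s] []) < stagePot k Y W := by
  have hsH := List.mem_toFinset.1 (hX.subset hs)
  refine inv_advance h (by simpa using hsH) (by simp) (by simp) (by simp)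
    (fun G _ hG => by simpa using hG) ⟨X.erase s, ?_, ?_, ?_⟩ (Or.inl (by simp))
  · intro x hx
    have := Finset.mem_erase.1 hx
    simp [this.1, List.mem_toFinset.1 (hX.subset this.2)]
  · have := Finset.card_erase_add_one hs
    have := hX.card_le
    simp only [List.length_singleton]
    omega
  · refine hX.good.mono fun v hv => ?_
    simp only [Finset.mem_sdiff, List.mem_toFinset, List.mem_singleton, Finset.mem_erase] at hv ⊢
    tauto

/-- A solution bounds the minimum cuts that it respects. -/
theorem lam_le_of_sol (h : Base n M k d H Y W) (hX : Sol M k d H Y W A T U X) {B C : List ℕ}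
    {P : Finset ℕ} (hB : ∀ b ∈ B, b ∈ reachSet (rel M) H.toFinset X P)
    (hC : ∀ c ∈ C, c ∉ reachSet (rel M) H.toFinset X P) :
    lam (List.range n) M H B C ≤ (bd (rel M) H.toFinset (reachSet (rel M) H.toFinset X P)).card ∧
      (bd (rel M) H.toFinset (reachSet (rel M) H.toFinset X P)).card ≤ k := by
  refine ⟨lam_le_card h.nodup h.lt
    (fun b hb => List.mem_toFinset.1 (reachSet_subset (hB b hb)))
    (fun b hb => hB b (List.mem_toFinset.1 hb)) reachSet_subset ?_, ?_⟩
  · rw [Finset.disjoint_left]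
    exact fun x hx hx' => hC x (List.mem_toFinset.1 hx') hx
  · have := Finset.card_le_card (bd_reachSet_subset (E := rel M) (H := H.toFinset) (X := X)
      (U := P))
    have := hX.card_le
    omega

end
end SCCDeletion

namespace SCCDeletion
open RecProg Relation

/-! ### The branching rules -/

section
variable {n : ℕ} {M : List (List Bool)} {k d : ℕ} {H Y W Wu A T U : List ℕ} {X : Finset ℕ}

theorem bdry_nodup (hH : H.Nodup) (R : List ℕ) : (bdry M H R).Nodup := hH.filter _

theorem bdry_subset (R : List ℕ) : ∀ s ∈ bdry M H R, s ∈ H := fun _ hs => List.mem_of_mem_filter hs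

theorem bdry_length (hH : H.Nodup) (R : List ℕ) :
    (bdry M H R).length = (bd (rel M) H.toFinset R.toFinset).card := by
  rw [← toFinset_bdry, List.toFinset_card_of_nodup (bdry_nodup hH R)]

theorem rmax_subset : ∀ v ∈ rmax (List.range n) M H A T, v ∈ H := fun _ hv =>
  List.mem_of_mem_filter hv

theorem Inv.length_deleted_le (h : Inv n M k d H Y W Wu A T U) : Y.length ≤ k := by
  obtain ⟨X, hX⟩ := h.sol
  have := hX.card_le
  omega

/-- The branches on the largest minimum cut between `U` and the terminals: by the pushing lemma it may
be taken, unless one of its vertices is deleted or reachable from `U`; in the last case the vertex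
joins `U`, and the minimum cut grows. -/
theorem step_cut (hk : k ≤ n) (h : Inv n M k d H Y W Wu A T U) (hU : U ≠ []) :
    ∃ st ∈ cutBranches (List.range n) M k H Y W Wu A T U, InvSt n M k d st ∧
      pot n M k d st < pot n M k d (H, Y, W, Wu, A, T, U) := by
  have hb := h.base
  obtain ⟨X, hX⟩ := h.sol
  obtain ⟨hUX, hUW⟩ := hX.cut hU
  have hUH : ∀ u ∈ U, u ∈ H := fun u hu =>
    List.mem_toFinset.1 (Finset.mem_sdiff.1 (hUX u hu)).1
  have hUn : ∀ u ∈ U, u < n := fun u hu => hb.lt u (hUH u hu)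
  have hlam : lam (List.range n) M H U W ≤ k := by
    have := lam_le_of_sol hb hX (B := U) (C := W) (P := U.toFinset)
      (fun u hu => mem_reachSet.2 ⟨hUX u hu, u, List.mem_toFinset.2 hu, .refl⟩)
      (fun w hw hw' => by
        obtain ⟨-, u, hu, huw⟩ := mem_reachSet.1 hw'
        exact hUW u (List.mem_toFinset.1 hu) w hw huw)
    exact this.1.trans this.2
  obtain ⟨hUR, hRW, hcard, hnext⟩ := rmax_spec (M := M) (T := W) hb.nodup hb.lt hUH (hlam.trans hk)
  set R := rmax (List.range n) M H U W with hR
  set S := bdry M H R with hS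
  have hSlen : S.length = lam (List.range n) M H U W := by
    rw [hS, bdry_length hb.nodup, hcard]
  have hSfin : S.toFinset = bd (rel M) H.toFinset R.toFinset := toFinset_bdry M H R
  have hbr : cutBranches (List.range n) M k H Y W Wu A T U =
      advance (List.range n) H Y W S [] ::
      mapOnto (fun s => advance (List.range n) H Y W [s] []) S
        (mapOnto (fun s => ((H, Y, W, Wu, A, T, uni (List.range n) U [s]) : St)) S []) := by
    have h₁ : leb (k + 1) (lam (List.range n) M H U W) = false := by
      rw [← Bool.not_eq_true, leb_iff]; omega
    have h₂ : leb (k + 1) S.length = false := by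
      rw [← Bool.not_eq_true, leb_iff]; omega
    simp only [cutBranches, ← hR, ← hS, h₁, h₂, Bool.or_self, cond_false]
  have hpot : pot n M k d (H, Y, W, Wu, A, T, U) =
      stagePot k Y W + (k + 1 - min (k + 1) (lam (List.range n) M H U W)) := by
    simp [pot, phasePot, hU]
  rw [hbr, hpot]
  by_cases h₁ : ∃ s ∈ S, s ∈ X
  · obtain ⟨s, hs, hsX⟩ := h₁
    obtain ⟨h₂, h₃⟩ := inv_delete hb hX hsX
    exact ⟨_, List.mem_cons_of_mem _ (mem_mapOnto.2 (Or.inl ⟨s, hs, rfl⟩)), h₂, by omega⟩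
  by_cases h₂ : ∃ s ∈ S, ∃ u ∈ U, Rch (rel M) (H.toFinset \ X) u s
  · obtain ⟨s, hs, u, hu, hus⟩ := h₂
    have hsX : s ∈ H.toFinset \ X := hus.mem (hUX u hu)
    have hsH : s ∈ H := bdry_subset R s hs
    have hsR : s ∉ R := fun hsR => by
      rw [← List.mem_toFinset, hSfin, mem_bd] at hs
      exact hs.2.1 (List.mem_toFinset.2 hsR)
    have hmem : ∀ v ∈ uni (List.range n) U [s], v ∈ U ∨ v = s := fun v hv => by
      simpa using (mem_uni.1 hv).2
    have hne : uni (List.range n) U [s] ≠ [] :=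
      List.ne_nil_of_mem (mem_uni.2 ⟨hb.lt s hsH, Or.inr (by simp)⟩)
    refine ⟨(H, Y, W, Wu, A, T, uni (List.range n) U [s]), List.mem_cons_of_mem _
      (mem_mapOnto.2 (Or.inr (mem_mapOnto.2 (Or.inl ⟨s, hs, rfl⟩)))), ?_, ?_⟩
    · refine ⟨hb, h.cover, h.length_le, h.unassigned, h.fresh, fun _ => ?_, X, hX.subset,
        hX.card_le, hX.good, fun _ => ⟨fun v hv => ?_, fun v hv w hw hvw => ?_⟩,
        fun h => absurd h hne⟩
      · obtain ⟨u', hu', w, hw, huw⟩ := h.returns hU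
        exact ⟨u', mem_uni.2 ⟨hUn u' hu', Or.inl hu'⟩, w, hw, huw⟩
      · rcases hmem v hv with hv | rfl
        · exact hUX v hv
        · exact hsX
      · rcases hmem v hv with hv | rfl
        · exact hUW v hv w hw hvw
        · exact hUW u hu w hw (hus.trans hvw)
    · have := hnext s hsH hsR
      simp only [pot, phasePot, hne, ne_eq, not_false_eq_true, if_true]
      omega
  · push Not at h₁ h₂
    have hSne : S ≠ [] := by
      intro hS0
      obtain ⟨u, hu, w, hw, huw⟩ := h.returns hU
      have hcl := bd_closed (E := rel M) (H := H.toFinset) (R := R.toFinset)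
      rw [← hSfin, hS0, List.toFinset_nil, Finset.sdiff_empty] at hcl
      exact Finset.disjoint_left.1 hRW (huw.inside hcl (hUR (List.mem_toFinset.2 hu))).1
        (List.mem_toFinset.2 hw)
    obtain ⟨X', hX'sub, hX'card, hX'good⟩ := exists_solution_of_push (R := R.toFinset) hX.subset
      hX.good hb.good (U := U.toFinset) (fun u hu => hUX u (List.mem_toFinset.1 hu))
      (fun u hu w hw => hUW u (List.mem_toFinset.1 hu) w (List.mem_toFinset.1 hw)) hUR hRW
      (fun R' h₁ h₂ h₃ => by
        rw [hcard]; exact lam_le_card hb.nodup hb.lt hUH h₁ h₂ h₃)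
      (fun s hs => h₁ s (List.mem_toFinset.1 (hSfin ▸ hs)))
      (fun s hs u hu => h₂ s (List.mem_toFinset.1 (hSfin ▸ hs)) u (List.mem_toFinset.1 hu))
    rw [← hSfin] at hX'sub hX'card hX'good
    rw [List.toFinset_card_of_nodup (bdry_nodup hb.nodup R), ← hS] at hX'card
    obtain ⟨h₃, h₄⟩ := inv_advance hb (S := S) (R := []) (bdry_subset R)
      (bdry_nodup hb.nodup R) (by simp) (by simp) (fun G _ hG => by simpa using hG)
      ⟨X', by simpa using hX'sub, by have := hX.card_le; omega, by simpa using hX'good⟩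
      (Or.inl hSne)
    exact ⟨_, List.mem_cons_self, h₃, by omega⟩

/-- The first branches of a stage: among the strong components of the terminals that survive, some
last one contains the terminal to be chosen; if no terminal survives, any of them may be deleted. -/
theorem step_fresh (h : Inv n M k d H Y W Wu [] T []) (hW : W ≠ []) :
    ∃ st ∈ mapOnto (fun w => advance (List.range n) H Y W [w] []) W
      (mapOnto (fun w => ((H, Y, W, Wu, [w], T, []) : St)) W []), InvSt n M k d st ∧
      pot n M k d st < pot n M k d (H, Y, W, Wu, [], T, []) := by
  have hb := h.base
  obtain ⟨X, hX⟩ := h.sol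
  have hpot : pot n M k d (H, Y, W, Wu, [], T, []) = stagePot k Y W + (4 * k + 8) := by
    simp [pot, phasePot]
  rw [hpot]
  by_cases hne : (W.toFinset ∩ (H.toFinset \ X)).Nonempty
  · obtain ⟨r, hr, hsink⟩ := exists_sink (rel M) (H.toFinset \ X) hne
    obtain ⟨hrW, hrX⟩ := Finset.mem_inter.1 hr
    have hT := h.fresh rfl
    subst hT
    refine ⟨(H, Y, W, Wu, [r], [], []), mem_mapOnto.2 (Or.inr (mem_mapOnto.2
      (Or.inl ⟨r, List.mem_toFinset.1 hrW, rfl⟩))), ?_, ?_⟩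
    · refine ⟨hb, fun w hw => ?_, h.length_le, h.unassigned, fun h => absurd h (by simp),
        fun h => absurd rfl h, X, hX.subset, hX.card_le, hX.good, fun h => absurd rfl h,
        fun _ _ => ⟨r, List.mem_toFinset.1 hrW, by simp, hrX,
          fun w hw => hsink w (List.mem_toFinset.2 hw), fun a ha => ?_, by simp⟩⟩
      · exact (h.cover w hw).elim Or.inl fun h => h.elim (by simp) (by simp)
      · rw [List.mem_singleton.1 ha]; exact ReflTransGen.refl
    · have := h.length_le
      simp only [pot, phasePot, ne_eq, not_true_eq_false, if_false, reduceCtorEq]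
      split_ifs <;> omega
  · obtain ⟨w, ws, hw⟩ := List.exists_cons_of_ne_nil hW
    have hwW : w ∈ W := by simp [hw]
    have hwX : w ∈ X := by
      by_contra hwX
      exact hne ⟨w, Finset.mem_inter.2 ⟨List.mem_toFinset.2 hwW,
        Finset.mem_sdiff.2 ⟨List.mem_toFinset.2 (hb.terminals w hwW), hwX⟩⟩⟩
    obtain ⟨h₂, h₃⟩ := inv_delete hb hX hwX
    exact ⟨_, mem_mapOnto.2 (Or.inl ⟨w, hwW, rfl⟩), h₂, by omega⟩

theorem pot_lt_of_assign (hA : A ≠ []) {A' T' : List ℕ} (hA' : A' ≠ []) (hWu : Wu ≠ []) :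
    pot n M k d (H, Y, W, Wu.tail, A', T', []) < pot n M k d (H, Y, W, Wu, A, T, []) := by
  have : Wu.tail.length + 1 = Wu.length := by
    have := List.length_pos_of_ne_nil hWu
    simp; omega
  simp only [pot, phasePot, ne_eq, not_true_eq_false, if_false, hA, hA', hWu,
    not_false_eq_true, if_true]
  split_ifs <;> omega

/-- The branches on whether the next terminal is reachable from the chosen one. -/
theorem step_assign (h : Inv n M k d H Y W Wu A T []) (hA : A ≠ []) (hWu : Wu ≠ []) :
    ∃ st ∈ ([(H, Y, W, Wu.tail, uni (List.range n) A [Wu.headD 0], T, []),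
      (H, Y, W, Wu.tail, A, uni (List.range n) T [Wu.headD 0], [])] : List St),
      InvSt n M k d st ∧ pot n M k d st < pot n M k d (H, Y, W, Wu, A, T, []) := by
  have hb := h.base
  obtain ⟨X, hX⟩ := h.sol
  obtain ⟨r, hrW, hrA, hrX, hsink, hrch, hnot⟩ := hX.root rfl hA
  obtain ⟨w, ws, rfl⟩ := List.exists_cons_of_ne_nil hWu
  have hw := h.unassigned w (by simp)
  have hwn := hb.lt w (hb.terminals w hw)
  have hlen := h.length_le
  have hTn : ∀ v ∈ W, v < n := fun v hv => hb.lt v (hb.terminals v hv)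
  simp only [List.length_cons] at hlen
  simp only [List.headD_cons, List.tail_cons]
  by_cases hc : Rch (rel M) (H.toFinset \ X) r w
  · have hA' : uni (List.range n) A [w] ≠ [] :=
      List.ne_nil_of_mem (mem_uni.2 ⟨hwn, Or.inr (by simp)⟩)
    refine ⟨_, List.mem_cons_self, ⟨hb, fun v hv => ?_, by omega,
      fun v hv => h.unassigned v (by simp [hv]), fun h => absurd h hA', fun h => absurd rfl h, X,
      hX.subset, hX.card_le, hX.good, fun h => absurd rfl h, fun _ _ => ⟨r, hrW, ?_, hrX, hsink,
        fun a ha => ?_, hnot⟩⟩, pot_lt_of_assign hA hA' hWu⟩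
    · have := h.cover v hv
      simp only [List.mem_cons, mem_uni, List.not_mem_nil, or_false] at this ⊢
      have := hTn v hv
      tauto
    · exact mem_uni.2 ⟨hTn r hrW, Or.inl hrA⟩
    · rcases (mem_uni.1 ha).2 with ha | ha
      · exact hrch a ha
      · rwa [List.mem_singleton.1 ha]
  · refine ⟨_, List.mem_cons_of_mem _ List.mem_cons_self, ⟨hb, fun v hv => ?_, by omega,
      fun v hv => h.unassigned v (by simp [hv]), fun h => absurd h hA, fun h => absurd rfl h, X,
      hX.subset, hX.card_le, hX.good, fun h => absurd rfl h, fun _ _ => ⟨r, hrW, hrA, hrX, hsink,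
        hrch, fun t ht => ?_⟩⟩, pot_lt_of_assign hA hA hWu⟩
    · have := h.cover v hv
      simp only [List.mem_cons, mem_uni, List.not_mem_nil, or_false] at this ⊢
      have := hTn v hv
      tauto
    · rcases (mem_uni.1 ht).2 with ht | ht
      · exact hnot t ht
      · rwa [List.mem_singleton.1 ht]

/-- The branches on a forced vertex `v` that is active: either it is deleted, or it is not reachable
from the chosen terminal, or one of its first `d + 1` returning out-neighbours is deleted or cut off
from the terminals. -/
theorem step_vertex (hk : k ≤ n) (h : Inv n M k d H Y W [] A T []) (hA : A ≠ [])
    (hlam : lam (List.range n) M H A T ≤ k) {v : ℕ} (hv : v ∈ forced (List.range n) M d H W A T) :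
    ∃ st ∈ vertexBranches (List.range n) H Y W [] A T []
      (pick (d + 1) (returning (List.range n) M H W v)) v, InvSt n M k d st ∧
      pot n M k d st < pot n M k d (H, Y, W, [], A, T, []) := by
  classical
  have hb := h.base
  obtain ⟨X, hX⟩ := h.sol
  obtain ⟨r, hrW, hrA, hrX, hsink, hrch, hnot⟩ := hX.root rfl hA
  have hAH : ∀ a ∈ A, a ∈ H := fun a ha =>
    List.mem_toFinset.1 (Finset.mem_sdiff.1 ((hrch a ha).mem hrX)).1
  obtain ⟨hvact, hvlam⟩ : v ∈ active (List.range n) M d H W ∧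
      lam (List.range n) M H A T + 1 ≤ lam (List.range n) M H A (uni (List.range n) T [v]) := by
    simpa [forced] using hv
  obtain ⟨hvH, hvcard⟩ := (mem_active hb.nodup).1 hvact
  have hpot : pot n M k d (H, Y, W, [], A, T, []) = stagePot k Y W +
      ((2 * (k + 1) - min (k + 1) (lam (List.range n) M H A T) -
    min (k + 1) (lam (List.range n) M H A
      (uni (List.range n) T (active (List.range n) M d H W)))) + (k + 3)) := by
    simp [pot, phasePot, hA]
  unfold vertexBranches
  by_cases hvX : v ∈ X
  · obtain ⟨h₂, h₃⟩ := inv_delete hb hX hvX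
    exact ⟨_, List.mem_cons_self, h₂, by omega⟩
  by_cases hrv : Rch (rel M) (H.toFinset \ X) r v
  swap
  · refine ⟨_, List.mem_cons_of_mem _ List.mem_cons_self, ⟨hb, fun w hw => ?_, h.length_le,
      h.unassigned, fun h => absurd h hA, fun h => absurd rfl h, X, hX.subset, hX.card_le, hX.good,
      fun h => absurd rfl h, fun _ _ => ⟨r, hrW, hrA, hrX, hsink, hrch, fun t ht => ?_⟩⟩, ?_⟩
    · rcases h.cover w hw with h | h | h
      · exact Or.inl h
      · exact Or.inr (Or.inl h)
      · exact Or.inr (Or.inr (mem_uni.2 ⟨hb.lt w (hb.terminals w hw), Or.inl h⟩))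
    · rcases (mem_uni.1 ht).2 with ht | ht
      · exact hnot t ht
      · rwa [List.mem_singleton.1 ht]
    · have hmono := min_lam_mono (M := M) (A := A) (A' := A)
        (T := uni (List.range n) T (active (List.range n) M d H W))
        (T' := uni (List.range n) (uni (List.range n) T [v]) (active (List.range n) M d H W))
        hb.nodup hb.lt hk (fun a ha => ha) hAH (fun t ht => by
          simp only [mem_uni] at ht ⊢; tauto)
      rw [hpot]
      simp only [pot, phasePot, ne_eq, not_true_eq_false, if_false, hA]
      omega
  · set Z := pick (d + 1) (returning (List.range n) M H W v) with hZ
    have hZmem : ∀ z ∈ Z, z ∈ H ∧ adj M v z = true ∧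
        ∃ w ∈ W, Rch (rel M) H.toFinset z w := fun z hz => by
      have hz : z ∈ returning (List.range n) M H W v := by
        rw [hZ, pick_eq] at hz
        exact List.mem_of_mem_take (List.mem_reverse.1 hz)
      have := List.mem_toFinset.2 hz
      rw [toFinset_returning hb.nodup hb.lt] at this
      simpa using this
    have hret : (returning (List.range n) M H W v).Nodup := hb.nodup.filter _
    have hZcard : Z.toFinset.card = d + 1 := by
      rw [List.toFinset_card_of_nodup hret] at hvcard
      rw [hZ, pick_eq, List.toFinset_reverse, List.toFinset_card_of_nodup
        (hret.sublist (List.take_sublist _ _)), List.length_take]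
      omega
    -- Otherwise all of `Z` lies in the strong component of `v`: from `v` to `z`, to a terminal `w`,
    -- back to `r` by the choice of `r`, and to `v`.
    obtain ⟨z, hz, hzbad⟩ : ∃ z ∈ Z, z ∈ X ∨
        z ∉ X ∧ ∀ w ∈ W, ¬ Rch (rel M) (H.toFinset \ X) z w := by
      by_contra! hcon
      have hvHX := hrv.mem hrX
      have hsub : Z.toFinset ⊆ (H.toFinset \ X).filter fun u =>
          rel M v u ∧ Rch (rel M) (H.toFinset \ X) u v := by
        intro z hz
        have hz := List.mem_toFinset.1 hz
        obtain ⟨hzH, hvz, -⟩ := hZmem z hz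
        obtain ⟨hzX, hzw⟩ := hcon z hz
        obtain ⟨w, hw, hzw⟩ := hzw hzX
        have hzHX : z ∈ H.toFinset \ X := Finset.mem_sdiff.2 ⟨List.mem_toFinset.2 hzH, hzX⟩
        have hrw : Rch (rel M) (H.toFinset \ X) r w := (hrv.tail ⟨hvz, hzHX⟩).trans hzw
        exact Finset.mem_filter.2 ⟨hzHX, hvz, (hzw.trans (hsink w hw hrw)).trans hrv⟩
      have hg := hX.good v hvHX
      have hle : Z.toFinset.card ≤ d := by
        refine le_trans (Finset.card_le_card hsub) ?_
        exact (le_of_eq (by congr)).trans hg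
      omega
    rcases hzbad with hzX | ⟨hzX, hzW⟩
    · obtain ⟨h₂, h₃⟩ := inv_delete hb hX hzX
      exact ⟨_, List.mem_cons_of_mem _ (List.mem_cons_of_mem _
        (mem_mapOnto.2 (Or.inl ⟨z, hz, rfl⟩))), h₂, by omega⟩
    · obtain ⟨hzH, hvz, hzret⟩ := hZmem z hz
      refine ⟨(H, Y, W, [], A, T, [z]), List.mem_cons_of_mem _ (List.mem_cons_of_mem _
        (mem_mapOnto.2 (Or.inr (mem_mapOnto.2 (Or.inl ⟨z, hz, rfl⟩))))), ?_, ?_⟩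
      · refine ⟨hb, h.cover, h.length_le, h.unassigned, h.fresh, fun _ => ⟨z, by simp, hzret⟩, X,
          hX.subset, hX.card_le, hX.good, fun _ => ⟨?_, ?_⟩, fun h => absurd h (by simp)⟩
        · intro u hu
          rw [List.mem_singleton.1 hu]
          exact Finset.mem_sdiff.2 ⟨List.mem_toFinset.2 hzH, hzX⟩
        · intro u hu
          rw [List.mem_singleton.1 hu]
          exact hzW
      · rw [hpot]
        simp only [pot, phasePot, ne_eq, reduceCtorEq, not_false_eq_true, if_true]
        omega

/-- The branches on the largest cut that avoids all active vertices: it is taken, or one of its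
vertices is deleted, or one of its vertices is reachable from the chosen terminal. -/
theorem step_finish (hk : k ≤ n) (h : Inv n M k d H Y W [] A T []) (hA : A ≠ [])
    (hlam : lam (List.range n) M H A T ≤ k) (hforced : forced (List.range n) M d H W A T = []) :
    ∃ st ∈ finishBranches (List.range n) k H Y W [] A T []
      (rmax (List.range n) M H A (uni (List.range n) T (active (List.range n) M d H W)))
      (bdry M H (rmax (List.range n) M H A
        (uni (List.range n) T (active (List.range n) M d H W)))), InvSt n M k d st ∧
      pot n M k d st < pot n M k d (H, Y, W, [], A, T, []) := by
  classical
  have hb := h.base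
  obtain ⟨X, hX⟩ := h.sol
  obtain ⟨r, hrW, hrA, hrX, hsink, hrch, hnot⟩ := hX.root rfl hA
  have hAX : ∀ a ∈ A, a ∈ H.toFinset \ X := fun a ha => (hrch a ha).mem hrX
  have hAH : ∀ a ∈ A, a ∈ H := fun a ha => List.mem_toFinset.1 (Finset.mem_sdiff.1 (hAX a ha)).1
  set T' := uni (List.range n) T (active (List.range n) M d H W) with hT'
  have hactH : ∀ v ∈ active (List.range n) M d H W, v ∈ H := fun v hv =>
    ((mem_active hb.nodup).1 hv).1
  have hlam' : lam (List.range n) M H A T' ≤ lam (List.range n) M H A T := by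
    refine lam_uni_le hb.nodup hb.lt hAH hactH (hlam.trans hk) fun s hs => ?_
    by_contra hlt
    have : s ∈ forced (List.range n) M d H W A T := by
      simp only [forced, List.mem_filter, leb_iff]
      exact ⟨hs, by omega⟩
    rw [hforced] at this
    simp at this
  have hpot : pot n M k d (H, Y, W, [], A, T, []) = stagePot k Y W +
      ((2 * (k + 1) - min (k + 1) (lam (List.range n) M H A T) -
        min (k + 1) (lam (List.range n) M H A T')) + (k + 3)) := by
    simp [pot, phasePot, hA, hT']
  obtain ⟨hAR, hRT, hcard, hnext⟩ := rmax_spec (M := M) (T := T') hb.nodup hb.lt hAH (by omega)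
  set R := rmax (List.range n) M H A T' with hR
  set S := bdry M H R with hS
  have hSlen : S.length = lam (List.range n) M H A T' := by
    rw [hS, bdry_length hb.nodup, hcard]
  have hSfin : S.toFinset = bd (rel M) H.toFinset R.toFinset := toFinset_bdry M H R
  have hSR : ∀ v ∈ S, v ∉ R := fun v hv hvR => by
    rw [← List.mem_toFinset, hSfin, mem_bd] at hv
    exact hv.2.1 (List.mem_toFinset.2 hvR)
  have h₀ : leb (k + 1) S.length = false := by
    rw [← Bool.not_eq_true, leb_iff]; omega
  rw [finishBranches, h₀, cond_false]
  by_cases h₁ : ∃ s ∈ S, s ∈ X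
  · obtain ⟨s, hs, hsX⟩ := h₁
    obtain ⟨h₂, h₃⟩ := inv_delete hb hX hsX
    exact ⟨_, List.mem_cons_of_mem _ (mem_mapOnto.2 (Or.inl ⟨s, hs, rfl⟩)), h₂, by omega⟩
  by_cases h₂ : ∃ s ∈ S, Rch (rel M) (H.toFinset \ X) r s
  · obtain ⟨s, hs, hrs⟩ := h₂
    have hsH : s ∈ H := bdry_subset R s hs
    have hmem : ∀ v ∈ uni (List.range n) A [s], v ∈ A ∨ v = s := fun v hv => by
      simpa using (mem_uni.1 hv).2
    have hsub : ∀ a ∈ A, a ∈ uni (List.range n) A [s] := fun a ha =>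
      mem_uni.2 ⟨hb.lt a (hAH a ha), Or.inl ha⟩
    have hne : uni (List.range n) A [s] ≠ [] := List.ne_nil_of_mem (hsub r hrA)
    have hrch' : ∀ a ∈ uni (List.range n) A [s], Rch (rel M) (H.toFinset \ X) r a := by
      intro a ha
      rcases hmem a ha with ha | rfl
      · exact hrch a ha
      · exact hrs
    refine ⟨(H, Y, W, [], uni (List.range n) A [s], T, []), List.mem_cons_of_mem _
      (mem_mapOnto.2 (Or.inr (mem_mapOnto.2 (Or.inl ⟨s, hs, rfl⟩)))), ?_, ?_⟩
    · refine ⟨hb, fun w hw => ?_, h.length_le, h.unassigned, fun h => absurd h hne,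
        fun h => absurd rfl h, X, hX.subset, hX.card_le, hX.good, fun h => absurd rfl h,
        fun _ _ => ⟨r, hrW, hsub r hrA, hrX, hsink, hrch', hnot⟩⟩
      rcases h.cover w hw with h | h | h
      · exact Or.inl h
      · exact Or.inr (Or.inl (hsub w h))
      · exact Or.inr (Or.inr h)
    · have h₃ := hnext s hsH (hSR s hs)
      have h₄ := min_lam_mono (M := M) (A := A) (A' := uni (List.range n) A [s]) (T := T) (T' := T)
        hb.nodup hb.lt hk hsub (fun a ha => List.mem_toFinset.1
          (Finset.mem_sdiff.1 ((hrch' a ha).mem hrX)).1) (fun t ht => ht)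
      rw [hpot]
      simp only [pot, phasePot, ne_eq, not_true_eq_false, if_false, hne, ← hT']
      omega
  · push Not at h₁ h₂
    have hQR : reachSet (rel M) H.toFinset X {r} ⊆ R.toFinset :=
      reachSet_subset_of_bd (by simpa using hrX) (by simpa using hAR (List.mem_toFinset.2 hrA))
        fun s hs u hu => by
          rw [Finset.mem_singleton.1 hu]
          exact h₂ s (List.mem_toFinset.1 (hSfin ▸ hs))
    have hle := lam_le_of_sol hb hX (B := A) (C := T) (P := {r})
      (fun a ha => mem_reachSet.2 ⟨hAX a ha, r, by simp, hrch a ha⟩)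
      (fun t ht ht' => by
        obtain ⟨-, u, hu, hut⟩ := mem_reachSet.1 ht'
        rw [Finset.mem_singleton.1 hu] at hut
        exact hnot t ht hut)
    obtain ⟨X', hX'sub, hX'card, hX'good⟩ := exists_solution_of_finish hX.good
      (bd_reachSet_subset (U := {r})) hQR (by rw [hcard]; omega)
    rw [← hSfin] at hX'sub hX'card hX'good
    rw [List.toFinset_card_of_nodup (bdry_nodup hb.nodup R), ← hS] at hX'card
    have hRH : ∀ v ∈ R, v ∈ H := rmax_subset
    have hunion : ∀ G ⊆ (H.toFinset \ S.toFinset) \ R.toFinset, Good (rel M) d G →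
        Good (rel M) d (R.toFinset ∪ G) := by
      intro G hG hGg
      rw [hSfin] at hG
      refine hb.good.union (fun v hv => ?_) (fun v hv => ?_) hG hGg
      · exact List.mem_toFinset.2 (hRH v (List.mem_toFinset.1 hv))
      · have hle : (returning (List.range n) M H W v).toFinset.card ≤ d := by
          by_contra hlt
          have hvH := hRH v (List.mem_toFinset.1 hv)
          exact Finset.disjoint_left.1 hRT hv (List.mem_toFinset.2 (mem_uni.2 ⟨hb.lt v hvH,
            Or.inr ((mem_active hb.nodup).2 ⟨hvH, not_le.1 hlt⟩)⟩))
        rw [toFinset_returning hb.nodup hb.lt] at hle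
        convert hle
    obtain ⟨h₃, h₄⟩ := inv_advance hb (S := S) (R := R) (bdry_subset R)
      (bdry_nodup hb.nodup R) hRH (fun v hv hv' => hSR v hv' hv) hunion
      ⟨X', hX'sub, by have := hX.card_le; omega, hX'good⟩
      (Or.inr ⟨r, hrW, List.mem_toFinset.1 (hAR (List.mem_toFinset.2 hrA))⟩)
    exact ⟨_, List.mem_cons_self, h₃, by omega⟩

/-- A state on a successful path that still has terminals has a successor on a successful path, of
smaller potential. -/
theorem exists_branch (hk : k ≤ n) (h : Inv n M k d H Y W Wu A T U) (hW : W ≠ []) :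
    ∃ st ∈ branches (List.range n) M k d H Y W Wu A T U, InvSt n M k d st ∧
      pot n M k d st < pot n M k d (H, Y, W, Wu, A, T, U) := by
  have h₁ : leb (k + 1) Y.length = false := by
    rw [← Bool.not_eq_true, leb_iff]; have := h.length_deleted_le; omega
  have h₂ : leb (k + 2) W.length = false := by
    rw [← Bool.not_eq_true, leb_iff]; have := h.base.length_le; omega
  rw [branches, h₁, h₂, Bool.or_self, cond_false]
  by_cases hU : U = []
  swap
  · rw [show (!U.isEmpty) = true by simp [hU], cond_true]
    exact step_cut hk h hU
  subst hU
  rw [show (!([] : List ℕ).isEmpty) = false from rfl, cond_false]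
  by_cases hA : A = []
  · subst hA
    exact step_fresh h hW
  rw [show A.isEmpty = false by simp [hA], cond_false]
  by_cases hWu : Wu = []
  swap
  · rw [show (!Wu.isEmpty) = true by simp [hWu], cond_true]
    exact step_assign h hA hWu
  subst hWu
  rw [show (!([] : List ℕ).isEmpty) = false from rfl, cond_false]
  have hlam : lam (List.range n) M H A T ≤ k := by
    obtain ⟨X, hX⟩ := h.sol
    obtain ⟨r, hrW, hrA, hrX, hsink, hrch, hnot⟩ := hX.root rfl hA
    have hle := lam_le_of_sol h.base hX (B := A) (C := T) (P := {r})
      (fun a ha => mem_reachSet.2 ⟨(hrch a ha).mem hrX, r, by simp, hrch a ha⟩)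
      (fun t ht ht' => by
        obtain ⟨-, u, hu, hut⟩ := mem_reachSet.1 ht'
        rw [Finset.mem_singleton.1 hu] at hut
        exact hnot t ht hut)
    exact hle.1.trans hle.2
  have h₃ : leb (k + 1) (lam (List.range n) M H A T) = false := by
    rw [← Bool.not_eq_true, leb_iff]; omega
  rw [mainBranches, h₃, cond_false]
  by_cases hf : forced (List.range n) M d H W A T = []
  · rw [hf, List.isEmpty_nil, cond_true]
    exact step_finish hk h hA hlam hf
  · rw [show (forced (List.range n) M d H W A T).isEmpty = false by simp [hf], cond_false]
    obtain ⟨v, vs, hv⟩ := List.exists_cons_of_ne_nil hf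
    rw [show (forced (List.range n) M d H W A T).headD 0 = v by rw [hv]; rfl]
    exact step_vertex hk h hA hlam (by rw [hv]; simp)

end
end SCCDeletion

namespace SCCDeletion
open RecProg

/-! ### Depth-first search -/

section
variable {σ ρ : Type}

/-- The first nonempty value of `g` on a list, and the empty list if there is none. -/
def firstHit (g : σ → List ρ) : List σ → List ρ
  | [] => []
  | s :: l => bif (g s).isEmpty then firstHit g l else g s

/-- Depth-first search from `s` for a state with a nonempty value of `found`, to the given depth. -/
def searchFrom (found : σ → List ρ) (children : σ → List σ) : ℕ → σ → List ρ
  | 0, s => found s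
  | f + 1, s => bif (found s).isEmpty then firstHit (searchFrom found children f) (children s)
      else found s

theorem exists_of_firstHit_ne_nil {g : σ → List ρ} {l : List σ} (h : firstHit g l ≠ []) :
    ∃ s ∈ l, firstHit g l = g s := by
  induction l with
  | nil => exact absurd rfl h
  | cons s l ih =>
    unfold firstHit at h ⊢
    cases hs : (g s).isEmpty
    · exact ⟨s, by simp, by simp⟩
    · rw [hs, cond_true] at h
      obtain ⟨t, ht, h⟩ := ih h
      exact ⟨t, by simp [ht], by simpa using h⟩

theorem firstHit_ne_nil {g : σ → List ρ} {l : List σ} {s : σ} (hs : s ∈ l) (h : g s ≠ []) :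
    firstHit g l ≠ [] := by
  induction l with
  | nil => simp at hs
  | cons t l ih =>
    unfold firstHit
    cases ht : (g t).isEmpty
    · simpa using ht
    · rcases List.mem_cons.1 hs with rfl | hs
      · exact absurd (List.isEmpty_iff.1 ht) h
      · simpa using ih hs

variable {found : σ → List ρ} {children : σ → List σ}

theorem exists_of_searchFrom_ne_nil {I : σ → Prop} (hI : ∀ s, I s → ∀ t ∈ children s, I t) :
    ∀ (f : ℕ) (s : σ), I s → searchFrom found children f s ≠ [] →
      ∃ t, I t ∧ searchFrom found children f s = found t
  | 0, s, hs, _ => ⟨s, hs, rfl⟩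
  | f + 1, s, hs, h => by
    unfold searchFrom at h ⊢
    cases hf : (found s).isEmpty
    · exact ⟨s, hs, by simp⟩
    · rw [hf, cond_true] at h
      obtain ⟨t, ht, h'⟩ := exists_of_firstHit_ne_nil h
      rw [h'] at h
      obtain ⟨u, hu, h⟩ := exists_of_searchFrom_ne_nil hI f t (hI s hs t ht) h
      exact ⟨u, hu, by rw [cond_true, h', h]⟩

/-- The search succeeds if from each state with the property `J` either the state itself is a hit or
a child with the property `J` and a smaller potential exists. -/
theorem searchFrom_ne_nil {J : σ → Prop} {p : σ → ℕ}
    (hJ : ∀ s, J s → found s ≠ [] ∨ ∃ t ∈ children s, J t ∧ p t < p s) :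
    ∀ (f : ℕ) (s : σ), J s → p s ≤ f → searchFrom found children f s ≠ []
  | 0, s, hs, hp => (hJ s hs).resolve_right fun ⟨_, _, _, h⟩ => by omega
  | f + 1, s, hs, hp => by
    unfold searchFrom
    cases hf : (found s).isEmpty
    · simpa using hf
    · obtain ⟨t, ht, h₁, h₂⟩ := (hJ s hs).resolve_left (by simpa using hf)
      exact firstHit_ne_nil ht (searchFrom_ne_nil hJ f t h₁ (by omega))

end

/-! ### The compression step -/

/-- The list of the deleted set of the state if this set is a solution, and the empty list
otherwise. -/
def found (vs : List ℕ) (M : List (List Bool)) (k d : ℕ) (s : St) : List (List ℕ) :=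
  bif leb s.2.1.length k && good vs M d (diff vs s.2.1) then [s.2.1] else []

/-- The successors of a state, given as one object. -/
def children (vs : List ℕ) (M : List (List Bool)) (k d : ℕ) (s : St) : List St :=
  branches vs M k d s.1 s.2.1 s.2.2.1 s.2.2.2.1 s.2.2.2.2.1 s.2.2.2.2.2.1 s.2.2.2.2.2.2

/-- All components of the state are increasing lists of numbers below `n`. -/
def Sorted (n : ℕ) (s : St) : Prop :=
  s.1.Sublist (List.range n) ∧ s.2.1.Sublist (List.range n) ∧ s.2.2.1.Sublist (List.range n) ∧
  s.2.2.2.1.Sublist (List.range n) ∧ s.2.2.2.2.1.Sublist (List.range n) ∧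
  s.2.2.2.2.2.1.Sublist (List.range n) ∧ s.2.2.2.2.2.2.Sublist (List.range n)

section
variable {n : ℕ} {M : List (List Bool)} {k d : ℕ}

theorem uni_sublist (S T : List ℕ) : (uni (List.range n) S T).Sublist (List.range n) :=
  List.filter_sublist

theorem diff_sublist {S T vs : List ℕ} (h : S.Sublist vs) : (diff S T).Sublist vs :=
  List.filter_sublist.trans h

theorem sorted_advance {H Y W S R : List ℕ} (hH : H.Sublist (List.range n))
    (hW : W.Sublist (List.range n)) : Sorted n (advance (List.range n) H Y W S R) :=
  ⟨diff_sublist (diff_sublist hH), uni_sublist _ _, diff_sublist (diff_sublist hW),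
    diff_sublist (diff_sublist hW), List.nil_sublist _, List.nil_sublist _, List.nil_sublist _⟩

theorem sorted_of_mem_children {s t : St} (hs : Sorted n s)
    (ht : t ∈ children (List.range n) M k d s) : Sorted n t := by
  obtain ⟨H, Y, W, Wu, A, T, U⟩ := s
  obtain ⟨hH, hY, hW, hWu, hA, hT, hU⟩ := hs
  simp only at hH hY hW hWu hA hT hU
  have hadv : ∀ S R, Sorted n (advance (List.range n) H Y W S R) :=
    fun S R => sorted_advance hH hW
  simp only [children, branches] at ht
  cases h₁ : leb (k + 1) Y.length || leb (k + 2) W.length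
  swap
  · simp [h₁] at ht
  rw [h₁, cond_false] at ht
  cases h₂ : !U.isEmpty
  swap
  · rw [h₂, cond_true, cutBranches] at ht
    generalize bdry M H _ = S at ht
    cases h₃ : leb (k + 1) (lam (List.range n) M H U W) || leb (k + 1) S.length
    swap
    · simp [h₃] at ht
    rw [h₃, cond_false, List.mem_cons, mem_mapOnto, mem_mapOnto] at ht
    rcases ht with rfl | ⟨x, -, rfl⟩ | ⟨x, -, rfl⟩ | ht
    · exact hadv _ _
    · exact hadv _ _
    · exact ⟨hH, hY, hW, hWu, hA, hT, uni_sublist _ _⟩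
    · simp at ht
  rw [h₂, cond_false] at ht
  cases h₃ : A.isEmpty
  swap
  · rw [h₃, cond_true, mem_mapOnto, mem_mapOnto] at ht
    rcases ht with ⟨x, -, rfl⟩ | ⟨x, hx, rfl⟩ | ht
    · exact hadv _ _
    · exact ⟨hH, hY, hW, hWu, (List.singleton_sublist.2 hx).trans hW, hT, hU⟩
    · simp at ht
  rw [h₃, cond_false] at ht
  cases h₄ : !Wu.isEmpty
  swap
  · rw [h₄, cond_true, List.mem_cons, List.mem_singleton] at ht
    rcases ht with rfl | rfl
    · exact ⟨hH, hY, hW, (List.tail_sublist _).trans hWu, uni_sublist _ _, hT, hU⟩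
    · exact ⟨hH, hY, hW, (List.tail_sublist _).trans hWu, hA, uni_sublist _ _, hU⟩
  rw [h₄, cond_false, mainBranches] at ht
  cases h₅ : leb (k + 1) (lam (List.range n) M H A T)
  swap
  · simp [h₅] at ht
  rw [h₅, cond_false] at ht
  cases h₆ : (forced (List.range n) M d H W A T).isEmpty
  · rw [h₆, cond_false, vertexBranches, List.mem_cons, List.mem_cons, mem_mapOnto,
      mem_mapOnto] at ht
    rcases ht with rfl | rfl | ⟨x, -, rfl⟩ | ⟨x, hx, rfl⟩ | ht
    · exact hadv _ _
    · exact ⟨hH, hY, hW, hWu, hA, uni_sublist _ _, hU⟩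
    · exact hadv _ _
    · refine ⟨hH, hY, hW, hWu, hA, hT, (List.singleton_sublist.2 ?_).trans hH⟩
      rw [pick_eq, List.mem_reverse] at hx
      exact (List.mem_filter.1 (List.mem_of_mem_take hx)).1
    · simp at ht
  · rw [h₆, cond_true, finishBranches] at ht
    generalize bdry M H _ = S at ht
    cases h₇ : leb (k + 1) S.length
    swap
    · simp [h₇] at ht
    rw [h₇, cond_false, List.mem_cons, mem_mapOnto, mem_mapOnto] at ht
    rcases ht with rfl | ⟨x, -, rfl⟩ | ⟨x, -, rfl⟩ | ht
    · exact hadv _ _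
    · exact hadv _ _
    · exact ⟨hH, hY, hW, hWu, uni_sublist _ _, hT, hU⟩
    · simp at ht

/-- Because large cuts are discarded, the search tree has bounded degree. -/
theorem length_children_le (vs : List ℕ) (M : List (List Bool)) (k d : ℕ) (s : St) :
    (children vs M k d s).length ≤ 2 * k + 2 * d + 6 := by
  obtain ⟨H, Y, W, Wu, A, T, U⟩ := s
  simp only [children, branches]
  cases h₁ : leb (k + 1) Y.length || leb (k + 2) W.length
  swap
  · simp
  have hW : W.length ≤ k + 1 := by
    by_contra hcon
    simp [leb] at h₁
    omega
  rw [cond_false]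
  cases !U.isEmpty
  swap
  · rw [cond_true, cutBranches]
    generalize bdry M H _ = S
    cases h₃ : leb (k + 1) (lam vs M H U W) || leb (k + 1) S.length
    swap
    · simp
    simp [leb] at h₃
    simp only [cond_false, List.length_cons, length_mapOnto, List.length_nil]
    omega
  rw [cond_false]
  cases A.isEmpty
  swap
  · simp only [cond_true, length_mapOnto, List.length_nil]
    omega
  rw [cond_false]
  cases !Wu.isEmpty
  swap
  · simp
  rw [cond_false, mainBranches]
  cases leb (k + 1) (lam vs M H A T)
  swap
  · simp
  rw [cond_false]
  cases (forced vs M d H W A T).isEmpty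
  · have : ∀ l : List ℕ, (pick (d + 1) l).length ≤ d + 1 := by simp [pick_eq]
    have := this (returning vs M H W ((forced vs M d H W A T).headD 0))
    simp only [cond_false, vertexBranches, List.length_cons, length_mapOnto, List.length_nil]
    omega
  · rw [cond_true, finishBranches]
    generalize bdry M H _ = S
    cases h₃ : leb (k + 1) S.length
    swap
    · simp
    simp [leb] at h₃
    simp only [cond_false, List.length_cons, length_mapOnto, List.length_nil]
    omega

theorem toFinset_diff_range (Y : List ℕ) :
    (diff (List.range n) Y).toFinset = Finset.range n \ Y.toFinset := by
  rw [toFinset_diff, List.toFinset_range]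

theorem good_diff_range {Y : List ℕ} : good (List.range n) M d (diff (List.range n) Y) = true ↔
    Good (rel M) d (Finset.range n \ Y.toFinset) := by
  have h : (diff (List.range n) Y).Nodup := List.nodup_range.filter _
  rw [good_iff h fun v hv => List.mem_range.1 (mem_diff.1 hv).1, toFinset_diff_range]

/-- What is found is a solution. -/
theorem of_found_ne_nil {s : St} (hs : Sorted n s) (h : found (List.range n) M k d s ≠ []) :
    ∃ Y : List ℕ, found (List.range n) M k d s = [Y] ∧ Y.Sublist (List.range n) ∧ Y.length ≤ k ∧
      Good (rel M) d (Finset.range n \ Y.toFinset) := by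
  unfold found at h ⊢
  cases hc : leb s.2.1.length k && good (List.range n) M d (diff (List.range n) s.2.1)
  · simp [hc] at h
  · rw [Bool.and_eq_true, leb_iff, good_diff_range] at hc
    exact ⟨s.2.1, rfl, hs.2.1, hc.1, hc.2⟩

theorem found_or_exists_child (hk : k ≤ n) (s : St) (h : InvSt n M k d s) :
    found (List.range n) M k d s ≠ [] ∨
      ∃ t ∈ children (List.range n) M k d s, InvSt n M k d t ∧ pot n M k d t < pot n M k d s := by
  obtain ⟨H, Y, W, Wu, A, T, U⟩ := s
  by_cases hW : W = []
  · left
    subst hW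
    obtain ⟨X, hX⟩ := h.sol
    have hb := h.base
    have h₁ : Good (rel M) d (Finset.range n \ Y.toFinset) := by
      refine (hb.extend H.toFinset subset_rfl (by simpa using hb.good)).mono fun v hv => ?_
      simp only [Finset.mem_union, Finset.mem_sdiff] at hv ⊢
      tauto
    have h₂ : leb Y.length k = true := leb_iff.2 (by have := hX.card_le; omega)
    simp [found, h₂, good_diff_range.2 h₁]
  · exact Or.inr (exists_branch hk h hW)

/-- The state in which the search for a solution begins, given a set `W` whose deletion leaves
small components. -/
def initial (vs W : List ℕ) : St := (vs, [], W, W, [], [], [])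

/-- A depth that suffices for the search with the parameter `k`: the potential of the initial state is
at most `(4 * k + 9) * (2 * k + 1) + (4 * k + 8)`. -/
def depth (k : ℕ) : ℕ := 8 * k ^ 2 + 26 * k + 18

theorem sorted_initial {W : List ℕ} (hW : W.Sublist (List.range n)) :
    Sorted n (initial (List.range n) W) :=
  ⟨List.Sublist.refl _, List.nil_sublist _, hW, hW, List.nil_sublist _, List.nil_sublist _,
    List.nil_sublist _⟩

/-- Compression: from a solution of size at most `k + 1`, the search finds one of size at most `k`,
or there is none. -/
theorem searchFrom_initial (hk : k ≤ n) {W : List ℕ} (hW : W.Sublist (List.range n))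
    (hWk : W.length ≤ k + 1) (hWg : Good (rel M) d (Finset.range n \ W.toFinset)) {r : List (List ℕ)}
    (hr : r = searchFrom (found (List.range n) M k d) (children (List.range n) M k d) (depth k)
      (initial (List.range n) W)) :
    (r ≠ [] → ∃ Y : List ℕ, r = [Y] ∧ Y.Sublist (List.range n) ∧ Y.length ≤ k ∧
      Good (rel M) d (Finset.range n \ Y.toFinset)) ∧
    ∀ X ⊆ Finset.range n, X.card ≤ k → Good (rel M) d (Finset.range n \ X) → r ≠ [] := by
  subst hr
  refine ⟨fun h => ?_, fun X hX hXk hXg => ?_⟩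
  · obtain ⟨t, ht, he⟩ := exists_of_searchFrom_ne_nil (I := Sorted n)
      (fun s hs t ht => sorted_of_mem_children hs ht) _ _ (sorted_initial hW) h
    rw [he] at h ⊢
    exact of_found_ne_nil ht h
  · have hWn : ∀ w ∈ W, w ∈ List.range n := fun w hw => hW.subset hw
    refine searchFrom_ne_nil (J := InvSt n M k d) (p := pot n M k d)
      (found_or_exists_child hk) _ _ ?_ ?_
    · refine ⟨⟨List.nodup_range, fun v hv => List.mem_range.1 hv, by simp, by simp, by simp, hWn,
        hWk, by simpa [List.toFinset_range] using hWg,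
        fun G hG hGg => by simpa [List.toFinset_range] using hGg⟩, fun w hw => Or.inl hw, hWk,
        fun w hw => hw, fun _ => rfl, fun h => absurd rfl h, X, ?_, by simpa using hXk,
        by simpa [List.toFinset_range] using hXg, fun h => absurd rfl h, fun _ h => absurd rfl h⟩
      simpa [List.toFinset_range] using hX
    · have : (4 * k + 9) * (k + W.length) ≤ (4 * k + 9) * (2 * k + 1) :=
        Nat.mul_le_mul_left _ (by omega)
      simp only [pot, initial, stagePot, phasePot, depth, List.length_nil, ne_eq,
        not_true_eq_false, if_false, if_true, Nat.sub_zero]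
      nlinarith

end
end SCCDeletion

namespace RecProg
open Enc (enc)
open SCCDeletion (firstHit searchFrom)

/-! ### Depth-first search on the machine -/

namespace EvalLe

variable {P : Program} {env : List Val} {e₁ e₂ : Expr} {v v₁ v₂ : Val} {T₁ T₂ : ℕ}

theorem var1 : EvalLe P (v₁ :: v :: env) (.var 1) v 1 := ⟨1, le_rfl, .var⟩

theorem var2 : EvalLe P (v₁ :: v₂ :: v :: env) (.var 2) v 1 := ⟨1, le_rfl, .var⟩

theorem bind (h₁ : EvalLe P env e₁ v₁ T₁) (h₂ : EvalLe P (v₁ :: env) e₂ v₂ T₂) :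
    EvalLe P env (.bind e₁ e₂) v₂ (T₁ + T₂ + 1) :=
  let ⟨_, h, h₁⟩ := h₁; let ⟨_, h', h₂⟩ := h₂; ⟨_, by omega, h₁.bind h₂⟩

end EvalLe

/-- The body of the depth-first search through a list of states. The argument holds a parameter,
the depth and the list; function `j` tests the first state, function `j + 1` lists its children, and
function `j + 2` is the search itself. -/
def searchBody (j : ℕ) : Expr :=
  .ite (.isPair (.snd (.snd (.var 0))))
    (.bind (.call j (.pair (.fst (.var 0)) (.fst (.snd (.snd (.var 0))))))
      (.ite (.isPair (.var 0)) (.var 0)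
        (.bind
          (.ite (.le (.const 1) (.fst (.snd (.var 1))))
            (.call (j + 2) (.pair (.fst (.var 1)) (.pair (.sub (.fst (.snd (.var 1))) (.const 1))
              (.call (j + 1) (.pair (.fst (.var 1)) (.fst (.snd (.snd (.var 1)))))))))
            (.const 0))
          (.ite (.isPair (.var 0)) (.var 0)
            (.call (j + 2) (.pair (.fst (.var 2)) (.pair (.fst (.snd (.var 2)))
              (.snd (.snd (.snd (.var 2)))))))))))
    (.const 0)

/-- A bound for the time of the depth-first search from a single state to the depth `f`, if states
have at most `b` children and are tested and expanded in time `τ`. -/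
def searchTime (τ b f : ℕ) : ℕ := (2 * τ + 100) * (b + 2) ^ f

theorem searchTime_succ (τ b f : ℕ) :
    b * searchTime τ b f + 4 * τ + 200 ≤ searchTime τ b (f + 1) := by
  have h : 2 * τ + 100 ≤ searchTime τ b f := Nat.le_mul_of_pos_right _ (by positivity)
  have h' : searchTime τ b (f + 1) = b * searchTime τ b f + 2 * searchTime τ b f := by
    simp only [searchTime, pow_succ]; ring
  omega

theorem add_le_searchTime (τ b f : ℕ) : 2 * τ + 100 ≤ searchTime τ b f :=
  Nat.le_mul_of_pos_right _ (by positivity)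

theorem searchBody_eval {κ σ ρ : Type} [Enc κ] [Enc σ] [Enc ρ] (P : Program) (eF eC : Expr) (c : κ)
    {found : σ → List ρ} {children : σ → List σ} (I : σ → Prop) (b τ : ℕ)
    (hI : ∀ s, I s → (∀ t ∈ children s, I t) ∧ (children s).length ≤ b ∧
      EvalLe P [enc (c, s)] eF (enc (found s)) τ ∧
      EvalLe P [enc (c, s)] eC (enc (children s)) τ) (f : ℕ) :
    ∀ l : List σ, (∀ s ∈ l, I s) →
      EvalLe (P ++ [eF, eC, searchBody P.length]) [enc (c, f, l)] (searchBody P.length)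
        (enc (firstHit (searchFrom found children f) l)) (l.length * searchTime τ b f + 10) := by
  have hq₀ : (P ++ [eF, eC, searchBody P.length])[P.length]? = some eF := by simp
  have hq₁ : (P ++ [eF, eC, searchBody P.length])[P.length + 1]? = some eC := by simp
  have hq₂ : (P ++ [eF, eC, searchBody P.length])[P.length + 2]? = some (searchBody P.length) := by
    simp
  generalize hQ : P ++ [eF, eC, searchBody P.length] = Q at hq₀ hq₁ hq₂
  have hP : ∀ {env e v T}, EvalLe P env e v T → EvalLe Q env e v T := fun h => hQ ▸ h.append_right _
  have hnil : ∀ {env : List Val} {r : List ρ}, r = [] → EvalLe Q env (.const 0) (enc r) 1 := by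
    rintro env r rfl; exact .const
  induction f with
  | zero =>
    intro l
    induction l with
    | nil => exact fun _ => (EvalLe.iteFalse EvalLe.var0.snd.snd.isPair (hnil rfl)).mono (by omega)
    | cons s l ih =>
      intro hl
      obtain ⟨-, -, hF, -⟩ := hI s (hl s (by simp))
      have x0 : EvalLe Q [enc (c, 0, s :: l)] (.var 0)
        (.pair (enc c) (.pair (.num 0) (.pair (enc s) (enc l)))) 1 := .var0
      have x1 : ∀ {v}, EvalLe Q [v, enc (c, 0, s :: l)] (.var 1)
        (.pair (enc c) (.pair (.num 0) (.pair (enc s) (enc l)))) 1 := .var1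
      have x2 : ∀ {v w}, EvalLe Q [w, v, enc (c, 0, s :: l)] (.var 2)
        (.pair (enc c) (.pair (.num 0) (.pair (enc s) (enc l)))) 1 := .var2
      have hrec := ih fun t ht => hl t (by simp [ht])
      have hcall := (x0.fst.pair x0.snd.snd.fst).call hq₀ (hP hF)
      have hT := add_le_searchTime τ b 0
      simp only [List.length_cons, Nat.add_mul, Nat.one_mul]
      cases hfs : found s with
      | cons y r =>
        rw [hfs] at hcall
        have : firstHit (searchFrom found children 0) (s :: l) = y :: r := by
          simp [firstHit, searchFrom, hfs]
        rw [this]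
        exact (EvalLe.iteTrue x0.snd.snd.isPair (Nat.succ_ne_zero 0) (hcall.bind
          (EvalLe.var0.isPair.iteTrue (Nat.succ_ne_zero 0) .var0))).mono (by omega)
      | nil =>
        rw [hfs] at hcall
        have : firstHit (searchFrom found children 0) (s :: l) =
            firstHit (searchFrom found children 0) l := by simp [firstHit, searchFrom, hfs]
        rw [this]
        refine (EvalLe.iteTrue x0.snd.snd.isPair (Nat.succ_ne_zero 0) (hcall.bind
          (EvalLe.var0.isPair.iteFalse (EvalLe.bind (EvalLe.iteFalse (EvalLe.const.le x1.snd.fst)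
            (EvalLe.const (n := 0))) (EvalLe.var0.isPair.iteFalse
              ((x2.fst.pair (x2.snd.fst.pair x2.snd.snd.snd)).call hq₂ hrec)))))).mono (by omega)
  | succ f ihf =>
    intro l
    induction l with
    | nil => exact fun _ => (EvalLe.iteFalse EvalLe.var0.snd.snd.isPair (hnil rfl)).mono (by omega)
    | cons s l ih =>
      intro hl
      obtain ⟨hch, hb, hF, hC⟩ := hI s (hl s (by simp))
      have x0 : EvalLe Q [enc (c, f + 1, s :: l)] (.var 0)
        (.pair (enc c) (.pair (.num (f + 1)) (.pair (enc s) (enc l)))) 1 := .var0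
      have x1 : ∀ {v}, EvalLe Q [v, enc (c, f + 1, s :: l)] (.var 1)
        (.pair (enc c) (.pair (.num (f + 1)) (.pair (enc s) (enc l)))) 1 := .var1
      have x2 : ∀ {v w}, EvalLe Q [w, v, enc (c, f + 1, s :: l)] (.var 2)
        (.pair (enc c) (.pair (.num (f + 1)) (.pair (enc s) (enc l)))) 1 := .var2
      have hrec := ih fun t ht => hl t (by simp [ht])
      have hsub := ihf (children s) hch
      have hcall := (x0.fst.pair x0.snd.snd.fst).call hq₀ (hP hF)
      have hT := searchTime_succ τ b f
      have hbT := Nat.mul_le_mul_right (searchTime τ b f) hb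
      simp only [List.length_cons, Nat.add_mul, Nat.one_mul]
      cases hfs : found s with
      | cons y r =>
        rw [hfs] at hcall
        have : firstHit (searchFrom found children (f + 1)) (s :: l) = y :: r := by
          simp [firstHit, searchFrom, hfs]
        rw [this]
        exact (EvalLe.iteTrue x0.snd.snd.isPair (Nat.succ_ne_zero 0) (hcall.bind
          (EvalLe.var0.isPair.iteTrue (Nat.succ_ne_zero 0) .var0))).mono (by omega)
      | nil =>
        rw [hfs] at hcall
        have hgo : ∀ {v}, EvalLe Q [v, enc (c, f + 1, s :: l)] (.le (.const 1) (.fst (.snd (.var 1))))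
            (.num 1) 5 := by
          intro v
          simpa using (EvalLe.const (n := 1)).le (x1 (v := v)).snd.fst
        have hmid : ∀ {v}, EvalLe Q [v, enc (c, f + 1, s :: l)] _ _ _ := fun {v} =>
          (x1 (v := v)).fst.pair (((x1 (v := v)).snd.fst.sub (EvalLe.const (n := 1))).pair
            (((x1 (v := v)).fst.pair x1.snd.snd.fst).call hq₁ (hP hC)))|>.call hq₂ hsub
        cases hmid' : firstHit (searchFrom found children f) (children s) with
        | nil =>
          rw [hmid'] at hmid
          have : firstHit (searchFrom found children (f + 1)) (s :: l) =
              firstHit (searchFrom found children (f + 1)) l := by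
            simp [firstHit, searchFrom, hfs, hmid']
          rw [this]
          exact (EvalLe.iteTrue x0.snd.snd.isPair (Nat.succ_ne_zero 0) (hcall.bind
            (EvalLe.var0.isPair.iteFalse (EvalLe.bind (hgo.iteTrue one_ne_zero hmid)
              (EvalLe.var0.isPair.iteFalse
                ((x2.fst.pair (x2.snd.fst.pair x2.snd.snd.snd)).call hq₂ hrec)))))).mono (by omega)
        | cons y r =>
          rw [hmid'] at hmid
          have : firstHit (searchFrom found children (f + 1)) (s :: l) = y :: r := by
            simp [firstHit, searchFrom, hfs, hmid']
          rw [this]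
          exact (EvalLe.iteTrue x0.snd.snd.isPair (Nat.succ_ne_zero 0) (hcall.bind
            (EvalLe.var0.isPair.iteFalse (EvalLe.bind (hgo.iteTrue one_ne_zero hmid)
              (EvalLe.var0.isPair.iteTrue (Nat.succ_ne_zero 0) .var0))))).mono (by omega)

end RecProg

namespace SCCDeletion
open RecProg

/-! ### Iterative compression -/

/-- The list of the numbers below the number of rows of a matrix. -/
def verts (M : List (List Bool)) : List ℕ :=
  (M.foldl (fun l _ => l.length :: l) []).reverse

/-- The parameter, reduced to the number of vertices: the vertices below `k` are counted. -/
def budget (vs : List ℕ) (k : ℕ) : List ℕ := vs.filter fun v => leb (v + 1) k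

/-- The numbers below and including `m` among the vertices. -/
def upTo (M : List (List Bool)) (m : ℕ) : List ℕ := (verts M).filter fun v => leb v m

/-- The previous solution together with the new vertex `m`. -/
def terminalsAt (M : List (List Bool)) (r : List (List ℕ)) (m : ℕ) : List ℕ :=
  (upTo M m).filter fun v => mem v (r.headD []) || eqb v m

/-- The inputs of the algorithm: `d`, `k`, the number of vertices and the adjacency matrix. -/
abbrev Inst : Type := ℕ × ℕ × ℕ × List (List Bool) × Unit

/-- One round of iterative compression, in which the vertex `m` is added. The list `r` is empty if
there is no solution on the vertices below `m`; otherwise it has such a solution as its element. -/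
def round (M : List (List Bool)) (k d : ℕ) (r : List (List ℕ)) (m : ℕ) : List (List ℕ) :=
  bif r.isEmpty then [] else
    firstHit (searchFrom (found (upTo M m) M (budget (upTo M m) k).length d)
      (children (upTo M m) M (budget (upTo M m) k).length d)
      (depth (budget (upTo M m) k).length)) [initial (upTo M m) (terminalsAt M r m)]

/-- The result of all rounds, which is empty if and only if there is no solution. -/
def solve (M : List (List Bool)) (k d : ℕ) : List (List ℕ) :=
  (verts M).foldl (round M k d) [[]]

section
variable {M : List (List Bool)} {k d n : ℕ}

theorem verts_eq (M : List (List Bool)) : verts M = List.range M.length := by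
  have h : ∀ (M : List (List Bool)) (l : List ℕ), l = (List.range l.length).reverse →
      M.foldl (fun l _ => l.length :: l) l = (List.range (l.length + M.length)).reverse := by
    intro M
    induction M with
    | nil => intro l hl; simpa using hl
    | cons x M ih =>
      intro l hl
      rw [List.foldl_cons, ih _ (by simp [List.range_succ, ← hl])]
      simp only [List.length_cons]
      congr 2
      omega
  rw [verts, h M [] rfl]
  simp

theorem filter_lt_range (n m : ℕ) (h : m ≤ n) :
    ((List.range n).filter fun v => decide (v < m)) = List.range m := by
  obtain ⟨j, rfl⟩ := Nat.exists_eq_add_of_le h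
  rw [List.range_add, List.filter_append, List.filter_eq_self.2 (by simp),
    List.filter_eq_nil_iff.2 (by simp), List.append_nil]

theorem upTo_eq {m : ℕ} (hm : m < M.length) : upTo M m = List.range (m + 1) := by
  rw [upTo, verts_eq, ← filter_lt_range M.length (m + 1) hm]
  refine List.filter_congr fun v _ => ?_
  simp [leb]

theorem length_budget (n k : ℕ) : (budget (List.range n) k).length = min n k := by
  have : budget (List.range n) k = (List.range n).filter fun v => decide (v < min n k) := by
    refine List.filter_congr fun v hv => ?_
    have := List.mem_range.1 hv
    simp [leb]
    omega
  rw [this, filter_lt_range _ _ (min_le_left _ _), List.length_range]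

theorem round_cons {Y : List ℕ} {r : List (List ℕ)} {m : ℕ} (hm : m < M.length) :
    round M k d (Y :: r) m = searchFrom (found (List.range (m + 1)) M (min (m + 1) k) d)
      (children (List.range (m + 1)) M (min (m + 1) k) d) (depth (min (m + 1) k))
      (initial (List.range (m + 1)) (terminalsAt M (Y :: r) m)) := by
  simp only [round, upTo_eq hm, length_budget, firstHit, List.isEmpty_cons, cond_false]
  cases h : (searchFrom (found (List.range (m + 1)) M (min (m + 1) k) d)
      (children (List.range (m + 1)) M (min (m + 1) k) d) (depth (min (m + 1) k))
      (initial (List.range (m + 1)) (terminalsAt M (Y :: r) m))) <;> simp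

theorem terminalsAt_sublist {r : List (List ℕ)} {m : ℕ} (hm : m < M.length) :
    (terminalsAt M r m).Sublist (List.range (m + 1)) := by
  rw [terminalsAt, upTo_eq hm]
  exact List.filter_sublist

theorem mem_terminalsAt {Y : List ℕ} {r : List (List ℕ)} {m v : ℕ} (hm : m < M.length) :
    v ∈ terminalsAt M (Y :: r) m ↔ v < m + 1 ∧ (v ∈ Y ∨ v = m) := by
  simp [terminalsAt, upTo_eq hm]

theorem round_eq (hm : n < M.length) (r : List (List ℕ)) :
    round M k d r n = [] ∨ ∃ Y : List ℕ, round M k d r n = [Y] ∧ Y.length ≤ M.length := by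
  cases r with
  | nil => exact Or.inl rfl
  | cons Y r =>
    by_cases h : round M k d (Y :: r) n = []
    · exact Or.inl h
    right
    rw [round_cons hm] at h ⊢
    obtain ⟨t, ht, he⟩ := exists_of_searchFrom_ne_nil (I := Sorted (n + 1))
      (fun s hs t ht => sorted_of_mem_children hs ht) _ _
        (sorted_initial (terminalsAt_sublist hm)) h
    rw [he] at h ⊢
    obtain ⟨Y, hY, hs, -⟩ := of_found_ne_nil ht h
    exact ⟨Y, hY, by simpa using hs.length_le.trans (by simpa using hm)⟩

/-- The rounds maintain a solution on the vertices below `i`. -/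
theorem foldl_round {i : ℕ} (hi : i ≤ M.length) {r : List (List ℕ)}
    (hr : r = (List.range i).foldl (round M k d) [[]]) :
    (r ≠ [] → ∃ Y : List ℕ, r = [Y] ∧ Y.Sublist (List.range i) ∧ Y.length ≤ min i k ∧
      Good (rel M) d (Finset.range i \ Y.toFinset)) ∧
    ∀ X ⊆ Finset.range i, X.card ≤ k → Good (rel M) d (Finset.range i \ X) → r ≠ [] := by
  induction i generalizing r with
  | zero =>
    subst hr
    exact ⟨fun _ => ⟨[], rfl, by simp, by simp, fun v hv => by simp at hv⟩, fun _ _ _ _ => by simp⟩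
  | succ i ih =>
    obtain ⟨h₁, h₂⟩ := ih (by omega) rfl
    rw [List.range_succ, List.foldl_append, List.foldl_cons, List.foldl_nil] at hr
    -- Solutions restrict to smaller vertex sets, so a failure in an earlier round is final.
    by_cases hne : (List.range i).foldl (round M k d) [[]] = []
    · rw [hne] at hr
      refine ⟨fun h => absurd hr h, fun X hX hXk hXg => absurd hne ?_⟩
      refine h₂ (X.erase i) (fun v hv => ?_) ((Finset.card_le_card (X.erase_subset i)).trans hXk)
        (hXg.mono fun v hv => ?_)
      · have := Finset.mem_erase.1 hv
        have := Finset.mem_range.1 (hX this.2)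
        exact Finset.mem_range.2 (by omega)
      · simp only [Finset.mem_sdiff, Finset.mem_range, Finset.mem_erase] at hv ⊢
        refine ⟨by omega, fun h => hv.2 ⟨by omega, h⟩⟩
    · obtain ⟨Y, hY, hYs, hYk, hYg⟩ := h₁ hne
      rw [hY, round_cons hi] at hr
      have hsub := terminalsAt_sublist (r := [Y]) hi
      refine (searchFrom_initial (min_le_left _ _) hsub ?_ ?_ hr).imp_right
        fun h X hX hXk hXg => h X hX (le_min (by simpa using Finset.card_le_card hX) hXk) hXg
      · have hle : (terminalsAt M [Y] i).Subperm (i :: Y) := by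
          refine List.subperm_of_subset (List.nodup_range.sublist hsub) fun v hv => ?_
          simpa [or_comm] using ((mem_terminalsAt hi).1 hv).2
        have := hle.length_le
        simp only [List.length_cons] at this
        omega
      · refine hYg.mono fun v hv => ?_
        simp only [Finset.mem_sdiff, Finset.mem_range, List.mem_toFinset, mem_terminalsAt hi] at hv ⊢
        refine ⟨?_, fun h => hv.2 ⟨hv.1, Or.inl h⟩⟩
        by_contra hcon
        exact hv.2 ⟨hv.1, Or.inr (by omega)⟩

/-- Correctness of the algorithm, in terms of the numbered vertices. -/
theorem solve_ne_nil_iff : solve M k d ≠ [] ↔ ∃ X ⊆ Finset.range M.length, X.card ≤ k ∧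
    Good (rel M) d (Finset.range M.length \ X) := by
  rw [solve, verts_eq]
  obtain ⟨h₁, h₂⟩ := foldl_round (M := M) (k := k) (d := d) le_rfl rfl
  refine ⟨fun h => ?_, fun ⟨X, hX, hXk, hXg⟩ => h₂ X hX hXk hXg⟩
  obtain ⟨Y, -, hYs, hYk, hYg⟩ := h₁ h
  refine ⟨Y.toFinset, fun v hv => ?_, (List.toFinset_card_le _).trans (hYk.trans (min_le_right _ _)),
    hYg⟩
  exact Finset.mem_range.2 (List.mem_range.1 (hYs.subset (List.mem_toFinset.1 hv)))

end
end SCCDeletion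

namespace RecProg.PT
open SCCDeletion (St)
variable {α : Type} [Enc α] {vs W : α → List ℕ} {M : α → List (List Bool)} {k d m : α → ℕ}

@[fun_prop]
theorem verts (hM : PT M) : PT (fun a => SCCDeletion.verts (M a)) := by
  unfold SCCDeletion.verts
  refine reverse (foldl (g := fun _ l _ => l.length :: l) hM (by fun_prop) (by fun_prop)
    (((Poly.const 2).mul hM.size).add (.const 1)) fun a l hl => ?_)
  have h : ∀ (l : List (List Bool)) (r : List ℕ),
      (l.foldl (fun l _ => l.length :: l) r).length = r.length + l.length := by
    intro l
    induction l with
    | nil => simp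
    | cons x l ih => intro r; rw [List.foldl_cons, ih]; simp; omega
  have := hl.length_le
  have := length_le_sz (M a)
  rw [sz_list_nat, h]
  simp only [List.length_nil]
  omega

@[fun_prop]
theorem budget (hvs : PT vs) (hk : PT k) : PT (fun a => SCCDeletion.budget (vs a) (k a)) := by
  unfold SCCDeletion.budget; fun_prop

@[fun_prop]
theorem upTo (hM : PT M) (hm : PT m) : PT (fun a => SCCDeletion.upTo (M a) (m a)) := by
  unfold SCCDeletion.upTo; fun_prop

@[fun_prop]
theorem terminalsAt {r : α → List (List ℕ)} (hM : PT M) (hr : PT r) (hm : PT m) :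
    PT (fun a => SCCDeletion.terminalsAt (M a) (r a) (m a)) := by
  unfold SCCDeletion.terminalsAt; fun_prop

@[fun_prop]
theorem initial (hvs : PT vs) (hW : PT W) :
    PT (fun a => SCCDeletion.initial (vs a) (W a)) := by
  unfold SCCDeletion.initial; fun_prop

@[fun_prop]
theorem found {s : α → St} (hvs : PT vs) (hM : PT M) (hk : PT k) (hd : PT d) (hs : PT s) :
    PT (fun a => SCCDeletion.found (vs a) (M a) (k a) (d a) (s a)) := by
  unfold SCCDeletion.found; fun_prop

@[fun_prop]
theorem children {s : α → St} (hvs : PT vs) (hM : PT M) (hk : PT k) (hd : PT d) (hs : PT s) :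
    PT (fun a => SCCDeletion.children (vs a) (M a) (k a) (d a) (s a)) := by
  unfold SCCDeletion.children; fun_prop

/-- The depth of the search is quadratic in the length of a list, and is computed by repeated
addition. -/
@[fun_prop]
theorem depth_length {l : α → List ℕ} (hl : PT l) :
    PT (fun a => SCCDeletion.depth (l a).length) := by
  have h : (fun a => SCCDeletion.depth (l a).length) = fun a =>
      RecProg.mulLen (l a) ((l a).length + (l a).length + (l a).length + (l a).length + (l a).length +
        (l a).length + (l a).length + (l a).length + 26) + 18 := by
    funext a
    rw [mulLen_eq, SCCDeletion.depth]
    ring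
  rw [h]
  fun_prop

end RecProg.PT

namespace SCCDeletion
open RecProg
open RecProg.Enc (enc)

/-! ### The program -/

/-- A measure of the input to which the polynomial part of the running time refers. The second term
is for the lists of vertices in the arguments of the search: there are eight, and each entry takes
two nodes. -/
def inputSize (M : List (List Bool)) : ℕ := sz M + 16 * M.length + 100

/-- The bound for the size of the search tree. The degree is at most `2 * k + 2 * d + 6`; the larger
base absorbs the time spent outside the recursive calls. -/
def treeSize (k d : ℕ) : ℕ := (2 * k + 2 * d + 8) ^ depth k

theorem treeSize_pos (k d : ℕ) : 1 ≤ treeSize k d := Nat.one_le_pow _ _ (by omega)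

theorem sz_list_nat_le {n : ℕ} {l : List ℕ} (h : l.Sublist (List.range n)) : sz l ≤ 2 * n + 1 := by
  have := h.length_le
  rw [List.length_range] at this
  rw [sz_list_nat]
  omega

theorem searchTime_le {k k' : ℕ} (d τ : ℕ) (h : k ≤ k') :
    searchTime τ (2 * k + 2 * d + 6) (depth k) ≤ (2 * τ + 100) * treeSize k' d := by
  have h₁ : depth k ≤ depth k' := by unfold depth; gcongr
  exact Nat.mul_le_mul_left _ ((Nat.pow_le_pow_left (by omega) _).trans
    (Nat.pow_le_pow_right (by omega) h₁))

/-- A single round of iterative compression on the machine. -/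
theorem exists_round_program : ∃ (P : Program) (e : Expr) (c : ℕ),
    ∀ (d k n : ℕ) (M : List (List Bool)) (r : List (List ℕ)) (m : ℕ), m < M.length →
      (r = [] ∨ ∃ Y : List ℕ, r = [Y] ∧ Y.length ≤ M.length) →
      EvalLe P [enc (((d, k, n, M, ()) : Inst), r, m)] e (enc (round M k d r m))
        (inputSize M ^ c * treeSize k d) := by
  have hF : PT (fun q : (List ℕ × List (List Bool) × ℕ × ℕ) × St =>
      found q.1.1 q.1.2.1 q.1.2.2.1 q.1.2.2.2 q.2) := by fun_prop
  have hC : PT (fun q : (List ℕ × List (List Bool) × ℕ × ℕ) × St =>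
      children q.1.1 q.1.2.1 q.1.2.2.1 q.1.2.2.2 q.2) := by fun_prop
  have hstart : PT (fun q : Inst × List (List ℕ) × ℕ =>
      ((upTo q.1.2.2.2.1 q.2.2, q.1.2.2.2.1, (budget (upTo q.1.2.2.2.1 q.2.2) q.1.2.1).length,
        q.1.1), depth (budget (upTo q.1.2.2.2.1 q.2.2) q.1.2.1).length,
        [initial (upTo q.1.2.2.2.1 q.2.2) (terminalsAt q.1.2.2.2.1 q.2.1 q.2.2)])) := by
    fun_prop
  obtain ⟨P, eF, eC, TF, TC, ⟨cF, hTF⟩, ⟨cC, hTC⟩, hF, hC⟩ := hF.common hC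
  obtain ⟨Q, e, T, ⟨c, hT⟩, -, hstart⟩ := hstart
  let P' := P ++ [eF, eC, searchBody P.length]
  refine ⟨(Q ++ P'.map (Expr.shift Q.length)) ++ [(searchBody P.length).shift Q.length],
    .ite (.isPair (.fst (.snd (.var 0))))
      (.call (Q ++ P'.map (Expr.shift Q.length)).length e) (.const 0),
    c + (cF + cC) + 2, fun d k n M r m hm hr => ?_⟩
  set N := inputSize M with hN
  have hN100 : 100 ≤ N := by simp [hN, inputSize]
  have hX := treeSize_pos k d
  have hN1 : 1 ≤ N ^ (c + (cF + cC)) := Nat.one_le_pow _ _ (by omega)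
  have hbig : 140 * (N ^ (c + (cF + cC)) * treeSize k d) ≤
      N ^ (c + (cF + cC) + 2) * treeSize k d :=
    calc _ ≤ N ^ 2 * (N ^ (c + (cF + cC)) * treeSize k d) :=
          Nat.mul_le_mul_right _ (by nlinarith)
      _ = _ := by rw [pow_add _ _ 2]; ring
  have hNX : treeSize k d ≤ N ^ (c + (cF + cC)) * treeSize k d := Nat.le_mul_of_pos_left _ hN1
  cases r with
  | nil =>
    have x0 : EvalLe ((Q ++ P'.map (Expr.shift Q.length)) ++ [(searchBody P.length).shift Q.length])
        [enc (((d, k, n, M, ()) : Inst), ([] : List (List ℕ)), m)] (.var 0)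
        (.pair (enc ((d, k, n, M, ()) : Inst)) (.pair (.num 0) (.num m))) 1 := .var0
    have h₁ := x0.snd.fst.isPair.iteFalse (EvalLe.const (n := 0))
      (e₁ := .call (Q ++ P'.map (Expr.shift Q.length)).length e)
    have h₂ : round M k d [] m = [] := rfl
    rw [h₂]
    exact h₁.mono (by omega)
  | cons Y r =>
    have hY : sz (Y :: r) ≤ 2 * M.length + 3 := by
      obtain ⟨Y', h, hY'⟩ := hr.resolve_left (by simp)
      rw [h, sz_cons, sz_list_nat, sz_nil]
      omega
    have h₁ := hstart ((d, k, n, M, ()), Y :: r, m)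
    have hT₁ : T ((d, k, n, M, ()), Y :: r, m) ≤ N ^ (c + (cF + cC)) := by
      refine (hT _).trans ((Nat.pow_le_pow_left ?_ c).trans
        (Nat.pow_le_pow_right (by omega) (by omega)))
      simp only [sz_pair, sz_nat, sz_unit, hN, inputSize] at hY ⊢
      omega
    simp only [upTo_eq hm, length_budget] at h₁
    have h₂ := searchBody_eval (found := found (List.range (m + 1)) M (min (m + 1) k) d)
      (children := children (List.range (m + 1)) M (min (m + 1) k) d) P eF eC
      (List.range (m + 1), M, min (m + 1) k, d) (Sorted (m + 1)) (2 * min (m + 1) k + 2 * d + 6)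
      (N ^ (c + (cF + cC))) (fun s hs => by
        have hsz : sz ((List.range (m + 1), M, min (m + 1) k, d), s) + 2 ≤ N := by
          obtain ⟨H, Y, W, Wu, A, T, U⟩ := s
          obtain ⟨hs₁, hs₂, hs₃, hs₄, hs₅, hs₆, hs₇⟩ := hs
          have := sz_list_nat_le hs₁
          have := sz_list_nat_le hs₂
          have := sz_list_nat_le hs₃
          have := sz_list_nat_le hs₄
          have := sz_list_nat_le hs₅
          have := sz_list_nat_le hs₆
          have := sz_list_nat_le hs₇
          have := sz_list_nat_le (List.Sublist.refl (List.range (m + 1)))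
          simp only [sz_pair, sz_nat, hN, inputSize] at *
          omega
        refine ⟨fun t ht => sorted_of_mem_children hs ht, length_children_le _ _ _ _ _,
          (hF (_, s)).mono ((hTF _).trans ?_), (hC (_, s)).mono ((hTC _).trans ?_)⟩
        · exact (Nat.pow_le_pow_left hsz _).trans (Nat.pow_le_pow_right (by omega) (by omega))
        · exact (Nat.pow_le_pow_left hsz _).trans (Nat.pow_le_pow_right (by omega) (by omega)))
      (depth (min (m + 1) k)) [initial (List.range (m + 1)) (terminalsAt M (Y :: r) m)]
      (by simpa using sorted_initial (terminalsAt_sublist hm))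
    have h₃ := ((h₁.append_right _).append_right _).call List.getElem?_concat_length
      ((h₂.append_left Q).append_right [(searchBody P.length).shift Q.length])
    have hround : round M k d (Y :: r) m = firstHit
        (searchFrom (found (List.range (m + 1)) M (min (m + 1) k) d)
          (children (List.range (m + 1)) M (min (m + 1) k) d) (depth (min (m + 1) k)))
        [initial (List.range (m + 1)) (terminalsAt M (Y :: r) m)] := by
      simp only [round, upTo_eq hm, length_budget, List.isEmpty_cons, cond_false]
    have x0 : EvalLe ((Q ++ P'.map (Expr.shift Q.length)) ++ [(searchBody P.length).shift Q.length])
        [enc (((d, k, n, M, ()) : Inst), Y :: r, m)] (.var 0)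
        (.pair (enc ((d, k, n, M, ()) : Inst)) (.pair (.pair (enc Y) (enc r)) (.num m))) 1 := .var0
    rw [hround]
    refine (x0.snd.fst.isPair.iteTrue (Nat.succ_ne_zero 0) h₃).mono ?_
    have hst := searchTime_le d (N ^ (c + (cF + cC))) (min_le_right (m + 1) k)
    rw [Nat.add_mul, Nat.mul_assoc 2] at hst
    have hT₂ : N ^ (c + (cF + cC)) ≤ N ^ (c + (cF + cC)) * treeSize k d :=
      Nat.le_mul_of_pos_right _ hX
    simp only [List.length_singleton, Nat.one_mul]
    omega

/-- The algorithm on the machine, with its running time. -/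
theorem exists_program : ∃ (P : Program) (c : ℕ), ∀ (d k n : ℕ) (M : List (List Bool)),
    ∃ t ≤ inputSize M ^ c * treeSize k d,
      Runs P (enc ((d, k, n, M, ()) : Inst)) (enc (!(solve M k d).isEmpty)) t := by
  have hstart : PT (fun a : Inst => (a, [([] : List ℕ)], verts a.2.2.2.1)) := by fun_prop
  obtain ⟨P, e, c, h⟩ := exists_round_program
  obtain ⟨Q, e', T, ⟨c', hT⟩, -, hstart⟩ := hstart
  let P' := P ++ [e, foldBody P.length]
  let Q' := (Q ++ P'.map (Expr.shift Q.length)) ++ [(foldBody P.length).shift Q.length]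
  let main : Expr := .isPair (.call (Q ++ P'.map (Expr.shift Q.length)).length e')
  -- The entry point has to be function `0`, so the other functions move by one place.
  refine ⟨[main.shift 1] ++ Q'.map (Expr.shift 1), c + c' + 3, fun d k n M => ?_⟩
  set N := inputSize M with hN
  have hN100 : 100 ≤ N := by simp [hN, inputSize]
  have h₁ := hstart (d, k, n, M, ())
  have hT₁ := hT (d, k, n, M, ())
  have hT₂ : (sz ((d, k, n, M, ()) : Inst) + 2) ^ c' ≤ N ^ c' := by
    refine Nat.pow_le_pow_left ?_ _
    simp only [sz_pair, sz_nat, sz_unit, hN, inputSize]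
    omega
  have h₂ := foldBody_eval P e ((d, k, n, M, ()) : Inst) (round M k d)
    (fun r l => (∀ m ∈ l, m < M.length) ∧
      (r = [] ∨ ∃ Y : List ℕ, r = [Y] ∧ Y.length ≤ M.length))
    (N ^ c * treeSize k d) (fun r m l ⟨hl, hr⟩ => ⟨⟨fun x hx => hl x (by simp [hx]),
      round_eq (hl m (by simp)) r⟩, h d k n M r m (hl m (by simp)) hr⟩)
    (verts M) [[]] ⟨fun m hm => by simpa [verts_eq] using hm, Or.inr ⟨[], rfl, by simp⟩⟩
  have h₃ := (((h₁.append_right _).append_right _).call List.getElem?_concat_length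
      ((h₂.append_left Q).append_right [(foldBody P.length).shift Q.length])).isPair
  obtain ⟨t, ht, h₄⟩ := h₃.append_left [main.shift 1]
  refine ⟨t, ht.trans ?_, main.shift 1, rfl, ?_⟩
  · have hlen : (verts M).length ≤ N := by
      rw [verts_eq, List.length_range, hN, inputSize]
      omega
    have hX := treeSize_pos k d
    have hc : N ^ c ≤ N ^ (c + c') := Nat.pow_le_pow_right (by omega) (by omega)
    have hc' : N ^ c' ≤ N ^ (c + c') := Nat.pow_le_pow_right (by omega) (by omega)
    have h1 : 1 ≤ N ^ (c + c') := Nat.one_le_pow _ _ (by omega)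
    have hB : N ^ (c + c') ≤ N ^ (c + c') * treeSize k d := Nat.le_mul_of_pos_right _ hX
    have hB' : N ^ c * treeSize k d ≤ N ^ (c + c') * treeSize k d := Nat.mul_le_mul_right _ hc
    have hmul : (verts M).length * (N ^ c * treeSize k d + 30) ≤
        N * (31 * (N ^ (c + c') * treeSize k d)) := Nat.mul_le_mul hlen (by omega)
    have hfin : N ^ (c + c' + 3) * treeSize k d =
        N * (N * (N * (N ^ (c + c') * treeSize k d))) := by rw [pow_add]; ring
    rw [hfin]
    generalize N ^ (c + c') * treeSize k d = B at *
    have hNB : 100 * B ≤ N * B := Nat.mul_le_mul_right _ hN100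
    have hNB' : 100 * (N * B) ≤ N * (N * B) := Nat.mul_le_mul_right _ hN100
    have hNB'' : 100 * (N * (N * B)) ≤ N * (N * (N * B)) := Nat.mul_le_mul_right _ hN100
    have : N * (31 * B) = 31 * (N * B) := by ring
    omega
  · have henc : Val.num (enc ((verts M).foldl (round M k d) [[]])).shape =
        enc (!(solve M k d).isEmpty) := by
      rw [← solve]
      cases solve M k d <;> rfl
    rw [← henc]
    exact h₄

end SCCDeletion

namespace SCCDeletion
open RecProg Relation
open RecProg.Enc (enc)

/-! ### Strong components and the encoding of digraphs -/

section
variable {V : Type*} {D : Digraph V} {d : ℕ}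

/-- The strong component of a vertex consists of the vertices that are mutually reachable with it. -/
theorem isStrongComponent_of_mem (v : V) :
    IsStrongComponent D {u | Reachable D u v ∧ Reachable D v u} := by
  refine ⟨⟨⟨v, .refl, .refl⟩, fun u hu w hw => hu.1.trans hw.2⟩, fun T hT hle u hu => ?_⟩
  have hv : v ∈ T := hle ⟨.refl, .refl⟩
  exact ⟨hT.2 u hu v hv, hT.2 v hv u hu⟩

theorem IsStrongComponent.eq {S : Set V} (hS : IsStrongComponent D S) {v : V} (hv : v ∈ S) :
    S = {u | Reachable D u v ∧ Reachable D v u} :=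
  Set.Subset.antisymm (fun u hu => ⟨hS.prop.2 u hu v hv, hS.prop.2 v hv u hu⟩)
    (hS.le_of_ge (isStrongComponent_of_mem v).prop
      fun u hu => ⟨hS.prop.2 u hu v hv, hS.prop.2 v hv u hu⟩)

theorem outDegree_induce {S : Set V} (v : S) :
    outDegree (induce D S) v = {u | D.Adj v u ∧ u ∈ S}.ncard := by
  rw [outDegree, ← Set.ncard_image_of_injective _ Subtype.val_injective]
  congr 1
  ext u
  simp [induce]

theorem strongComponentsOutDegreeLE_iff : StrongComponentsOutDegreeLE D d ↔
    ∀ v, {u | D.Adj v u ∧ Reachable D u v}.ncard ≤ d := by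
  have h (v : V) : {u | D.Adj v u ∧ u ∈ {u | Reachable D u v ∧ Reachable D v u}} =
      {u | D.Adj v u ∧ Reachable D u v} := by
    ext u
    exact ⟨fun h => ⟨h.1, h.2.1⟩, fun h => ⟨h.1, h.2, .single h.1⟩⟩
  constructor
  · intro hD v
    have := hD _ (isStrongComponent_of_mem v) ⟨v, .refl, .refl⟩
    rwa [outDegree_induce, h] at this
  · intro hD S hS v
    have he := h v.1
    rw [← hS.eq v.2] at he
    rw [outDegree_induce, he]
    exact hD v

end

section
variable {n : ℕ}

open Classical in
/-- The adjacency matrix with Boolean entries. -/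
noncomputable def matrix (D : Digraph (Fin n)) : List (List Bool) :=
  List.ofFn fun u => List.ofFn fun v => decide (D.Adj u v)

theorem length_matrix (D : Digraph (Fin n)) : (matrix D).length = n := by simp [matrix]

theorem rel_matrix (D : Digraph (Fin n)) (u v : ℕ) :
    rel (matrix D) u v ↔ ∃ (hu : u < n) (hv : v < n), D.Adj ⟨u, hu⟩ ⟨v, hv⟩ := by
  unfold rel adj matrix
  by_cases hu : u < n
  · by_cases hv : v < n <;> simp [List.getD_eq_getElem?_getD, hu, hv]
  · simp [List.getD_eq_getElem?_getD, hu]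

theorem encodeInstance_eq (d : ℕ) (D : Digraph (Fin n)) (k : ℕ) :
    encodeInstance d D k = enc ((d, k, n, matrix D, ()) : Inst) := by
  have h : encodeDigraph D = enc (matrix D) := by
    simp only [encodeDigraph, matrix, Enc.enc, List.map_ofFn]
    congr 2
    funext u
    simp only [Function.comp, List.map_ofFn]
    congr 2
    funext v
    by_cases h : D.Adj u v <;> simp [Val.ofProp, h]
  rw [encodeInstance, h]
  rfl

theorem ofProp_eq {p : Prop} {b : Bool} (h : b = true ↔ p) : Val.ofProp p = enc b := by
  cases b <;> simp [Val.ofProp, Enc.enc, ← h]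

theorem reachable_deleteVerts_iff (D : Digraph (Fin n)) (X : Finset (Fin n))
    (u v : ((X : Set (Fin n))ᶜ : Set (Fin n))) :
    Reachable (deleteVerts D X) u v ↔
      Rch (rel (matrix D)) (Finset.range n \ X.map Fin.valEmbedding) u.1.1 v.1.1 := by
  have hmem : ∀ w : ℕ, w ∈ Finset.range n \ X.map Fin.valEmbedding ↔
      ∃ hw : w < n, (⟨w, hw⟩ : Fin n) ∉ X := by
    intro w
    simp only [Finset.mem_sdiff, Finset.mem_range, Finset.mem_map, Fin.valEmbedding_apply,
      not_exists, not_and]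
    exact ⟨fun h => ⟨h.1, fun hX => h.2 _ hX rfl⟩,
      fun ⟨hw, hX⟩ => ⟨hw, by rintro x hx rfl; exact hX hx⟩⟩
  constructor
  · refine ReflTransGen.lift (fun w : ((X : Set (Fin n))ᶜ : Set (Fin n)) => w.1.1)
      (fun x y hxy => ?_) u v
    exact ⟨(rel_matrix D _ _).2 ⟨x.1.2, y.1.2, hxy⟩, (hmem _).2 ⟨y.1.2, y.2⟩⟩
  · intro h
    have key : ∀ w, Rch (rel (matrix D)) (Finset.range n \ X.map Fin.valEmbedding) u.1.1 w →
        ∃ w' : ((X : Set (Fin n))ᶜ : Set (Fin n)), w'.1.1 = w ∧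
          Reachable (deleteVerts D X) u w' := by
      intro w hw
      induction hw with
      | refl => exact ⟨u, rfl, .refl⟩
      | tail _ hxy ih =>
        obtain ⟨x, rfl, hx⟩ := ih
        obtain ⟨hy, hyX⟩ := (hmem _).1 hxy.2
        obtain ⟨_, _, hD⟩ := (rel_matrix D _ _).1 hxy.1
        exact ⟨⟨⟨_, hy⟩, hyX⟩, rfl, hx.tail hD⟩
    obtain ⟨w, hw, huw⟩ := key _ h
    rwa [← Subtype.ext (Fin.ext hw)]

theorem strongComponentsOutDegreeLE_deleteVerts_iff (d : ℕ) (D : Digraph (Fin n))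
    (X : Finset (Fin n)) : StrongComponentsOutDegreeLE (deleteVerts D (X : Set (Fin n))) d ↔
      Good (rel (matrix D)) d (Finset.range n \ X.map Fin.valEmbedding) := by
  classical
  have hmem : ∀ w : Fin n, w.1 ∈ Finset.range n \ X.map Fin.valEmbedding ↔ w ∉ X := by
    intro w
    simp only [Finset.mem_sdiff, Finset.mem_range, Finset.mem_map, Fin.valEmbedding_apply,
      not_exists, not_and]
    exact ⟨fun h hX => h.2 _ hX rfl,
      fun hX => ⟨w.2, fun x hx hxw => hX (Fin.ext hxw ▸ hx)⟩⟩
  rw [strongComponentsOutDegreeLE_iff]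
  have hcard (v : ((X : Set (Fin n))ᶜ : Set (Fin n))) :
      {u | (deleteVerts D (X : Set (Fin n))).Adj v u ∧ Reachable (deleteVerts D X) u v}.ncard =
      ((Finset.range n \ X.map Fin.valEmbedding).filter fun u => rel (matrix D) v.1.1 u ∧
        Rch (rel (matrix D)) (Finset.range n \ X.map Fin.valEmbedding) u v.1.1).card := by
    rw [← Set.ncard_image_of_injective _ (Fin.val_injective.comp Subtype.val_injective),
      ← Set.ncard_coe_finset]
    congr 1
    ext u
    simp only [Set.mem_image, Set.mem_ofPred_eq, Function.comp, Finset.coe_filter]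
    constructor
    · rintro ⟨x, ⟨hvx, hxv⟩, rfl⟩
      exact ⟨(hmem _).2 x.2, (rel_matrix D _ _).2 ⟨v.1.2, x.1.2, hvx⟩,
        (reachable_deleteVerts_iff D X x v).1 hxv⟩
    · rintro ⟨hu, hvu, huv⟩
      obtain ⟨_, hun, hD⟩ := (rel_matrix D _ _).1 hvu
      exact ⟨⟨⟨u, hun⟩, (hmem ⟨u, hun⟩).1 hu⟩, ⟨hD, (reachable_deleteVerts_iff D X _ v).2 huv⟩, rfl⟩
  constructor
  · intro h v hv
    have hvn : v < n := Finset.mem_range.1 (Finset.mem_sdiff.1 hv).1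
    have := h ⟨⟨v, hvn⟩, (hmem ⟨v, hvn⟩).1 hv⟩
    rw [hcard] at this
    exact (le_of_eq (by congr)).trans this
  · intro h v
    rw [hcard]
    exact (le_of_eq (by congr)).trans (h v.1.1 ((hmem _).2 v.2))

theorem isYesInstance_iff (d : ℕ) (D : Digraph (Fin n)) (k : ℕ) :
    IsYesInstance d D k ↔ solve (matrix D) k d ≠ [] := by
  rw [solve_ne_nil_iff, length_matrix]
  constructor
  · rintro ⟨X, hXk, hX⟩
    refine ⟨X.map Fin.valEmbedding, fun v hv => ?_, by simpa using hXk,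
      (strongComponentsOutDegreeLE_deleteVerts_iff d D X).1 hX⟩
    obtain ⟨x, -, rfl⟩ := Finset.mem_map.1 hv
    exact Finset.mem_range.2 x.2
  · rintro ⟨X, hX, hXk, hXg⟩
    have hmap : (X.attachFin fun v hv => Finset.mem_range.1 (hX hv)).map Fin.valEmbedding = X := by
      ext v
      simp only [Finset.mem_map, Finset.mem_attachFin, Fin.valEmbedding_apply]
      exact ⟨by rintro ⟨x, hx, rfl⟩; exact hx,
        fun hv => ⟨⟨v, Finset.mem_range.1 (hX hv)⟩, hv, rfl⟩⟩
    refine ⟨X.attachFin fun v hv => Finset.mem_range.1 (hX hv), by simpa using hXk, ?_⟩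
    rw [strongComponentsOutDegreeLE_deleteVerts_iff, hmap]
    exact hXg

/-- The size of the input is quadratic in the number of vertices. -/
theorem inputSize_matrix_le (D : Digraph (Fin n)) :
    inputSize (matrix D) ≤ 200 * (n + 1) ^ 2 := by
  have h : sz (matrix D) ≤ n * (2 * n + 2) + 1 := by
    have := sz_list_le (l := matrix D) (s := 2 * n + 1) fun r hr => by
      obtain ⟨u, rfl⟩ := List.mem_ofFn.1 hr
      have := sz_list_le (l := List.ofFn fun v => @decide (D.Adj u v) (Classical.propDecidable _))
        (s := 1) fun b _ => by simp
      rw [List.length_ofFn] at this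
      omega
    rwa [length_matrix] at this
  rw [inputSize, length_matrix]
  nlinarith

end
end SCCDeletion

namespace SCCDeletion
open RecProg

/-! ### The running time -/

theorem primrec_pow : Primrec₂ fun m n : ℕ => m ^ n :=
  Primrec₂.unpaired'.1 Nat.Primrec.pow

theorem computable_treeSize (C : ℕ) : Computable fun d => C * treeSize d d := by
  have hm : ∀ {f g : ℕ → ℕ}, Primrec f → Primrec g → Primrec fun d => f d * g d :=
    fun hf hg => Primrec.nat_mul.comp hf hg
  have ha : ∀ {f g : ℕ → ℕ}, Primrec f → Primrec g → Primrec fun d => f d + g d :=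
    fun hf hg => Primrec.nat_add.comp hf hg
  have hp : ∀ {f g : ℕ → ℕ}, Primrec f → Primrec g → Primrec fun d => f d ^ g d :=
    fun hf hg => primrec_pow.comp hf hg
  have hc : ∀ c : ℕ, Primrec fun _ : ℕ => c := Primrec.const
  have hd : Primrec fun d : ℕ => d := .id
  exact (hm (hc C) (hp (ha (ha (hm (hc 2) hd) (hm (hc 2) hd)) (hc 8))
    (ha (ha (hm (hc 8) (hp hd (hc 2))) (hm (hc 26) hd)) (hc 18)))).to_comp

theorem treeSize_mono {k k' d d' : ℕ} (hk : k ≤ k') (hd : d ≤ d') :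
    treeSize k d ≤ treeSize k' d' := by
  have h₁ : depth k ≤ depth k' := by unfold depth; gcongr
  exact (Nat.pow_le_pow_left (by omega) _).trans (Nat.pow_le_pow_right (by omega) h₁)

theorem treeSize_le_pow {k d : ℕ} (hk : 2 ≤ k) (hkd : d < k) :
    treeSize k d ≤ k ^ (104 * k ^ 3) := by
  have hbase : 2 * k + 2 * d + 8 ≤ k ^ 4 := by
    have h₁ := Nat.mul_le_mul_right k (Nat.pow_le_pow_left hk 3)
    rw [← pow_succ] at h₁
    norm_num only at h₁
    omega
  have hexp : 4 * depth k ≤ 104 * k ^ 3 := by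
    have h₁ := Nat.mul_le_mul_left (k ^ 2) hk
    have h₂ := Nat.mul_le_mul_left k hk
    rw [← pow_succ] at h₁
    norm_num only at h₁
    rw [← pow_two] at h₂
    unfold depth
    omega
  calc treeSize k d ≤ (k ^ 4) ^ depth k := Nat.pow_le_pow_left hbase _
    _ = k ^ (4 * depth k) := (pow_mul _ _ _).symm
    _ ≤ _ := Nat.pow_le_pow_right (by omega) hexp

/-- The search tree is bounded by a function of `d` if `k ≤ d`, and otherwise its degree is linear
and its depth quadratic in `k`. The remaining case `k = 1`, `d = 0`, where `k ^ 3 * log k` vanishes, is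
covered by the constant `10 ^ 52 = treeSize 1 0`. -/
theorem treeSize_le (k d : ℕ) :
    (treeSize k d : ℝ) ≤ (10 ^ 52 * treeSize d d : ℕ) *
      (2 : ℝ) ^ ((104 : ℕ) * ((k : ℝ) ^ 3 * Real.logb 2 k)) := by
  have hlog : (0 : ℝ) ≤ Real.logb 2 k := by
    rcases Nat.eq_zero_or_pos k with rfl | hk
    · simp
    · exact Real.logb_nonneg (by norm_num) (by exact_mod_cast hk)
  have hone : (1 : ℝ) ≤ (2 : ℝ) ^ ((104 : ℕ) * ((k : ℝ) ^ 3 * Real.logb 2 k)) :=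
    Real.one_le_rpow (by norm_num) (by positivity)
  have hd := treeSize_pos d d
  by_cases hcase : treeSize k d ≤ 10 ^ 52 * treeSize d d
  · calc (treeSize k d : ℝ) ≤ (10 ^ 52 * treeSize d d : ℕ) := by exact_mod_cast hcase
      _ ≤ _ := le_mul_of_one_le_right (Nat.cast_nonneg _) hone
  have hkd : d < k := by
    by_contra hcon
    have := treeSize_mono (not_lt.1 hcon) (le_refl d)
    exact hcase (this.trans (Nat.le_mul_of_pos_left _ (by positivity)))
  have hk2 : 2 ≤ k := by
    by_contra hcon
    obtain rfl : k = 1 := by omega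
    obtain rfl : d = 0 := by omega
    refine hcase (le_trans ?_ (Nat.le_mul_of_pos_right _ hd))
    simp [treeSize, depth]
  have hnat := treeSize_le_pow hk2 hkd
  have hkpos : (0 : ℝ) < k := by exact_mod_cast (by omega : 0 < k)
  have hpow : (2 : ℝ) ^ ((104 : ℕ) * ((k : ℝ) ^ 3 * Real.logb 2 k)) =
      (k ^ (104 * k ^ 3) : ℕ) := by
    have : ((104 : ℕ) : ℝ) * ((k : ℝ) ^ 3 * Real.logb 2 k) =
        Real.logb 2 k * (104 * k ^ 3 : ℕ) := by push_cast; ring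
    rw [this, Real.rpow_mul (by norm_num), Real.rpow_logb (by norm_num) (by norm_num) hkpos,
      Real.rpow_natCast]
    push_cast
    rfl
  calc (treeSize k d : ℝ) ≤ (k ^ (104 * k ^ 3) : ℕ) := by exact_mod_cast hnat
    _ = (2 : ℝ) ^ ((104 : ℕ) * ((k : ℝ) ^ 3 * Real.logb 2 k)) := hpow.symm
    _ ≤ _ := le_mul_of_one_le_left (by positivity) (by
      exact_mod_cast Nat.one_le_iff_ne_zero.2 (by positivity))

end SCCDeletion

theorem theorem2 :
    ∃ (P : RecProg.Program) (f : ℕ → ℕ) (a c : ℕ), Computable f ∧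
      ∀ (d n : ℕ) (D : Digraph (Fin n)) (k : ℕ),
        ∃ t : ℕ,
          RecProg.Runs P (SCCDeletion.encodeInstance d D k)
            (RecProg.Val.ofProp (SCCDeletion.IsYesInstance d D k)) t ∧
          (t : ℝ) ≤ (f d : ℝ) * (2 : ℝ) ^ ((a : ℝ) * ((k : ℝ) ^ 3 * Real.logb 2 (k : ℝ)))
            * ((n : ℝ) + 1) ^ c := by
  obtain ⟨P, c, h⟩ := SCCDeletion.exists_program
  refine ⟨P, _, 104, 2 * c, SCCDeletion.computable_treeSize (200 ^ c * 10 ^ 52),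
    fun d n D k => ?_⟩
  obtain ⟨t, ht, hrun⟩ := h d k n (SCCDeletion.matrix D)
  refine ⟨t, ?_, ?_⟩
  · rw [SCCDeletion.encodeInstance_eq, SCCDeletion.ofProp_eq
      (b := !(SCCDeletion.solve (SCCDeletion.matrix D) k d).isEmpty)]
    · exact hrun
    · rw [SCCDeletion.isYesInstance_iff]
      simp
  · have h₁ : SCCDeletion.inputSize (SCCDeletion.matrix D) ^ c ≤ 200 ^ c * (n + 1) ^ (2 * c) := by
      rw [pow_mul, ← mul_pow]
      exact Nat.pow_le_pow_left (SCCDeletion.inputSize_matrix_le D) c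
    have h₂ := SCCDeletion.treeSize_le k d
    calc (t : ℝ) ≤ (200 ^ c * (n + 1) ^ (2 * c) : ℕ) * (SCCDeletion.treeSize k d : ℝ) := by
          exact_mod_cast ht.trans (Nat.mul_le_mul_right _ h₁)
      _ ≤ _ := mul_le_mul_of_nonneg_left h₂ (Nat.cast_nonneg _)
      _ = _ := by push_cast; ring
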